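/- Let $K$ be a field of characteristic $0$ and let $A$, $B$ be $K$-vector spaces. Let $\mathfrak g=\bigoplus_{n\ge 0}\mathfrak g_n$, $\mathfrak g_n=\mathrm{Hom}((A\oplus B)^{\otimes n+1},A\oplus B)$, be the graded Lie algebra with the Gerstenhaber bracket: for $f\in\mathfrak g_m$, $g\in\mathfrak g_n$, $[f,g]=f\diamond g-(-1)^{mn}g\diamond f$, where $$(f\diamond g)(a_1,\dots,a_{m+n+1})=\sum_{i=1}^{m+1}(-1)^{(i-1)n}f(a_1,\dots,a_{i-1},g(a_i,\dots,a_{i+n}),a_{i+n+1},\dots,a_{m+n+1}).$$ Let $\mathcal A^{p,q}$ be the sum of all tensor products of $p$ copies of $A$ and $q$ copies of $B$ in any order, and for $k+l=n$, $k,l\ge -1$, let $C^{k|l}\subset\mathfrak g_n$ be the space of maps $f$ with $f(\mathcal A^{k+1,l})\subset A$, $f(\mathcal A^{k,l+1})\subset B$ and $f=0$ on all other $\mathcal A^{p,q}$, $p+q=n+1$. Put $\mathscr Q=\bigoplus_{n\ge0}\mathscr Q_n$ with $\mathscr Q_n=C^{n+1|-1}\oplus C^{n|0}\oplus\cdots\oplus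 C^{0|n}$, which is a graded Lie subalgebra of $\mathfrak g$, and $\mathfrak b=\bigoplus_{n\ge 0}\mathfrak b_n$ with $\mathfrak b_n=\mathrm{Hom}(B^{\otimes n+1},A)\subset\mathfrak g_n$, and let $P:\mathfrak g\to\mathfrak b$ be the projection. The degree $d$ part of $\mathscr Q[1]\oplus\mathfrak b$ is $\mathscr Q_{d+1}\oplus\mathfrak b_d$. An $L_\infty$-algebra is a $\mathbb Z$-graded vector space with graded symmetric multilinear operations $l_k$, $k\ge1$, all of degree $1$, such that for all $N$ and all homogeneous $x_1,\dots,x_N$ $$\sum_{i=1}^{N}\ \sum_{\sigma\in Sh(i,N-i)}\epsilon(\sigma)\,l_{N-i+1}\big(l_i(x_{\sigma(1)},\dots,x_{\sigma(i)}),x_{\sigma(i+1)},\dots,x_{\sigma(N)}\big)=0,$$ with $\epsilon(\sigma)$ the Koszul sign. It is weakly filtered if there are a descending filtration by graded subspaces $F_1\supset F_2\supset\cdots$, with $F_1$ the whole space, which is complete in the graded sense, and an index $N$ such that $l_k$ takes values in $F_k$ for all $k\ge N$. A Maurer–Cartan element is a degree $0$ element $\alpha$ with $\sum_{k\ge1}\frac1{k!}l_k(\alpha,\dots,\alpha)=0$.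 Given bilinear maps $\mu:A\times A\to A$, $(a,b)\mapsto a\cdot_A b$; $\nu:B\times B\to B$, $(x,y)\mapsto x\cdot_B y$; $\vartriangleright:A\times B\to B$; $\vartriangleleft:B\times A\to B$; $\rightharpoonup:B\times A\to A$; $\leftharpoonup:A\times B\to A$; $\theta:A\times A\to B$, let $\Omega\in\mathscr Q_1$ be the bilinear map $$\Omega\big((a,x),(b,y)\big)=\big(a\cdot_A b+a\leftharpoonup y+x\rightharpoonup b,\ x\cdot_B y+a\vartriangleright y+x\vartriangleleft b+\theta(a,b)\big).$$ The tuple $(A_\mu,B_\nu,\vartriangleright,\vartriangleleft,\rightharpoonup,\leftharpoonup,\theta)$ is a quasi-twilled associative algebra if $A\oplus B$ with the product $\Omega$ is an associative algebra (in which $B$ is then a subalgebra). A linear map $r:B\to A$ is a weak deformation map in it if for all $x,y\in B$ $$r(x)\cdot_A r(y)+r(x)\leftharpoonup y+x\rightharpoonup r(y)=r\big(x\cdot_B y+r(x)\vartriangleright y+x\vartriangleleft r(y)+\theta(r(x),r(y))\big).$$ **Theorem.** (i) $\mathscr Q[1]\oplus\mathfrak b$ is a weakly filtered $L_\infty$-algebra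 with the structure maps $$\widetilde l_2(F[1],G[1])=(-1)^{|F|}[F,G][1],\qquad \widetilde l_k(F[1],f_1,\dots,f_{k-1})=P[\cdots[[F,f_1],f_2],\dots,f_{k-1}]\quad(k\ge2)$$ for homogeneous $F,G\in\mathscr Q$ and $f_1,\dots,f_{k-1}\in\mathfrak b$, where, up to permutations of the entries, all other structure maps (in particular $\widetilde l_1$) vanish. (ii) Every element of degree $0$ of $\mathscr Q[1]\oplus\mathfrak b$ is $(\Omega[1],r)$ for exactly one tuple of bilinear maps as above and exactly one linear map $r:B\to A$. The tuple $(A_\mu,B_\nu,\vartriangleright,\vartriangleleft,\rightharpoonup,\leftharpoonup,\theta)$ is a quasi-twilled associative algebra and $r$ is a weak deformation map in it if and only if $(\Omega[1],r)$ is a Maurer–Cartan element of $(\mathscr Q[1]\oplus\mathfrak b,\{\widetilde l_k\}_{k\ge1})$. (iii) Suppose that the tuple is a quasi-twilled associative algebra and $r$ is a weak deformation map in it, and put $\alpha=(\Omega[1],r)$. Then the operations $$\widetilde l_k^{\,\alpha}(X_1,\dots,X_k)=\sum_{n\ge0}\frac1{n!}\,\widetilde l_{n+k}(\underbrace{\alpha,\dots,\alpha}_{n},X_1,\dots,X_k),\qquad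 k\ge1,$$ where only finitely many terms of each sum are non-zero, make $\mathscr Q[1]\oplus\mathfrak b$ a weakly filtered $L_\infty$-algebra. Moreover, for all $\Omega'\in\mathscr Q_1$ and all linear maps $r':B\to A$, the sum $\Omega+\Omega'$ is the product of a quasi-twilled associative algebra on $A\oplus B$ in which $r+r'$ is a weak deformation map if and only if $(\Omega'[1],r')$ is a Maurer–Cartan element of $(\mathscr Q[1]\oplus\mathfrak b,\{\widetilde l_k^{\,\alpha}\}_{k\ge1})$. -/

import Mathlib

open scoped DirectSum

noncomputable section

namespace QuasiTwilled

/-! ### Graded `L_∞`-algebras (symmetric convention, all operations of degree `1`) -/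

section LInfinity

variable (K : Type*) [Field K] {V : Type*} [AddCommGroup V] [Module K V]

/-- The Koszul sign `ε(σ)` of homogeneous elements `x_1, …, x_N` of degrees `d_1, …, d_N`, defined by
`x_1 ⋯ x_N = ε(σ) x_{σ(1)} ⋯ x_{σ(N)}` in the free graded commutative algebra: every inversion of
`σ` contributes the sign `(-1)^{d d'}` of the two elements which are exchanged. -/
def koszulSign {N : ℕ} (d : Fin N → ℤ) (σ : Equiv.Perm (Fin N)) : K :=
  ∏ p : Fin N × Fin N with p.1 < p.2 ∧ σ p.2 < σ p.1, (-1 : K) ^ (d (σ p.1) * d (σ p.2))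

/-- `(i, N - i)`-shuffles: permutations with `σ(1) < ⋯ < σ(i)` and `σ(i+1) < ⋯ < σ(N)`. -/
def shuffles (i N : ℕ) : Finset (Equiv.Perm (Fin N)) :=
  {σ | (∀ a b : Fin N, a < b → b.val < i → σ a < σ b) ∧
       (∀ a b : Fin N, a < b → i ≤ a.val → σ a < σ b)}

variable (𝒢 : ℤ → Submodule K V) (l : ∀ k : ℕ, (Fin k → V) → V)

/-- The operations `l_k` (`k ≥ 1`) make `V = ⨁_d 𝒢 d` an `L_∞`-algebra (with `l_0 = 0`). -/
structure IsLInfinity : Prop where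
  grading : DirectSum.IsInternal 𝒢
  multilinear : ∀ k, ∃ L : MultilinearMap K (fun _ : Fin k => V) V, ∀ x, L x = l k x
  curvature_zero : ∀ x, l 0 x = 0
  degree_one : ∀ (k : ℕ) (d : Fin k → ℤ) (x : Fin k → V), (∀ i, x i ∈ 𝒢 (d i)) →
    l k x ∈ 𝒢 (∑ i, d i + 1)
  symmetric : ∀ (k : ℕ) (d : Fin k → ℤ) (x : Fin k → V), (∀ i, x i ∈ 𝒢 (d i)) →
    ∀ σ : Equiv.Perm (Fin k), l k (fun i => x (σ i)) = koszulSign K d σ • l k x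
  jacobi : ∀ (N : ℕ) (d : Fin N → ℤ) (x : Fin N → V), (∀ i, x i ∈ 𝒢 (d i)) →
    ∑ i : Fin (N + 1), ∑ σ ∈ shuffles i.val N, koszulSign K d σ •
      l (N - i.val + 1) (Fin.cons
        (l i.val (fun j : Fin i.val => x (σ ⟨j.val, by omega⟩)))
        (fun j : Fin (N - i.val) => x (σ ⟨i.val + j.val, by omega⟩))) = 0

/-- There are a complete descending filtration `V = F_1 ⊇ F_2 ⊇ ⋯` by graded subspaces and an
index `N` such that `l_k` takes values in `F_k` for all `k ≥ N`.  Completeness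
`V = lim V / F_k` is that of graded vector spaces, i.e. `𝒢 d = lim 𝒢 d / (F_k ∩ 𝒢 d)` for all `d`:
each coherent sequence of classes is the sequence of classes of exactly one element. -/
def IsWeaklyFiltered : Prop :=
  ∃ F : ℕ → Submodule K V,
    F 1 = ⊤ ∧ (∀ k, 1 ≤ k → F (k + 1) ≤ F k) ∧
    (∀ k, 1 ≤ k → F k = ⨆ d, F k ⊓ 𝒢 d) ∧
    (∀ (d : ℤ) (u : ℕ → V), (∀ k, u k ∈ 𝒢 d) → (∀ k, 1 ≤ k → u (k + 1) - u k ∈ F k) →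
      ∃! v, v ∈ 𝒢 d ∧ ∀ k, 1 ≤ k → v - u k ∈ F k) ∧
    ∃ N : ℕ, ∀ k, N ≤ k → 1 ≤ k → ∀ x, l k x ∈ F k

/-- `α` has degree `0` and `∑_{k ≥ 1} (1 / k!) l_k(α, …, α) = 0`, where the sum is finite. -/
structure IsMaurerCartan (α : V) : Prop where
  degree_zero : α ∈ 𝒢 0
  finite : (Function.support fun k : ℕ =>
    (((k + 1).factorial : K)⁻¹) • l (k + 1) (fun _ => α)).Finite
  equation : ∑ᶠ k : ℕ, (((k + 1).factorial : K)⁻¹) • l (k + 1) (fun _ => α) = 0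

/-- The `n`-th term `(1 / n!) l_{n+k}(α, …, α, x_1, …, x_k)` of the twisted operation. -/
def twistTerm (α : V) (k : ℕ) (x : Fin k → V) (n : ℕ) : V :=
  ((n.factorial : K)⁻¹) • l (n + k) (Fin.append (fun _ : Fin n => α) x)

/-- The operations `l_k^α(x_1, …, x_k) = ∑_n (1 / n!) l_{n+k}(α, …, α, x_1, …, x_k)`, `k ≥ 1`. -/
def twist (α : V) : ∀ k : ℕ, (Fin k → V) → V
  | 0, _ => 0
  | k + 1, x => ∑ᶠ n : ℕ, twistTerm K l α (k + 1) x n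

end LInfinity

/-! ### The Gerstenhaber bracket -/

section Gerstenhaber

variable (K : Type*) [Field K] (W : Type*) [AddCommGroup W] [Module K W]

/-- `Hom(W^{⊗ n+1}, W)`, the homogeneous part of degree `n`. -/
abbrev Multi (n : ℕ) : Type _ := MultilinearMap K (fun _ : Fin (n + 1) => W) W

/-- `⨁_{n ≥ 0} Hom(W^{⊗ n+1}, W)`. -/
abbrev Gerst : Type _ := ⨁ n : ℕ, Multi K W n

variable {K W}

set_option linter.unusedSectionVars false

/-- The arguments `(a_i, …, a_{i+n})` of the inner map. -/
def innerArgs {m n : ℕ} (i : Fin (m + 1)) (a : Fin (m + n + 1) → W) : Fin (n + 1) → W :=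
  fun t => a ⟨i.val + t.val, by omega⟩

/-- The arguments `(a_0, …, a_{i-1}, c, a_{i+n+1}, …, a_{m+n})` of the outer map. -/
def outerArgs {m n : ℕ} (i : Fin (m + 1)) (c : W) (a : Fin (m + n + 1) → W) : Fin (m + 1) → W :=
  fun j => if j < i then a ⟨j.val, by omega⟩ else if j = i then c else a ⟨j.val + n, by omega⟩

theorem innerArgs_update_of_lt {m n : ℕ} (i : Fin (m + 1)) (a : Fin (m + n + 1) → W)
    (p : Fin (m + n + 1)) (v : W) (h : p.val < i.val ∨ i.val + n < p.val) :
    innerArgs i (Function.update a p v) = innerArgs i a := by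
  funext t
  simp only [innerArgs]
  rw [Function.update_of_ne]
  intro hp
  have := congrArg Fin.val hp
  simp at this
  omega

theorem innerArgs_update_of_mem {m n : ℕ} (i : Fin (m + 1)) (a : Fin (m + n + 1) → W)
    (p : Fin (m + n + 1)) (v : W) (h1 : i.val ≤ p.val) (h2 : p.val ≤ i.val + n) :
    innerArgs i (Function.update a p v) =
      Function.update (innerArgs i a) ⟨p.val - i.val, by omega⟩ v := by
  funext t
  simp only [innerArgs, Function.update_apply, Fin.ext_iff]
  have : (i.val + t.val = p.val) ↔ (t.val = p.val - i.val) := by omega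
  simp [this]

theorem outerArgs_update_of_mem {m n : ℕ} (i : Fin (m + 1)) (c : W) (a : Fin (m + n + 1) → W)
    (p : Fin (m + n + 1)) (v : W) (h1 : i.val ≤ p.val) (h2 : p.val ≤ i.val + n) :
    outerArgs i c (Function.update a p v) = outerArgs i c a := by
  funext j
  simp only [outerArgs, Function.update_apply, Fin.ext_iff, Fin.lt_def]
  split_ifs <;> first | rfl | omega

theorem outerArgs_update_of_lt {m n : ℕ} (i : Fin (m + 1)) (c : W) (a : Fin (m + n + 1) → W)
    (p : Fin (m + n + 1)) (v : W) (h : p.val < i.val) :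
    outerArgs i c (Function.update a p v) =
      Function.update (outerArgs i c a) ⟨p.val, by omega⟩ v := by
  funext j
  simp only [outerArgs, Function.update_apply, Fin.ext_iff, Fin.lt_def]
  split_ifs <;> first | rfl | omega

theorem outerArgs_update_of_gt {m n : ℕ} (i : Fin (m + 1)) (c : W) (a : Fin (m + n + 1) → W)
    (p : Fin (m + n + 1)) (v : W) (h : i.val + n < p.val) :
    outerArgs i c (Function.update a p v) =
      Function.update (outerArgs i c a) ⟨p.val - n, by omega⟩ v := by
  funext j
  simp only [outerArgs, Function.update_apply, Fin.ext_iff, Fin.lt_def]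
  split_ifs <;> first | rfl | omega

theorem outerArgs_eq_update {m n : ℕ} (i : Fin (m + 1)) (c : W) (a : Fin (m + n + 1) → W) :
    outerArgs i c a = Function.update (outerArgs i 0 a) i c := by
  funext j
  simp only [outerArgs, Function.update_apply, Fin.ext_iff, Fin.lt_def]
  split_ifs <;> first | rfl | omega

/-- `f(a_0, …, a_{i-1}, g(a_i, …, a_{i+n}), a_{i+n+1}, …, a_{m+n})`. -/
def insertAt {m n : ℕ} (i : Fin (m + 1)) (f : Multi K W m) (g : Multi K W n) :
    Multi K W (m + n) :=
  MultilinearMap.mk' (fun a => f (outerArgs i (g (innerArgs i a)) a))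
    (fun a p v w => by
      rcases lt_or_ge p.val i.val with h | h
      · simp only [innerArgs_update_of_lt i a p _ (Or.inl h), outerArgs_update_of_lt i _ a p _ h,
          MultilinearMap.map_update_add]
      · rcases le_or_gt p.val (i.val + n) with h' | h'
        · simp only [innerArgs_update_of_mem i a p _ h h', outerArgs_update_of_mem i _ a p _ h h',
            MultilinearMap.map_update_add]
          rw [outerArgs_eq_update, MultilinearMap.map_update_add,
            ← outerArgs_eq_update, ← outerArgs_eq_update]
        · simp only [innerArgs_update_of_lt i a p _ (Or.inr h'),
            outerArgs_update_of_gt i _ a p _ h', MultilinearMap.map_update_add])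
    (fun a p c v => by
      rcases lt_or_ge p.val i.val with h | h
      · simp only [innerArgs_update_of_lt i a p _ (Or.inl h), outerArgs_update_of_lt i _ a p _ h,
          MultilinearMap.map_update_smul]
      · rcases le_or_gt p.val (i.val + n) with h' | h'
        · simp only [innerArgs_update_of_mem i a p _ h h', outerArgs_update_of_mem i _ a p _ h h',
            MultilinearMap.map_update_smul]
          rw [outerArgs_eq_update, MultilinearMap.map_update_smul, ← outerArgs_eq_update]
        · simp only [innerArgs_update_of_lt i a p _ (Or.inr h'),
            outerArgs_update_of_gt i _ a p _ h', MultilinearMap.map_update_smul])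

theorem insertAt_apply {m n : ℕ} (i : Fin (m + 1)) (f : Multi K W m) (g : Multi K W n)
    (a : Fin (m + n + 1) → W) :
    insertAt i f g a = f (outerArgs i (g (innerArgs i a)) a) := rfl

/-- `f ⋄ g` for `f` of degree `m` and `g` of degree `n`; positions are counted from `0`. -/
def circ (m n : ℕ) : Multi K W m →ₗ[K] Multi K W n →ₗ[K] Multi K W (m + n) :=
  LinearMap.mk₂ K (fun f g => ∑ i : Fin (m + 1), (-1 : K) ^ (i.val * n) • insertAt i f g)
    (fun f f' g => by
      rw [← Finset.sum_add_distrib]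
      refine Finset.sum_congr rfl fun i _ => ?_
      rw [← smul_add]
      congr 1)
    (fun c f g => by
      rw [Finset.smul_sum]
      refine Finset.sum_congr rfl fun i _ => ?_
      rw [smul_comm]
      congr 1)
    (fun f g g' => by
      rw [← Finset.sum_add_distrib]
      refine Finset.sum_congr rfl fun i _ => ?_
      rw [← smul_add]
      congr 1
      ext a
      simp only [insertAt_apply, _root_.add_apply]
      rw [outerArgs_eq_update, MultilinearMap.map_update_add,
        ← outerArgs_eq_update, ← outerArgs_eq_update])
    (fun c f g => by
      rw [Finset.smul_sum]
      refine Finset.sum_congr rfl fun i _ => ?_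
      rw [smul_comm]
      congr 1
      ext a
      simp only [insertAt_apply, _root_.smul_apply]
      rw [outerArgs_eq_update, MultilinearMap.map_update_smul, ← outerArgs_eq_update])

/-- The bracket `[f, g] = f ⋄ g - (-1)^{mn} g ⋄ f` of homogeneous elements of degrees `m`, `n`. -/
def bracketHom (m n : ℕ) : Multi K W m →ₗ[K] Multi K W n →ₗ[K] Gerst K W :=
  LinearMap.mk₂ K
    (fun f g => DirectSum.lof K ℕ (Multi K W) (m + n) (circ m n f g) -
      (-1 : K) ^ (m * n) • DirectSum.lof K ℕ (Multi K W) (n + m) (circ n m g f))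
    (fun f f' g => by simp only [map_add, LinearMap.add_apply]; module)
    (fun c f g => by simp only [map_smul, LinearMap.smul_apply]; module)
    (fun f g g' => by simp only [map_add, LinearMap.add_apply]; module)
    (fun c f g => by simp only [map_smul, LinearMap.smul_apply]; module)

variable (K W) in
/-- The Gerstenhaber bracket. -/
def bracket : Gerst K W →ₗ[K] Gerst K W →ₗ[K] Gerst K W :=
  DirectSum.toModule K ℕ _ fun m =>
    (DirectSum.toModule K ℕ _ fun n => (bracketHom m n).flip).flip

theorem bracket_lof (m n : ℕ) (f : Multi K W m) (g : Multi K W n) :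
    bracket K W (DirectSum.lof K ℕ _ m f) (DirectSum.lof K ℕ _ n g) =
      DirectSum.lof K ℕ _ (m + n) (circ m n f g) -
        (-1 : K) ^ (m * n) • DirectSum.lof K ℕ _ (n + m) (circ n m g f) := by
  simp [bracket, bracketHom]

/-- The linear map `F ↦ (-1)^{|F|} F`. -/
def parity : Gerst K W →ₗ[K] Gerst K W :=
  DirectSum.lmap fun n => (-1 : K) ^ n • LinearMap.id

end Gerstenhaber

/-! ### The bidegree, the subalgebra `𝒬` and the abelian subalgebra `𝔟` -/

section Spaces

variable (K : Type*) [Field K] (A B : Type*) [AddCommGroup A] [Module K A]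
  [AddCommGroup B] [Module K B]

/-- `C^{k|l} ⊆ Hom((A ⊕ B)^{⊗ n+1}, A ⊕ B)`, where `l = n - k`: the maps `f` which send
`𝒜^{k+1,l}` to `A` and `𝒜^{k,l+1}` to `B` and vanish on all other `𝒜^{p,q}`, `p + q = n + 1`.
Here `𝒜^{p,q}` is spanned by the tensors `v` with entries from `A` at the positions in a set `s`
with `p` elements and entries from `B` at the other `q` positions. -/
def bidegree (n : ℕ) (k : ℤ) : Submodule K (Multi K (A × B) n) where
  carrier := {f | ∀ (s : Finset (Fin (n + 1))) (v : Fin (n + 1) → A × B),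
    (∀ i ∈ s, (v i).2 = 0) → (∀ i ∉ s, (v i).1 = 0) →
      ((s.card : ℤ) = k + 1 → (f v).2 = 0) ∧
      ((s.card : ℤ) = k → (f v).1 = 0) ∧
      ((s.card : ℤ) ≠ k + 1 → (s.card : ℤ) ≠ k → f v = 0)}
  add_mem' := by
    intro f g hf hg s v h1 h2
    obtain ⟨a1, a2, a3⟩ := hf s v h1 h2
    obtain ⟨b1, b2, b3⟩ := hg s v h1 h2
    refine ⟨fun h => ?_, fun h => ?_, fun h h' => ?_⟩
    · simp [a1 h, b1 h]
    · simp [a2 h, b2 h]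
    · simp [a3 h h', b3 h h']
  zero_mem' := by
    intro s v _ _
    simp
  smul_mem' := by
    intro c f hf s v h1 h2
    obtain ⟨a1, a2, a3⟩ := hf s v h1 h2
    refine ⟨fun h => ?_, fun h => ?_, fun h h' => ?_⟩
    · simp [a1 h]
    · simp [a2 h]
    · simp [a3 h h']

/-- `𝒬_n = C^{n+1|-1} ⊕ C^{n|0} ⊕ ⋯ ⊕ C^{0|n}`. -/
def homQ (n : ℕ) : Submodule K (Multi K (A × B) n) :=
  ⨆ k ∈ Finset.Icc (0 : ℤ) (n + 1), bidegree K A B n k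

variable {K A B}

theorem mem_homQ_iff {n : ℕ} (f : Multi K (A × B) n) :
    f ∈ homQ K A B n ↔ ∀ v : Fin (n + 1) → B, (f (fun i => ((0 : A), v i))).1 = 0 := by
  constructor
  · intro hf v
    let S : Submodule K (Multi K (A × B) n) :=
      { carrier := {f | (f (fun i => ((0 : A), v i))).1 = 0}
        add_mem' := by
          intro f g hf hg
          simp only [Set.mem_ofPred_eq] at hf hg ⊢
          simp [hf, hg]
        zero_mem' := by simp
        smul_mem' := by
          intro c f hf
          simp only [Set.mem_ofPred_eq] at hf ⊢
          simp [hf] }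
    have hle : homQ K A B n ≤ S := by
      refine iSup₂_le fun k hk g hg => ?_
      rw [Finset.mem_Icc] at hk
      obtain ⟨-, h2, h3⟩ := hg ∅ (fun i => ((0 : A), v i)) (by simp) (by simp)
      show (g (fun i => ((0 : A), v i))).1 = 0
      rcases eq_or_ne k 0 with h | h
      · exact h2 (by simp [h])
      · rw [h3 (by simp; omega) (by simpa using h.symm)]
        rfl
    exact hle hf
  · intro hf
    let e : Finset (Fin (n + 1)) → Fin (n + 1) → (A × B →ₗ[K] A × B) := fun s i =>
      if i ∈ s then LinearMap.inl K A B ∘ₗ LinearMap.fst K A B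
      else LinearMap.inr K A B ∘ₗ LinearMap.snd K A B
    have key : ∀ (s t : Finset (Fin (n + 1))) (v : Fin (n + 1) → A × B),
        (∀ i ∈ t, (v i).2 = 0) → (∀ i ∉ t, (v i).1 = 0) → t ≠ s →
          f.compLinearMap (e s) v = 0 := by
      intro s t v h1 h2 hts
      have hex : ∃ i, ¬ (i ∈ t ↔ i ∈ s) := by
        by_contra hcon
        push Not at hcon
        exact hts (Finset.ext hcon)
      obtain ⟨i, hi⟩ := hex
      rw [MultilinearMap.compLinearMap_apply]
      refine MultilinearMap.map_coord_zero _ i ?_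
      by_cases hs : i ∈ s
      · have : i ∉ t := fun h => hi (by simp [h, hs])
        simp [e, hs, h2 i this]
      · have : i ∈ t := by
          by_contra h
          exact hi (by simp [h, hs])
        simp [e, hs, h1 i this]
    have hsum : f = ∑ s : Finset (Fin (n + 1)), f.compLinearMap (e s) := by
      ext1 v
      have hv : v = (fun i => ((v i).1, (0 : B))) + (fun i => ((0 : A), (v i).2)) := by
        funext i
        simp
      conv_lhs => rw [hv, MultilinearMap.map_add_univ]
      rw [_root_.sum_apply]
      refine Finset.sum_congr rfl fun s _ => ?_
      rw [MultilinearMap.compLinearMap_apply]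
      congr 1
      funext i
      by_cases hs : i ∈ s <;> simp [e, hs]
    rw [hsum]
    refine Submodule.sum_mem _ fun s _ => ?_
    have hsplit : f.compLinearMap (e s) =
        (LinearMap.inl K A B ∘ₗ LinearMap.fst K A B).compMultilinearMap (f.compLinearMap (e s)) +
        (LinearMap.inr K A B ∘ₗ LinearMap.snd K A B).compMultilinearMap
          (f.compLinearMap (e s)) := by
      ext1 v
      simp
    have hcard : s.card ≤ n + 1 := by simpa using s.card_le_univ
    rw [hsplit]
    refine Submodule.add_mem _ ?_ ?_
    · rcases Finset.eq_empty_or_nonempty s with hs | hs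
      · have : (LinearMap.inl K A B ∘ₗ LinearMap.fst K A B).compMultilinearMap
            (f.compLinearMap (e s)) = 0 := by
          ext1 v
          have := hf (fun i => (v i).2)
          simp [e, hs, this]
        rw [this]
        exact Submodule.zero_mem _
      · have hpos : 0 < s.card := hs.card_pos
        refine Submodule.mem_iSup_of_mem ((s.card : ℤ) - 1)
          (Submodule.mem_iSup_of_mem (Finset.mem_Icc.2 ⟨by omega, by omega⟩) ?_)
        intro t v h1 h2
        have h0 : t ≠ s → f.compLinearMap (e s) v = 0 := key s t v h1 h2
        refine ⟨fun h => by simp, fun h => ?_, fun h h' => ?_⟩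
        · rw [LinearMap.compMultilinearMap_apply, h0 (by rintro rfl; omega)]
          simp
        · rw [LinearMap.compMultilinearMap_apply, h0 (by rintro rfl; omega)]
          simp
    · refine Submodule.mem_iSup_of_mem (s.card : ℤ)
        (Submodule.mem_iSup_of_mem (Finset.mem_Icc.2 ⟨by omega, by omega⟩) ?_)
      intro t v h1 h2
      have h0 : t ≠ s → f.compLinearMap (e s) v = 0 := key s t v h1 h2
      refine ⟨fun h => ?_, fun h => by simp, fun h h' => ?_⟩
      · rw [LinearMap.compMultilinearMap_apply, h0 (by rintro rfl; omega)]
        simp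
      · rw [LinearMap.compMultilinearMap_apply, h0 (by rintro rfl; omega)]
        simp

variable (K A B) in
/-- `𝒬 = ⨁_{n ≥ 0} 𝒬_n`, as a subspace of `𝔤 = ⨁_{n ≥ 0} Hom((A ⊕ B)^{⊗ n+1}, A ⊕ B)`. -/
def Q : Submodule K (Gerst K (A × B)) where
  carrier := {F | ∀ n, F n ∈ homQ K A B n}
  add_mem' hF hG n := by
    rw [DirectSum.add_apply]
    exact Submodule.add_mem _ (hF n) (hG n)
  zero_mem' n := by
    rw [DirectSum.zero_apply]
    exact Submodule.zero_mem _
  smul_mem' c F hF n := by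
    rw [DirectSum.smul_apply]
    exact Submodule.smul_mem _ c (hF n)

theorem lof_mem_Q {n : ℕ} {f : Multi K (A × B) n} (hf : f ∈ homQ K A B n) :
    DirectSum.lof K ℕ (Multi K (A × B)) n f ∈ Q K A B := by
  intro m
  rcases eq_or_ne n m with rfl | h
  · rw [DirectSum.lof_apply]
    exact hf
  · rw [DirectSum.lof_eq_of, DirectSum.of_eq_of_ne _ _ _ h.symm]
    exact Submodule.zero_mem _

theorem circ_mem_homQ {m n : ℕ} {f : Multi K (A × B) m} {g : Multi K (A × B) n}
    (hf : f ∈ homQ K A B m) (hg : g ∈ homQ K A B n) : circ m n f g ∈ homQ K A B (m + n) := by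
  show (∑ i : Fin (m + 1), (-1 : K) ^ (i.val * n) • insertAt i f g) ∈ homQ K A B (m + n)
  refine Submodule.sum_mem _ fun i _ => Submodule.smul_mem _ _ ?_
  rw [mem_homQ_iff] at hf hg ⊢
  intro v
  rw [insertAt_apply]
  have h1 : outerArgs i (g (innerArgs i fun p => ((0 : A), v p))) (fun p => ((0 : A), v p)) =
      fun j => ((0 : A), (outerArgs i (g (innerArgs i fun p => ((0 : A), v p)))
        (fun p => ((0 : A), v p)) j).2) := by
    funext j
    refine Prod.ext ?_ rfl
    simp only [outerArgs]
    split_ifs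
    · rfl
    · exact hg _
    · rfl
  rw [h1]
  exact hf _

/-- `𝒬` is closed under the Gerstenhaber bracket. -/
theorem bracket_mem_Q {F G : Gerst K (A × B)} (hF : F ∈ Q K A B) (hG : G ∈ Q K A B) :
    bracket K (A × B) F G ∈ Q K A B := by
  classical
  rw [← DirectSum.sum_support_of F, ← DirectSum.sum_support_of G]
  simp only [map_sum, LinearMap.sum_apply]
  refine Submodule.sum_mem _ fun m _ => Submodule.sum_mem _ fun n _ => ?_
  rw [← DirectSum.lof_eq_of K, ← DirectSum.lof_eq_of K, bracket_lof]
  exact Submodule.sub_mem _ (lof_mem_Q (circ_mem_homQ (hF _) (hG _)))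
    (Submodule.smul_mem _ _ (lof_mem_Q (circ_mem_homQ (hG _) (hF _))))

theorem parity_mem_Q {F : Gerst K (A × B)} (hF : F ∈ Q K A B) : parity F ∈ Q K A B := by
  intro n
  rw [parity, DirectSum.lmap_apply]
  exact Submodule.smul_mem _ _ (hF n)

variable (K A B) in
/-- `𝔟 = ⨁_{n ≥ 0} Hom(B^{⊗ n+1}, A)`. -/
abbrev AbB : Type _ := ⨁ n : ℕ, MultilinearMap K (fun _ : Fin (n + 1) => B) A

/-- The inclusion `𝔟 ⊆ 𝔤`: `f` becomes `((a_0, x_0), …, (a_n, x_n)) ↦ (f(x_0, …, x_n), 0)`. -/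
def incl : AbB K A B →ₗ[K] Gerst K (A × B) :=
  DirectSum.lmap fun n => LinearMap.compMultilinearMapₗ K (LinearMap.inl K A B) ∘ₗ
    MultilinearMap.compLinearMapₗ fun _ : Fin (n + 1) => LinearMap.snd K A B

/-- The projection `P : 𝔤 → 𝔟`: `F` becomes `(x_0, …, x_n) ↦ pr_A F((0, x_0), …, (0, x_n))`. -/
def proj : Gerst K (A × B) →ₗ[K] AbB K A B :=
  DirectSum.lmap fun n => LinearMap.compMultilinearMapₗ K (LinearMap.fst K A B) ∘ₗ
    MultilinearMap.compLinearMapₗ fun _ : Fin (n + 1) => LinearMap.inr K A B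

/-! ### The `L_∞`-algebra `𝒬[1] ⊕ 𝔟` -/

/-- The iterated bracket `[⋯[[X, f_1], f_2], …, f_k]`, linear in `X` and multilinear in the `f_i`. -/
def iterBracket : ∀ k : ℕ, Gerst K (A × B) →ₗ[K]
    MultilinearMap K (fun _ : Fin k => AbB K A B) (Gerst K (A × B))
  | 0 =>
    { toFun := fun X => MultilinearMap.constOfIsEmpty K _ X
      map_add' := fun _ _ => rfl
      map_smul' := fun _ _ => rfl }
  | k + 1 =>
    { toFun := fun X =>
        (iterBracket k ∘ₗ bracket K (A × B) X ∘ₗ incl :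
          AbB K A B →ₗ[K] MultilinearMap K (fun _ : Fin k => AbB K A B) _).uncurryLeft
      map_add' := fun X Y => by
        refine MultilinearMap.ext fun f => ?_
        simp [LinearMap.uncurryLeft_apply]
      map_smul' := fun c X => by
        refine MultilinearMap.ext fun f => ?_
        simp [LinearMap.uncurryLeft_apply] }

theorem iterBracket_zero (X : Gerst K (A × B)) (f : Fin 0 → AbB K A B) :
    iterBracket 0 X f = X := rfl

theorem iterBracket_succ (k : ℕ) (X : Gerst K (A × B)) (f : Fin (k + 1) → AbB K A B) :
    iterBracket (k + 1) X f =
      iterBracket k (bracket K (A × B) X (incl (f 0))) (fun i => f i.succ) := rfl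

variable (K A B) in
/-- The underlying space of `𝒬[1] ⊕ 𝔟`; the element `(F, f)` stands for `(F[1], f)`. -/
abbrev Tot : Type _ := Q K A B × AbB K A B

variable (K A B) in
/-- The grading of `𝒬[1] ⊕ 𝔟`: its degree `d` part is `𝒬_{d+1} ⊕ 𝔟_d`. -/
def totDeg (d : ℤ) : Submodule K (Tot K A B) where
  carrier := {x | (∀ n : ℕ, (n : ℤ) ≠ d + 1 → x.1.val n = 0) ∧
    (∀ n : ℕ, (n : ℤ) ≠ d → x.2 n = 0)}
  add_mem' hx hy := by
    refine ⟨fun n hn => ?_, fun n hn => ?_⟩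
    · simp [hx.1 n hn, hy.1 n hn]
    · simp [hx.2 n hn, hy.2 n hn]
  zero_mem' := by simp
  smul_mem' c x hx := by
    refine ⟨fun n hn => ?_, fun n hn => ?_⟩
    · exact (congrArg (c • ·) (hx.1 n hn)).trans (smul_zero c)
    · exact (congrArg (c • ·) (hx.2 n hn)).trans (smul_zero c)

/-- The linear map `f ↦ (-1)^{e |f|} f` on `𝔟`. -/
def signTwist (e : ℕ) : AbB K A B →ₗ[K] AbB K A B :=
  DirectSum.lmap fun m => (-1 : K) ^ (e * m) • LinearMap.id

/-- For homogeneous `F` of degree `n` in `𝒬` and `f_1, …, f_k ∈ 𝔟`, the value of `l_{k+1}` on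
`(f_1, …, f_i, F[1], f_{i+1}, …, f_k)`.  It is `P[⋯[[F, f_1], f_2], …, f_k]` multiplied by the
Koszul sign of moving `F[1]`, of degree `n - 1 ≡ n + 1` mod `2`, across `f_1, …, f_i`. -/
def mixedHom (k : ℕ) (i : Fin (k + 1)) (n : ℕ) : Multi K (A × B) n →ₗ[K]
    MultilinearMap K (fun _ : Fin k => Tot K A B) (Tot K A B) where
  toFun F := (LinearMap.inr K (Q K A B) (AbB K A B) ∘ₗ proj).compMultilinearMap
    ((iterBracket k (DirectSum.lof K ℕ _ n F)).compLinearMap fun j =>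
      (if j.castSucc < i then signTwist (n + 1) else LinearMap.id) ∘ₗ LinearMap.snd K _ _)
  map_add' F G := by
    ext1 x
    simp
  map_smul' c F := by
    ext1 x
    simp

/-- The part of `l_{k+1}` with exactly one argument from `𝒬[1]` and `k` arguments from `𝔟`. -/
def mixed (k : ℕ) : MultilinearMap K (fun _ : Fin (k + 1) => Tot K A B) (Tot K A B) :=
  ∑ i : Fin (k + 1), LinearMap.uncurryMid i
    (DirectSum.toModule K ℕ _ (mixedHom k i) ∘ₗ (Q K A B).subtype ∘ₗ LinearMap.fst K _ _)

variable (K A B) in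
/-- The part `l_2(F[1], G[1]) = (-1)^{|F|} [F, G][1]` of `l_2`. -/
def binary : MultilinearMap K (fun _ : Fin 2 => Tot K A B) (Tot K A B) :=
  MultilinearMap.mk' (fun x =>
      (⟨bracket K (A × B) (parity (x 0).1.val) (x 1).1.val,
        bracket_mem_Q (parity_mem_Q (x 0).1.2) (x 1).1.2⟩, 0))
    (fun x p u v => by
      refine Prod.ext (Subtype.ext ?_) (by simp)
      fin_cases p <;> simp)
    (fun x p c u => by
      refine Prod.ext (Subtype.ext ?_) (by simp)
      fin_cases p <;> simp)

variable (K A B) in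
/-- The structure maps of `𝒬[1] ⊕ 𝔟`. -/
def ops : ∀ k : ℕ, MultilinearMap K (fun _ : Fin k => Tot K A B) (Tot K A B)
  | 0 => 0
  | 1 => 0
  | 2 => binary K A B + mixed 1
  | k + 3 => mixed (k + 2)

end Spaces

/-! ### Quasi-twilled associative algebras and weak deformation maps -/

section Tuples

variable (K : Type*) [Field K] (A B : Type*) [AddCommGroup A] [Module K A]
  [AddCommGroup B] [Module K B]

/-- A tuple `(μ, ν, ▷, ◁, ⇀, ↼, θ)` of bilinear maps. -/
structure Tuple where
  /-- `μ(a, b) = a ·_A b` -/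
  mu : A →ₗ[K] A →ₗ[K] A
  /-- `ν(x, y) = x ·_B y` -/
  nu : B →ₗ[K] B →ₗ[K] B
  /-- `a ▷ x` -/
  lact : A →ₗ[K] B →ₗ[K] B
  /-- `x ◁ a` -/
  ract : B →ₗ[K] A →ₗ[K] B
  /-- `x ⇀ a` -/
  lharp : B →ₗ[K] A →ₗ[K] A
  /-- `a ↼ x` -/
  rharp : A →ₗ[K] B →ₗ[K] A
  /-- `θ(a, b)` -/
  theta : A →ₗ[K] A →ₗ[K] B

variable {K A B}

namespace Tuple

variable (T : Tuple K A B)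

/-- The product `(a, x) · (b, y)` on `A ⊕ B` determined by the tuple. -/
def mul (u v : A × B) : A × B :=
  (T.mu u.1 v.1 + T.rharp u.1 v.2 + T.lharp u.2 v.1,
    T.nu u.2 v.2 + T.lact u.1 v.2 + T.ract u.2 v.1 + T.theta u.1 v.1)

/-- The tuple is a quasi-twilled associative algebra: `A ⊕ B` with the product determined by it is
an associative algebra in which `B` is a subalgebra. -/
def IsQuasiTwilled : Prop :=
  (∀ u v w, T.mul (T.mul u v) w = T.mul u (T.mul v w)) ∧
    ∀ x y : B, (T.mul (0, x) (0, y)).1 = 0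

/-- `r` is a weak deformation map. -/
def IsWeakDeformationMap (r : B →ₗ[K] A) : Prop :=
  ∀ x y : B, T.mu (r x) (r y) + T.rharp (r x) y + T.lharp x (r y) =
    r (T.nu x y + T.lact (r x) y + T.ract x (r y) + T.theta (r x) (r y))

/-- `((a, x), (b, y)) ↦ (0, θ(a, b))`. -/
def thetaTilde : Multi K (A × B) 1 :=
  MultilinearMap.mk' (fun v => (0, T.theta (v 0).1 (v 1).1))
    (fun v p u w => by fin_cases p <;> simp)
    (fun v p c u => by fin_cases p <;> simp)

/-- `((a, x), (b, y)) ↦ (a ·_A b, a ▷ y + x ◁ b)`. -/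
def muTilde : Multi K (A × B) 1 :=
  MultilinearMap.mk'
    (fun v => (T.mu (v 0).1 (v 1).1, T.lact (v 0).1 (v 1).2 + T.ract (v 0).2 (v 1).1))
    (fun v p u w => by fin_cases p <;> simp <;> abel)
    (fun v p c u => by fin_cases p <;> simp)

/-- `((a, x), (b, y)) ↦ (a ↼ y + x ⇀ b, x ·_B y)`. -/
def nuTilde : Multi K (A × B) 1 :=
  MultilinearMap.mk'
    (fun v => (T.rharp (v 0).1 (v 1).2 + T.lharp (v 0).2 (v 1).1, T.nu (v 0).2 (v 1).2))
    (fun v p u w => by fin_cases p <;> simp <;> abel)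
    (fun v p c u => by fin_cases p <;> simp)

/-- `Ω = θ̃ + μ_{▷,◁} + ν_{⇀,↼}`. -/
def omega : Multi K (A × B) 1 := T.thetaTilde + T.muTilde + T.nuTilde

theorem omega_apply (v : Fin 2 → A × B) : T.omega v = T.mul (v 0) (v 1) := by
  change ((0, T.theta (v 0).1 (v 1).1) : A × B) +
    (T.mu (v 0).1 (v 1).1, T.lact (v 0).1 (v 1).2 + T.ract (v 0).2 (v 1).1) +
    (T.rharp (v 0).1 (v 1).2 + T.lharp (v 0).2 (v 1).1, T.nu (v 0).2 (v 1).2) = _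
  refine Prod.ext ?_ ?_ <;> simp only [mul, Prod.mk_add_mk] <;> abel

theorem omega_mem : T.omega ∈ homQ K A B 1 := by
  rw [mem_homQ_iff]
  intro v
  rw [omega_apply]
  simp [mul]

end Tuple

/-- The element `(Ω[1], r)` of `𝒬[1] ⊕ 𝔟` given by `Ω ∈ 𝒬_1` and `r ∈ 𝔟_0 = Hom(B, A)`. -/
def pairElt (Ω : homQ K A B 1) (r : B →ₗ[K] A) : Tot K A B :=
  (⟨DirectSum.lof K ℕ (Multi K (A × B)) 1 Ω.val, lof_mem_Q Ω.2⟩,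
    DirectSum.lof K ℕ (fun n => MultilinearMap K (fun _ : Fin (n + 1) => B) A) 0
      (MultilinearMap.ofSubsingleton K B A (0 : Fin 1) r))

/-- `Ω` of a tuple as an element of `𝒬_1`. -/
def Tuple.omegaQ (T : Tuple K A B) : homQ K A B 1 := ⟨T.omega, T.omega_mem⟩

end Tuples

end QuasiTwilled

end

open QuasiTwilled

noncomputable section

namespace QuasiTwilled

/-! ### The Gerstenhaber bracket: pre-Lie identity and graded Jacobi identity -/

section GradedJacobi

variable {K : Type*} [Field K] {W : Type*} [AddCommGroup W] [Module K W]

/-! The structure is an instance of Voronov's higher derived brackets. The Gerstenhaber algebra is 𝔤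
= 𝒬 ⊕ 𝔟, where 𝔟 is abelian and 𝒬 = ker P is a subalgebra. The elements of 𝒬 are themselves
arguments of the operations, and PF = 0 for F in 𝒬, so there is no `l_1`.

The higher Jacobi identity splits into two components. The 𝒬-component involves three arguments from
𝒬 and is the graded Jacobi identity (`splitSum_bin`). That identity follows from the graded symmetry
of the associator of ⋄ (`associator_symm`), because the associator only sees insertions at two
different places. The 𝔟-component involves two arguments F, G from 𝒬 and any number from 𝔟.
Iterating P[F, G] = P[F, PG] + P[PF, G] along the derivations [·, f] writes P[⋯[[F, G], f_1], …] as
a signed sum over unshuffles (`prj_iter_br`), and this sum cancels against the nested derived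
brackets (`splitSum_mix`). The signs are handled by the recursion `splitSum` on lists, for which
coassociativity and cocommutativity of the unshuffle coproduct are short inductions.
`sum_shuffles_eq_splitSum` and `GradedSymm.apply_ofFn` translate back to permutations.

Finiteness comes from the Euler element e(a, x) = (a, 0). The map [·, e] acts by k on C^{k|l} and by
-1 on 𝔟, every bracket with an element of 𝔟 lowers the eigenvalue by 1, and P only sees the
eigenvalue -1. Hence an element of 𝒬_n is killed by P after n + 3 or more brackets with 𝔟
(`proj_iter_eq_zero`). This gives the filtration by arity and local nilpotence. Completeness is
automatic, since each degree meets only finitely many steps of the filtration nontrivially.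

At (Ω[1], r) the 𝒬-component of the Maurer–Cartan equation is -[Ω, Ω]/2 = 0, which is associativity.
The 𝔟-component is P applied to the exponential series of [·, r] at Ω. As r squares to zero on A ⊕
B, this is the B × B → A part of e^{-r}Ω(e^r ·, e^r ·), a cubic expression in r whose vanishing is
the weak deformation equation (`sum_adOne`).

Twisting rests on the binomial theorem for copies of the degree-0 element α. Divided by k!, the
Jacobi identities for k copies of α followed by x_1, …, x_N sum over k to the twisted identity, and
the Maurer–Cartan sum of α + β regroups into the twisted one of β. -/

/-- A multilinear map evaluated at the initial segment of a sequence. -/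
def evalSeq {n : ℕ} (f : Multi K W n) (a : ℕ → W) : W := f fun i => a i

/-- The sequence `a_0, …, a_{i-1}, c, a_{i+n+1}, …`. -/
def insertSeq (i n : ℕ) (c : W) (a : ℕ → W) : ℕ → W :=
  fun j => if j < i then a j else if j = i then c else a (j + n)

theorem evalSeq_congr {n : ℕ} (f : Multi K W n) {a b : ℕ → W} (h : ∀ j ≤ n, a j = b j) :
    evalSeq f a = evalSeq f b := by
  unfold evalSeq
  congr 1
  funext i
  exact h _ (by omega)

theorem evalSeq_sub {n : ℕ} (f g : Multi K W n) (a : ℕ → W) :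
    evalSeq (f - g) a = evalSeq f a - evalSeq g a := rfl

theorem evalSeq_smul {n : ℕ} (c : K) (f : Multi K W n) (a : ℕ → W) :
    evalSeq (c • f) a = c • evalSeq f a := rfl

theorem evalSeq_sum {n : ℕ} {ι : Type*} (s : Finset ι) (f : ι → Multi K W n) (a : ℕ → W) :
    evalSeq (∑ i ∈ s, f i) a = ∑ i ∈ s, evalSeq (f i) a := by
  simp only [evalSeq, _root_.sum_apply]

theorem ext_evalSeq {n : ℕ} {f g : Multi K W n} (h : ∀ a, evalSeq f a = evalSeq g a) : f = g := by
  ext v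
  have := h fun j => if hj : j < n + 1 then v ⟨j, hj⟩ else 0
  simp only [evalSeq, Fin.is_lt, dite_true, Fin.eta] at this
  exact this

/-- Evaluation on infinite sequences makes sense for every arity, so maps whose arities agree only
propositionally can be compared without casts. -/
theorem lof_eq_lof {m n : ℕ} (hmn : m = n) {f : Multi K W m} {g : Multi K W n}
    (h : ∀ a, evalSeq f a = evalSeq g a) :
    DirectSum.lof K ℕ (Multi K W) m f = DirectSum.lof K ℕ (Multi K W) n g := by
  subst hmn
  rw [ext_evalSeq h]

theorem evalSeq_insertSeq_smul {m : ℕ} (f : Multi K W m) (i n : ℕ) (hi : i ≤ m) (r : K) (c : W)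
    (a : ℕ → W) :
    evalSeq f (insertSeq i n (r • c) a) = r • evalSeq f (insertSeq i n c a) := by
  have key : ∀ c : W, (fun j : Fin (m + 1) => insertSeq i n c a j) =
      Function.update (fun j : Fin (m + 1) => insertSeq i n 0 a j) ⟨i, by omega⟩ c := by
    intro c
    funext j
    simp only [insertSeq, Function.update_apply, Fin.ext_iff]
    split_ifs <;> first | rfl | omega
  simp only [evalSeq]
  rw [key, MultilinearMap.map_update_smul, ← key]

theorem evalSeq_insertSeq_sum {m : ℕ} (f : Multi K W m) (i n : ℕ) (hi : i ≤ m) {ι : Type*}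
    (s : Finset ι) (c : ι → W) (a : ℕ → W) :
    evalSeq f (insertSeq i n (∑ t ∈ s, c t) a) = ∑ t ∈ s, evalSeq f (insertSeq i n (c t) a) := by
  have key : ∀ c : W, (fun j : Fin (m + 1) => insertSeq i n c a j) =
      Function.update (fun j : Fin (m + 1) => insertSeq i n 0 a j) ⟨i, by omega⟩ c := by
    intro c
    funext j
    simp only [insertSeq, Function.update_apply, Fin.ext_iff]
    split_ifs <;> first | rfl | omega
  simp only [evalSeq]
  rw [key, MultilinearMap.map_update_sum]
  exact Finset.sum_congr rfl fun t _ => by rw [← key]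

theorem evalSeq_circ (m n : ℕ) (f : Multi K W m) (g : Multi K W n) (a : ℕ → W) :
    evalSeq (circ m n f g) a = ∑ i ∈ Finset.range (m + 1),
      (-1 : K) ^ (i * n) • evalSeq f (insertSeq i n (evalSeq g fun t => a (i + t)) a) := by
  rw [Finset.sum_range]
  change evalSeq (∑ i : Fin (m + 1), (-1 : K) ^ (i.val * n) • insertAt i f g) a = _
  rw [evalSeq_sum]
  refine Finset.sum_congr rfl fun i _ => ?_
  rw [evalSeq_smul]
  congr 1
  simp only [evalSeq, insertAt_apply]
  congr 1
  funext j
  simp only [outerArgs, insertSeq, Fin.ext_iff, Fin.lt_def]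
  rfl

/-- `f` with `g` inserted at the place `u` and `h` at the later place `v`. -/
def insertTwo {m n p : ℕ} (f : Multi K W m) (g : Multi K W n) (h : Multi K W p) (u v : ℕ)
    (a : ℕ → W) : W :=
  evalSeq f fun s => if s < u then a s else if s = u then evalSeq g fun t => a (u + t) else
    if s < v then a (s + n) else if s = v then evalSeq h fun t => a (v + n + t) else a (s + n + p)

/-- In (f ⋄ g) ⋄ h the map h lands before g, inside g or after g. The insertions inside g make up f
⋄ (g ⋄ h), so only insertions at two different places of f survive. -/
theorem associator_eq {m n p : ℕ} (f : Multi K W m) (g : Multi K W n) (h : Multi K W p)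
    (a : ℕ → W) :
    evalSeq (circ (m + n) p (circ m n f g) h) a - evalSeq (circ m (n + p) f (circ n p g h)) a =
      ∑ j ∈ Finset.range (m + 1), ∑ i ∈ Finset.range j,
        ((-1 : K) ^ (i * p + j * n) • insertTwo f h g i j a +
         (-1 : K) ^ (i * n + (j + n) * p) • insertTwo f g h i j a) := by
  -- Pairs with h behind g arise indexed by the place of g and the distance to h. This reindexes
  -- them by the later place.
  have hswap : ∀ c : ℕ → ℕ → W,
      ∑ j ∈ Finset.range (m + 1), ∑ i ∈ Finset.range (m - j), c j (j + 1 + i) =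
      ∑ j ∈ Finset.range (m + 1), ∑ i ∈ Finset.range j, c i j := by
    intro c
    have h1 : ∀ j ∈ Finset.range (m + 1), ∑ i ∈ Finset.range (m - j), c j (j + 1 + i) =
        ∑ i ∈ Finset.Ico (j + 1) (m + 1), c j i := by
      intro j _
      rw [Finset.sum_Ico_eq_sum_range]
      congr 2
      omega
    rw [Finset.sum_congr rfl h1]
    refine Finset.sum_comm' ?_
    intro x y
    simp only [Finset.mem_range, Finset.mem_Ico]
    omega
  have hcomp : evalSeq (circ (m + n) p (circ m n f g) h) a =
      ∑ j ∈ Finset.range (m + 1), ∑ i ∈ Finset.range (m + n + 1),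
        (-1 : K) ^ (i * p + j * n) • evalSeq f (insertSeq j n
          (evalSeq g fun t => insertSeq i p (evalSeq h fun t => a (i + t)) a (j + t))
          (insertSeq i p (evalSeq h fun t => a (i + t)) a)) := by
    rw [evalSeq_circ, Finset.sum_comm]
    refine Finset.sum_congr rfl fun i _ => ?_
    rw [evalSeq_circ, Finset.smul_sum]
    refine Finset.sum_congr rfl fun j _ => ?_
    rw [smul_smul, pow_add]
  rw [hcomp, evalSeq_circ, ← Finset.sum_sub_distrib]
  simp only [Finset.sum_add_distrib]
  rw [← hswap fun i j => (-1 : K) ^ (i * n + (j + n) * p) • insertTwo f g h i j a,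
    ← Finset.sum_add_distrib]
  refine Finset.sum_congr rfl fun j hj => ?_
  have hj' : j ≤ m := by simpa [Nat.lt_succ_iff] using hj
  -- The possible places of h: j before g, n + 1 inside g, and m - j behind g.
  rw [show m + n + 1 = j + ((n + 1) + (m - j)) by omega, Finset.sum_range_add,
    Finset.sum_range_add, evalSeq_circ, evalSeq_insertSeq_sum _ _ _ hj', Finset.smul_sum]
  have e1 : ∀ i ∈ Finset.range j, (-1 : K) ^ (i * p + j * n) • evalSeq f (insertSeq j n
          (evalSeq g fun t => insertSeq i p (evalSeq h fun t => a (i + t)) a (j + t))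
          (insertSeq i p (evalSeq h fun t => a (i + t)) a)) =
      (-1 : K) ^ (i * p + j * n) • insertTwo f h g i j a := by
    intro i hi
    rw [Finset.mem_range] at hi
    congr 1
    refine evalSeq_congr _ fun s hs => ?_
    simp only [insertSeq]
    split_ifs <;> first | rfl | omega | skip
    · refine evalSeq_congr _ fun t ht => ?_
      split_ifs <;> first | rfl | omega | skip
      congr 1
      omega
    · congr 1
      omega
  have e2 : ∀ t ∈ Finset.range (n + 1), (-1 : K) ^ ((j + t) * p + j * n) • evalSeq f (insertSeq j n
          (evalSeq g fun s => insertSeq (j + t) p (evalSeq h fun s => a (j + t + s)) a (j + s))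
          (insertSeq (j + t) p (evalSeq h fun s => a (j + t + s)) a)) =
      (-1 : K) ^ (j * (n + p)) • evalSeq f (insertSeq j (n + p)
        ((-1 : K) ^ (t * p) • evalSeq g (insertSeq t p (evalSeq h fun s => a (j + (t + s)))
          fun s => a (j + s))) a) := by
    intro t ht
    rw [Finset.mem_range] at ht
    rw [evalSeq_insertSeq_smul _ _ _ hj', smul_smul, ← pow_add]
    congr 1
    · congr 1
      ring
    · refine evalSeq_congr _ fun s hs => ?_
      simp only [insertSeq]
      split_ifs <;> first | rfl | omega | skip
      · refine evalSeq_congr _ fun t' ht' => ?_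
        simp only [insertSeq, add_lt_add_iff_left, add_right_inj, add_assoc]
      · congr 1
        omega
  have e3 : ∀ i ∈ Finset.range (m - j), (-1 : K) ^ ((j + (n + 1 + i)) * p + j * n) •
        evalSeq f (insertSeq j n
          (evalSeq g fun s => insertSeq (j + (n + 1 + i)) p
            (evalSeq h fun s => a (j + (n + 1 + i) + s)) a (j + s))
          (insertSeq (j + (n + 1 + i)) p (evalSeq h fun s => a (j + (n + 1 + i) + s)) a)) =
      (-1 : K) ^ (j * n + (j + 1 + i + n) * p) • insertTwo f g h j (j + 1 + i) a := by
    intro i hi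
    rw [Finset.mem_range] at hi
    congr 1
    · congr 1
      ring
    · refine evalSeq_congr _ fun s hs => ?_
      simp only [insertSeq]
      split_ifs <;> first | rfl | omega | skip
      · refine evalSeq_congr _ fun t ht => ?_
        split_ifs <;> first | rfl | omega
      · refine evalSeq_congr _ fun t ht => ?_
        congr 1
        omega
  rw [Finset.sum_congr rfl e1, Finset.sum_congr rfl e2, Finset.sum_congr rfl e3]
  abel

theorem neg_one_pow_congr {m n : ℕ} (h : m % 2 = n % 2) : (-1 : K) ^ m = (-1 : K) ^ n := by
  rw [← Nat.div_add_mod m 2, ← Nat.div_add_mod n 2, h]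
  simp [pow_add, pow_mul]

/-- Exchanging g and h swaps the two summands for each pair of places in `associator_eq`, up to the
sign (-1)^{np}. This is the graded pre-Lie identity. -/
theorem associator_symm {m n p : ℕ} (f : Multi K W m) (g : Multi K W n) (h : Multi K W p)
    (a : ℕ → W) :
    evalSeq (circ (m + n) p (circ m n f g) h) a - evalSeq (circ m (n + p) f (circ n p g h)) a =
      (-1 : K) ^ (n * p) •
        (evalSeq (circ (m + p) n (circ m p f h) g) a -
          evalSeq (circ m (p + n) f (circ p n h g)) a) := by
  rw [associator_eq, associator_eq, Finset.smul_sum]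
  refine Finset.sum_congr rfl fun j _ => ?_
  rw [Finset.smul_sum]
  refine Finset.sum_congr rfl fun i _ => ?_
  rw [smul_add, smul_smul, smul_smul, ← pow_add, ← pow_add, add_comm]
  congr 2
  · congr 1
    ring
  · refine neg_one_pow_congr ?_
    rw [show n * p + (i * p + (j + p) * n) = i * p + j * n + 2 * (n * p) by ring]
    omega

theorem bracket_antisymm (m n : ℕ) (f : Multi K W m) (g : Multi K W n) :
    bracket K W (DirectSum.lof K ℕ _ n g) (DirectSum.lof K ℕ _ m f) =
      -(-1 : K) ^ (m * n) • bracket K W (DirectSum.lof K ℕ _ m f) (DirectSum.lof K ℕ _ n g) := by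
  rw [bracket_lof, bracket_lof, smul_sub, smul_smul, neg_mul, ← pow_add, mul_comm n m,
    ← two_mul, pow_mul (-1 : K) 2, neg_one_sq, one_pow]
  module

/-- The graded Jacobi identity, as the derivation property of `[·, h]`. -/
theorem bracket_jacobi (m n p : ℕ) (f : Multi K W m) (g : Multi K W n) (h : Multi K W p) :
    bracket K W (bracket K W (DirectSum.lof K ℕ _ m f) (DirectSum.lof K ℕ _ n g))
        (DirectSum.lof K ℕ _ p h) =
      bracket K W (DirectSum.lof K ℕ _ m f)
        (bracket K W (DirectSum.lof K ℕ _ n g) (DirectSum.lof K ℕ _ p h)) +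
      (-1 : K) ^ (n * p) •
        bracket K W (bracket K W (DirectSum.lof K ℕ _ m f) (DirectSum.lof K ℕ _ p h))
          (DirectSum.lof K ℕ _ n g) := by
  -- The pre-Lie identity solved for (f ⋄ g) ⋄ h, stated in the direct sum because the arities of
  -- its terms are only propositionally equal.
  have pre : ∀ (m n p : ℕ) (f : Multi K W m) (g : Multi K W n) (h : Multi K W p),
      DirectSum.lof K ℕ (Multi K W) _ (circ (m + n) p (circ m n f g) h) =
        DirectSum.lof K ℕ (Multi K W) _ (circ m (n + p) f (circ n p g h)) +
        (-1 : K) ^ (n * p) • (DirectSum.lof K ℕ (Multi K W) _ (circ (m + p) n (circ m p f h) g) -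
          DirectSum.lof K ℕ (Multi K W) _ (circ m (p + n) f (circ p n h g))) := by
    intro m n p f g h
    have e1 : DirectSum.lof K ℕ (Multi K W) _ (circ (m + n) p (circ m n f g) h) -
        DirectSum.lof K ℕ (Multi K W) _ (circ m (n + p) f (circ n p g h)) =
      (-1 : K) ^ (n * p) • (DirectSum.lof K ℕ (Multi K W) _ (circ (m + p) n (circ m p f h) g) -
          DirectSum.lof K ℕ (Multi K W) _ (circ m (p + n) f (circ p n h g))) := by
      have hc : ∀ (q : ℕ) (hq : q = m + n + p) (u : Multi K W q), ∃ u' : Multi K W (m + n + p),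
          DirectSum.lof K ℕ (Multi K W) _ u = DirectSum.lof K ℕ (Multi K W) _ u' ∧
          ∀ a, evalSeq u a = evalSeq u' a := by
        rintro q rfl u
        exact ⟨u, rfl, fun _ => rfl⟩
      obtain ⟨u1, h1, k1⟩ := hc _ (by ring) (circ m (n + p) f (circ n p g h))
      obtain ⟨u2, h2, k2⟩ := hc _ (by ring) (circ (m + p) n (circ m p f h) g)
      obtain ⟨u3, h3, k3⟩ := hc _ (by ring) (circ m (p + n) f (circ p n h g))
      rw [h1, h2, h3, ← map_sub, ← map_sub, ← map_smul]
      congr 1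
      refine ext_evalSeq fun a => ?_
      rw [evalSeq_sub, evalSeq_smul, evalSeq_sub, ← k1, ← k2, ← k3]
      exact associator_symm f g h a
    rw [← e1]
    abel
  simp only [bracket_lof, map_sub, map_smul, LinearMap.sub_apply, LinearMap.smul_apply]
  -- One instance for each choice of the outermost map. What remains is a comparison of signs,
  -- settled by the parities of m, n and p.
  rw [pre m n p f g h, pre n m p g f h, pre p m n h f g]
  have par : ∀ k : ℕ, (-1 : K) ^ k = if k % 2 = 0 then 1 else -1 := by
    intro k
    rcases Nat.even_or_odd k with hk | hk
    · simp [hk.neg_one_pow, Nat.even_iff.1 hk]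
    · simp [hk.neg_one_pow, Nat.odd_iff.1 hk]
  simp only [par]
  rcases Nat.mod_two_eq_zero_or_one m with hm | hm <;>
  rcases Nat.mod_two_eq_zero_or_one n with hn | hn <;>
  rcases Nat.mod_two_eq_zero_or_one p with hp | hp <;>
  simp [Nat.add_mod, Nat.mul_mod, hm, hn, hp] <;> module

end GradedJacobi

/-! ### Signs -/

section Signs

variable {K : Type*} [Field K]

theorem neg_one_zpow_congr {a b : ℤ} (h : Even (a - b)) : (-1 : K) ^ a = (-1 : K) ^ b := by
  have : a = (a - b) + b := by ring
  rw [this, zpow_add₀ (neg_ne_zero.2 one_ne_zero), h.neg_one_zpow, one_mul]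

theorem neg_one_zpow_mul (a b : ℤ) : (-1 : K) ^ a * (-1 : K) ^ b = (-1 : K) ^ (a + b) :=
  (zpow_add₀ (neg_ne_zero.2 one_ne_zero) a b).symm

theorem neg_neg_one_zpow (a : ℤ) : -(-1 : K) ^ a = (-1 : K) ^ (a + 1) := by
  rw [← neg_one_zpow_mul]
  simp

end Signs

/-! ### Signed sums over unshuffles of a list -/

section SplitSum

variable (K : Type*) [Field K] {α : Type*} (deg : α → ℤ) {M : Type*} [AddCommMonoid M] [Module K M]

/-- The sum of `φ S T` over all unshuffles `(S, T)` of a list, with Koszul signs. -/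
def splitSum : List α → (List α → List α → M) → M
  | [], φ => φ [] []
  | x :: L, φ => splitSum L (fun S T => φ (x :: S) T) +
      splitSum L (fun S T => (-1 : K) ^ (deg x * (S.map deg).sum) • φ S (x :: T))

/-- The function `ψ` of an element and a list, extended by zero to pairs of lists. -/
def single (ψ : α → List α → M) : List α → List α → M
  | [x], T => ψ x T
  | _, _ => 0

/-- The sum over all ways to move one element of a list to the front, with Koszul signs. -/
def pullOut (L : List α) (ψ : α → List α → M) : M := splitSum K deg L (single ψ)

/-- Graded symmetry of a function of lists, in terms of neighbouring elements. -/
def GradedSymm (φ : List α → M) : Prop :=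
  ∀ (P : List α) (x y : α) (L : List α),
    φ (P ++ x :: y :: L) = (-1 : K) ^ (deg x * deg y) • φ (P ++ y :: x :: L)

variable {K deg}

theorem splitSum_add (L : List α) (φ ψ : List α → List α → M) :
    splitSum K deg L (fun S T => φ S T + ψ S T) = splitSum K deg L φ + splitSum K deg L ψ := by
  induction L generalizing φ ψ with
  | nil => rfl
  | cons x L ih =>
    simp only [splitSum, smul_add, ih]
    abel

theorem splitSum_smul (c : K) (L : List α) (φ : List α → List α → M) :
    splitSum K deg L (fun S T => c • φ S T) = c • splitSum K deg L φ := by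
  induction L generalizing φ with
  | nil => rfl
  | cons x L ih => simp only [splitSum, smul_add, ih, smul_comm _ c]

theorem splitSum_map {M' : Type*} [AddCommMonoid M'] [Module K M'] (g : M →ₗ[K] M') (L : List α)
    (φ : List α → List α → M) :
    g (splitSum K deg L φ) = splitSum K deg L fun S T => g (φ S T) := by
  induction L generalizing φ with
  | nil => rfl
  | cons x L ih => simp only [splitSum, map_add, ih, map_smul]

theorem splitSum_zero (L : List α) : splitSum K deg L (fun _ _ => (0 : M)) = 0 := by
  simpa using splitSum_smul (deg := deg) (0 : K) L (fun _ _ => (0 : M))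

theorem splitSum_sum {ι : Type*} (s : Finset ι) (L : List α) (φ : ι → List α → List α → M) :
    splitSum K deg L (fun S T => ∑ i ∈ s, φ i S T) = ∑ i ∈ s, splitSum K deg L (φ i) := by
  classical
  induction s using Finset.induction_on with
  | empty => simpa using splitSum_zero L
  | insert i s hi ih => simp only [Finset.sum_insert hi, splitSum_add, ih]

theorem splitSum_congr (L : List α) {φ ψ : List α → List α → M}
    (h : ∀ S T, (S ++ T).Perm L → φ S T = ψ S T) : splitSum K deg L φ = splitSum K deg L ψ := by
  induction L generalizing φ ψ with
  | nil => exact h [] [] (by simp)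
  | cons x L ih =>
    simp only [splitSum]
    congr 1
    · exact ih fun S T hST => h _ _ (by simpa using hST)
    · exact ih fun S T hST => by
        rw [h S (x :: T) (List.perm_middle.trans (hST.cons x))]

theorem splitSum_eq_zero (L : List α) {φ : List α → List α → M}
    (h : ∀ S T, (S ++ T).Perm L → φ S T = 0) : splitSum K deg L φ = 0 :=
  (splitSum_congr L h).trans (splitSum_zero L)

theorem sum_map_deg_of_perm {S T L : List α} (h : (S ++ T).Perm L) :
    (L.map deg).sum = (S.map deg).sum + (T.map deg).sum := by
  rw [← (h.map deg).sum_eq, List.map_append, List.sum_append]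

/-- Coassociativity of the unshuffle coproduct: both sides run over the distributions of L to three
lists, and the signs agree because degrees add up. -/
theorem splitSum_assoc (L : List α) (φ : List α → List α → List α → M) :
    splitSum K deg L (fun S U => splitSum K deg S fun S' T => φ S' T U) =
      splitSum K deg L (fun S' V => splitSum K deg V fun T U => φ S' T U) := by
  induction L generalizing φ with
  | nil => rfl
  | cons x L ih =>
    simp only [splitSum, smul_add]
    rw [splitSum_add, splitSum_add, ih, add_assoc]
    simp only [← splitSum_smul]
    rw [ih fun S' T U => (-1 : K) ^ (deg x * (S'.map deg).sum) • φ S' (x :: T) U]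
    congr 2
    rw [← ih fun S' T U => (-1 : K) ^ (deg x * (S'.map deg).sum) •
      (-1 : K) ^ (deg x * (T.map deg).sum) • φ S' T (x :: U)]
    congr 1
    funext S U
    refine splitSum_congr _ fun S' T h => ?_
    rw [sum_map_deg_of_perm h, mul_add, smul_smul, neg_one_zpow_mul]

/-- Graded cocommutativity: exchanging the two halves costs the sign of moving one past the other.
-/
theorem splitSum_comm (L : List α) (φ : List α → List α → M) :
    splitSum K deg L φ =
      splitSum K deg L fun S T => (-1 : K) ^ ((S.map deg).sum * (T.map deg).sum) • φ T S := by
  induction L generalizing φ with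
  | nil => simp [splitSum]
  | cons x L ih =>
    simp only [splitSum]
    rw [ih, ih (fun S T => (-1 : K) ^ (deg x * (S.map deg).sum) • φ S (x :: T)), add_comm]
    simp only [smul_smul, neg_one_zpow_mul, List.map_cons, List.sum_cons]
    congr 2 <;> funext S T <;> congr 1 <;> refine neg_one_zpow_congr ?_ <;>
      simp only [Int.even_add, Int.even_sub, Int.even_mul] <;> tauto

/-- Pulling one element out of the second half of an unshuffle. -/
theorem splitSum_pullOut (L : List α) (ψ : α → List α → List α → M) :
    splitSum K deg L (fun S T => pullOut K deg T fun y U => ψ y S U) =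
      pullOut K deg L fun y V => splitSum K deg V fun S U =>
        (-1 : K) ^ (deg y * (S.map deg).sum) • ψ y S U := by
  simp only [pullOut]
  -- The distribution into (S, y, U) is regrouped so that S and y lie in one half. They are then
  -- exchanged, and reassociating brings y to the front.
  rw [← splitSum_assoc L fun S Y U => single (fun y U => ψ y S U) Y U]
  have h : ∀ S U, splitSum K deg S (fun S' T => single (fun y U => ψ y S' U) T U) =
      splitSum K deg S fun T S' => (-1 : K) ^ ((T.map deg).sum * (S'.map deg).sum) •
        single (fun y U => ψ y S' U) T U := fun S U => splitSum_comm _ _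
  simp only [h]
  rw [splitSum_assoc L fun T S' U => (-1 : K) ^ ((T.map deg).sum * (S'.map deg).sum) •
        single (fun y U => ψ y S' U) T U]
  congr 1
  funext Y V
  match Y with
  | [] => simp [single, splitSum_zero]
  | [y] => simp [single]
  | _ :: _ :: _ => simp [single, splitSum_zero]

/-- Pulling one element out of the first half of an unshuffle. -/
theorem splitSum_pullOut_left (L : List α) (ψ : α → List α → List α → M) :
    splitSum K deg L (fun S T => pullOut K deg S fun x S' => ψ x S' T) =
      pullOut K deg L fun x V => splitSum K deg V fun S' T => ψ x S' T := by
  simp only [pullOut]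
  rw [splitSum_assoc L fun X S' T => single (fun x S' => ψ x S' T) X S']
  congr 1
  funext X V
  match X with
  | [] => simp [single, splitSum_zero]
  | [x] => simp [single]
  | _ :: _ :: _ => simp [single, splitSum_zero]

/-- The counit property: only one unshuffle has an empty left half, and its sign is 1. -/
theorem splitSum_left_nil (L : List α) (χ : List α → M) :
    splitSum K deg L (fun S T => match S with | [] => χ T | _ :: _ => 0) = χ L := by
  induction L generalizing χ with
  | nil => rfl
  | cons x L ih =>
    simp only [splitSum]
    rw [splitSum_zero, zero_add, ← ih fun T => χ (x :: T)]
    congr 1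
    funext S T
    cases S <;> simp

theorem pullOut_cons (x : α) (L : List α) (ψ : α → List α → M) :
    pullOut K deg (x :: L) ψ =
      ψ x L + pullOut K deg L fun y T => (-1 : K) ^ (deg x * deg y) • ψ y (x :: T) := by
  simp only [pullOut, splitSum]
  congr 1
  · rw [← splitSum_left_nil (K := K) (deg := deg) L (ψ x)]
    congr 1
    funext S T
    cases S <;> rfl
  · congr 1
    funext S T
    match S with
    | [] => simp [single]
    | [y] => simp [single]
    | _ :: _ :: _ => simp [single]

theorem pullOut_nil (ψ : α → List α → M) : pullOut K deg [] ψ = 0 := rfl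

theorem pullOut_congr (L : List α) {φ ψ : α → List α → M}
    (h : ∀ x T, (x :: T).Perm L → φ x T = ψ x T) : pullOut K deg L φ = pullOut K deg L ψ := by
  refine splitSum_congr _ fun S T hST => ?_
  match S with
  | [] => rfl
  | [x] => exact h x T hST
  | _ :: _ :: _ => rfl

theorem pullOut_add (L : List α) (φ ψ : α → List α → M) :
    pullOut K deg L (fun x T => φ x T + ψ x T) = pullOut K deg L φ + pullOut K deg L ψ := by
  rw [pullOut, pullOut, pullOut, ← splitSum_add]
  congr 1
  funext S T
  match S with
  | [] => simp [single]
  | [x] => simp [single]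
  | _ :: _ :: _ => simp [single]

theorem pullOut_smul (c : K) (L : List α) (φ : α → List α → M) :
    pullOut K deg L (fun x T => c • φ x T) = c • pullOut K deg L φ := by
  rw [pullOut, pullOut, ← splitSum_smul]
  congr 1
  funext S T
  match S with
  | [] => simp [single]
  | [x] => simp [single]
  | _ :: _ :: _ => simp [single]

theorem pullOut_map {M' : Type*} [AddCommMonoid M'] [Module K M'] (g : M →ₗ[K] M') (L : List α)
    (φ : α → List α → M) :
    g (pullOut K deg L φ) = pullOut K deg L fun x T => g (φ x T) := by
  rw [pullOut, pullOut, splitSum_map]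
  congr 1
  funext S T
  match S with
  | [] => simp [single]
  | [x] => simp [single]
  | _ :: _ :: _ => simp [single]

/-- Pulling out two elements one after the other. -/
theorem pullOut_pullOut (L : List α) (χ : α → α → List α → M) :
    pullOut K deg L (fun x V => pullOut K deg V fun y T => χ x y T) =
      splitSum K deg L fun S T => match S with
        | [x, y] => χ x y T + (-1 : K) ^ (deg x * deg y) • χ y x T
        | _ => 0 := by
  have h := splitSum_pullOut_left (K := K) (deg := deg) L
    fun x S T => single (fun y T => χ x y T) S T
  refine h.symm.trans ?_
  congr 1
  funext S T
  match S with
  | [] => rfl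
  | [x] => simp [pullOut_cons, pullOut_nil, single]
  | [x, y] => simp [pullOut_cons, pullOut_nil, single]
  | x :: y :: z :: S =>
    refine (pullOut_congr (ψ := fun _ _ => 0) _ fun u T hu => ?_).trans ?_
    · have := hu.length_eq
      match T with
      | [] => rfl
      | [_] => simp at this
      | _ :: _ :: _ => rfl
    · simpa using pullOut_smul (K := K) (deg := deg) (0 : K) (x :: y :: z :: S)
        fun _ _ => (0 : M)

/-- Neighbours x, y which land in the same half are exchanged by the symmetry of φ there. If they
land in different halves, the exchange interchanges the two distributions, and the sign comes from
the coefficients. -/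
theorem gradedSymm_splitSum {φ : List α → List α → M} (h1 : ∀ T, GradedSymm K deg fun S => φ S T)
    (h2 : ∀ S, GradedSymm K deg (φ S)) : GradedSymm K deg fun L => splitSum K deg L φ := by
  intro P
  induction P generalizing φ with
  | nil =>
    intro x y L
    simp only [List.nil_append, splitSum, smul_add, ← splitSum_smul]
    have e1 : ∀ S T, φ (x :: y :: S) T = (-1 : K) ^ (deg x * deg y) • φ (y :: x :: S) T :=
      fun S T => h1 T [] x y S
    have e2 : ∀ S T, φ S (x :: y :: T) = (-1 : K) ^ (deg x * deg y) • φ S (y :: x :: T) :=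
      fun S T => h2 S [] x y T
    rw [add_assoc, add_assoc]
    congr 1
    · simp only [e1]
    rw [add_left_comm]
    simp only [e2, smul_smul, neg_one_zpow_mul, List.map_cons, List.sum_cons]
    congr 1
    · congr 1
      funext S T
      congr 1
      refine neg_one_zpow_congr ?_
      simp only [Int.even_add, Int.even_sub, Int.even_mul]
      tauto
    congr 1
    · congr 1
      funext S T
      congr 1
      refine neg_one_zpow_congr ?_
      simp only [Int.even_add, Int.even_sub, Int.even_mul]
      tauto
    · congr 1
      funext S T
      congr 1
      refine neg_one_zpow_congr ?_
      simp only [Int.even_add, Int.even_sub, Int.even_mul]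
      tauto
  | cons p P ih =>
    intro x y L
    simp only [List.cons_append, splitSum, smul_add]
    congr 1
    · refine ih (φ := fun S T => φ (p :: S) T) (fun T P x y L => ?_) (fun S => h2 _) x y L
      exact h1 T (p :: P) x y L
    · refine ih (φ := fun S T => (-1 : K) ^ (deg p * (S.map deg).sum) • φ S (p :: T))
        (fun T P x y L => ?_) (fun S P x y L => ?_) x y L
      · have := h1 (p :: T) P x y L
        simp only at this ⊢
        rw [this, smul_comm]
        congr 3
        simp only [List.map_append, List.map_cons, List.sum_append, List.sum_cons]
        ring
      · have := h2 S (p :: P) x y L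
        simp only [List.cons_append] at this ⊢
        rw [this, smul_comm]

theorem gradedSymm_pullOut {ψ : α → List α → M} (h : ∀ x, GradedSymm K deg (ψ x)) :
    GradedSymm K deg fun L => pullOut K deg L ψ := by
  refine gradedSymm_splitSum (fun T P x y L => ?_) fun S P x y L => ?_
  · have : ∀ a b : α, single ψ (P ++ a :: b :: L) T = 0 := by
      intro a b
      match P with
      | [] => rfl
      | [_] => rfl
      | _ :: _ :: _ => rfl
    simp only [this, smul_zero]
  · match S with
    | [] => simp [single]
    | [z] => exact h z P x y L
    | _ :: _ :: _ => simp [single]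

end SplitSum

/-! ### Graded Lie algebras with a projection to an abelian subalgebra -/

section Voronov

/-- A graded Lie algebra `G` with bracket `br`, an abelian subalgebra `b` and a projection to it
whose kernel is a subalgebra. -/
structure BracketData (K G b : Type*) [Field K] [AddCommMonoid G] [Module K G] [AddCommMonoid b]
    [Module K b] where
  /-- the bracket -/
  br : G →ₗ[K] G →ₗ[K] G
  /-- the inclusion of the abelian subalgebra -/
  inc : b →ₗ[K] G
  /-- the projection to the abelian subalgebra -/
  prj : G →ₗ[K] b
  /-- the grading of `G` -/
  gDeg : ℤ → Submodule K G
  /-- the grading of `b` -/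
  bDeg : ℤ → Submodule K b
  br_mem : ∀ {a c : ℤ} {X Y : G}, X ∈ gDeg a → Y ∈ gDeg c → br X Y ∈ gDeg (a + c)
  antisymm : ∀ {a c : ℤ} {X Y : G}, X ∈ gDeg a → Y ∈ gDeg c →
    br Y X = (-(-1 : K) ^ (a * c)) • br X Y
  jacobi : ∀ {a c d : ℤ} {X Y Z : G}, X ∈ gDeg a → Y ∈ gDeg c → Z ∈ gDeg d →
    br (br X Y) Z = br X (br Y Z) + (-1 : K) ^ (c * d) • br (br X Z) Y
  inc_mem : ∀ {d : ℤ} {f : b}, f ∈ bDeg d → inc f ∈ gDeg d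
  prj_mem : ∀ {d : ℤ} {X : G}, X ∈ gDeg d → prj X ∈ bDeg d
  br_inc_inc : ∀ f g : b, br (inc f) (inc g) = 0
  -- When `prj` is a left inverse of `inc`, this encodes that ker `prj` is a subalgebra: expand the
  -- projection of the bracket of X - inc (prj X) and Y - inc (prj Y), using that `b` is abelian.
  prj_br : ∀ X Y : G, prj (br X Y) = prj (br X (inc (prj Y))) + prj (br (inc (prj X)) Y)

variable {K G b : Type*} [Field K] [AddCommMonoid G] [Module K G] [AddCommMonoid b] [Module K b]

namespace BracketData

variable (D : BracketData K G b)

/-- The iterated bracket `[⋯[[X, f_1], f_2], …, f_k]` with a list of elements of `b`. -/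
def iter (X : G) (L : List b) : G := L.foldl (fun X f => D.br X (D.inc f)) X

theorem iter_nil (X : G) : D.iter X [] = X := rfl

theorem iter_cons (X : G) (f : b) (L : List b) :
    D.iter X (f :: L) = D.iter (D.br X (D.inc f)) L := rfl

theorem iter_append (X : G) (L L' : List b) :
    D.iter X (L ++ L') = D.iter (D.iter X L) L' := by
  simp [iter]

theorem iter_add (X Y : G) (L : List b) : D.iter (X + Y) L = D.iter X L + D.iter Y L := by
  induction L generalizing X Y with
  | nil => rfl
  | cons f L ih => simp only [iter_cons, map_add, LinearMap.add_apply, ih]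

theorem iter_smul (c : K) (X : G) (L : List b) : D.iter (c • X) L = c • D.iter X L := by
  induction L generalizing X with
  | nil => rfl
  | cons f L ih => simp only [iter_cons, map_smul, LinearMap.smul_apply, ih]

theorem iter_zero (L : List b) : D.iter 0 L = 0 := by
  simpa using D.iter_smul (0 : K) 0 L

/-- Brackets with elements of the abelian subalgebra commute up to sign. -/
theorem br_inc_comm {a c d : ℤ} {X : G} {f g : b} (hX : X ∈ D.gDeg a) (hf : f ∈ D.bDeg c)
    (hg : g ∈ D.bDeg d) :
    D.br (D.br X (D.inc f)) (D.inc g) =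
      (-1 : K) ^ (c * d) • D.br (D.br X (D.inc g)) (D.inc f) := by
  rw [D.jacobi hX (D.inc_mem hf) (D.inc_mem hg), D.br_inc_inc, map_zero, zero_add]

variable {α : Type*} {deg : α → ℤ} {F : α → G} {t : α → b}

theorem iter_mem (ht : ∀ x, t x ∈ D.bDeg (deg x)) {a : ℤ} {X : G} (hX : X ∈ D.gDeg a)
    (L : List α) : D.iter X (L.map t) ∈ D.gDeg (a + (L.map deg).sum) := by
  induction L generalizing a X with
  | nil => simpa [iter_nil] using hX
  | cons x L ih =>
    rw [List.map_cons, List.map_cons, List.sum_cons, ← add_assoc]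
    exact ih (D.br_mem hX (D.inc_mem (ht x)))

theorem gradedSymm_iter (ht : ∀ x, t x ∈ D.bDeg (deg x)) {a : ℤ} {X : G} (hX : X ∈ D.gDeg a) :
    GradedSymm K deg fun L => D.iter X (L.map t) := by
  intro P x y L
  simp only [List.map_append, List.map_cons, iter_append, iter_cons]
  rw [D.br_inc_comm (D.iter_mem ht hX P) (ht x) (ht y), iter_smul]

/-- The projection of an iterated bracket of a bracket `[X, Y]` in terms of those of `X` and `Y`. -/
theorem prj_iter_br (ht : ∀ x, t x ∈ D.bDeg (deg x)) {a c : ℤ} {X Y : G} (hX : X ∈ D.gDeg a)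
    (hY : Y ∈ D.gDeg c) (L : List α) :
    D.prj (D.iter (D.br X Y) (L.map t)) =
      splitSum K deg L fun S T =>
        D.prj (D.iter (D.br X (D.inc (D.prj (D.iter Y (S.map t))))) (T.map t)) +
        (-(-1 : K) ^ (a * c)) •
          D.prj (D.iter (D.br Y (D.inc (D.prj (D.iter X (S.map t))))) (T.map t)) := by
  induction L generalizing a c X Y with
  | nil =>
    simp only [splitSum, List.map_nil, iter_nil]
    rw [D.prj_br, D.antisymm hY (D.inc_mem (D.prj_mem hX)), map_smul, mul_comm c a]
  | cons x L ih =>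
    have hx := D.inc_mem (ht x)
    -- The map [·, t x] is a derivation, so the induction hypothesis applies to [X, [Y, t x]] and to
    -- [[X, t x], Y].
    rw [List.map_cons, iter_cons, D.jacobi hX hY hx, iter_add, iter_smul,
      map_add, map_smul, ih hX (D.br_mem hY hx), ih (D.br_mem hX hx) hY,
      ← splitSum_smul, ← splitSum_add]
    simp only [splitSum]
    rw [← splitSum_add]
    congr 1
    funext S T
    simp only [List.map_cons, iter_cons]
    -- If x belongs to T, it is exchanged with the projected element, so that t x acts directly on X
    -- or Y as in the induction hypotheses.
    rw [D.br_inc_comm hX (D.prj_mem (D.iter_mem ht hY S)) (ht x),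
      D.br_inc_comm hY (D.prj_mem (D.iter_mem ht hX S)) (ht x)]
    simp only [iter_smul, map_smul, smul_add, smul_smul, neg_one_zpow_mul, neg_neg_one_zpow]
    have e1 : (-1 : K) ^ (deg x * (S.map deg).sum + (c + (S.map deg).sum) * deg x) =
        (-1 : K) ^ (c * deg x) := neg_one_zpow_congr (by
      simp only [Int.even_add, Int.even_sub, Int.even_mul]; tauto)
    have e2 : (-1 : K) ^ (deg x * (S.map deg).sum + (a * c + 1 + (a + (S.map deg).sum) * deg x)) =
        (-1 : K) ^ (a * (c + deg x) + 1) := neg_one_zpow_congr (by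
      simp only [Int.even_add, Int.even_sub, Int.even_mul]; tauto)
    have e3 : (-1 : K) ^ (c * deg x + ((a + deg x) * c + 1)) = (-1 : K) ^ (a * c + 1) :=
      neg_one_zpow_congr (by
        simp only [Int.even_add, Int.even_sub, Int.even_mul]; tauto)
    rw [e1, e2, e3]
    abel

variable (deg F t)

/-- The binary operation `[F[1], G[1]] = (-1)^{|F|} [F, G][1]`, extended by zero to all lists. -/
def bin : List α → G
  | [x, y] => (-1 : K) ^ (deg x + 1) • D.br (F x) (F y)
  | _ => 0

/-- The sum of the iterated brackets of one entry of a list with all others. -/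
def mix (L : List α) : b :=
  pullOut K deg L fun x T => D.prj (D.iter (F x) (T.map t))

variable {deg F t}

theorem gradedSymm_bin (hF : ∀ x, F x ∈ D.gDeg (deg x + 1)) :
    GradedSymm K deg (D.bin deg F) := by
  intro P x y L
  match P, L with
  | [], [] =>
    simp only [List.nil_append, bin]
    rw [D.antisymm (hF y) (hF x), smul_smul, smul_smul, neg_neg_one_zpow, neg_one_zpow_mul,
      neg_one_zpow_mul]
    congr 1
    refine neg_one_zpow_congr ?_
    simp only [Int.even_add, Int.even_sub, Int.even_mul]
    tauto
  | [], _ :: _ => simp [bin]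
  | [_], _ => simp [bin]
  | _ :: _ :: _, _ => simp [bin]

theorem gradedSymm_mix (hF : ∀ x, F x ∈ D.gDeg (deg x + 1)) (ht : ∀ x, t x ∈ D.bDeg (deg x)) :
    GradedSymm K deg (D.mix deg F t) := by
  refine gradedSymm_pullOut fun x P y z L => ?_
  have := D.gradedSymm_iter ht (hF x) P y z L
  simp only at this
  rw [this, map_smul]

theorem bin_mem (hF : ∀ x, F x ∈ D.gDeg (deg x + 1)) (L : List α) :
    D.bin deg F L ∈ D.gDeg ((L.map deg).sum + 1 + 1) := by
  match L with
  | [] => exact Submodule.zero_mem _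
  | [_] => exact Submodule.zero_mem _
  | [x, y] =>
    refine Submodule.smul_mem _ _ ?_
    convert D.br_mem (hF x) (hF y) using 2
    simp
    ring
  | _ :: _ :: _ :: _ => exact Submodule.zero_mem _

theorem mix_mem (hF : ∀ x, F x ∈ D.gDeg (deg x + 1)) (ht : ∀ x, t x ∈ D.bDeg (deg x))
    (L : List α) : D.mix deg F t L ∈ D.bDeg ((L.map deg).sum + 1) := by
  have key : ∀ (L : List α) (ψ : α → List α → b) (N : Submodule K b),
      (∀ x T, (x :: T).Perm L → ψ x T ∈ N) → pullOut K deg L ψ ∈ N := by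
    intro L
    induction L with
    | nil => exact fun _ _ _ => Submodule.zero_mem _
    | cons x L ih =>
      intro ψ N h
      rw [pullOut_cons]
      refine Submodule.add_mem _ (h x L (List.Perm.refl _)) (ih _ _ fun y T hy => ?_)
      exact Submodule.smul_mem _ _ (h y (x :: T) ((List.Perm.swap _ _ _).trans (hy.cons x)))
  refine key _ _ _ fun x T h => ?_
  convert D.prj_mem (D.iter_mem ht (hF x) T) using 2
  rw [← (h.map deg).sum_eq, List.map_cons, List.sum_cons]
  ring

/-- The part of the higher Jacobi identity which takes values in the kernel of the projection. -/
theorem splitSum_bin (hF : ∀ x, F x ∈ D.gDeg (deg x + 1)) (L : List α) :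
    splitSum K deg L (fun S T => match T with
      | [z] => (-1 : K) ^ ((S.map deg).sum + 1 + 1) • D.br (D.bin deg F S) (F z)
      | _ => 0) = 0 := by
  -- The inner bracket takes two entries and the outer one a third, so only lists of length 3
  -- contribute. Their unshuffles (xy|z), (xz|y), (yz|x) give the three terms of the graded Jacobi
  -- identity.
  by_cases hL : L.length = 3
  · match L, hL with
    | [x, y, z], _ =>
      simp only [splitSum, bin, List.map_nil, List.map_cons, List.sum_nil, List.sum_cons]
      have h1 := D.jacobi (hF x) (hF y) (hF z)
      rw [D.antisymm (D.br_mem (hF y) (hF z)) (hF x)] at h1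
      simp only [map_smul, LinearMap.smul_apply, h1, smul_zero,
        zero_add, add_zero, mul_zero, smul_add, smul_smul, neg_one_zpow_mul, neg_neg_one_zpow]
      generalize D.br (D.br (F y) (F z)) (F x) = u
      generalize D.br (D.br (F x) (F z)) (F y) = v
      have e : ∀ (p q : ℤ) (u : G), Even (p - q - 1) → (-1 : K) ^ p • u + (-1 : K) ^ q • u = 0 := by
        intro p q u h
        rw [neg_one_zpow_congr (K := K) (b := q + 1) (by rwa [← sub_sub]), ← add_smul,
          ← neg_neg_one_zpow, neg_add_cancel, zero_smul]
      rw [add_assoc, add_assoc, ← add_assoc (_ • v), e, zero_add, e] <;>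
        by_cases hx : Even (deg x) <;> by_cases hy : Even (deg y) <;>
        by_cases hz : Even (deg z) <;>
        simp only [Int.even_add, Int.even_sub, Int.even_mul, Int.not_even_one, hx, hy, hz] <;> decide
  · refine splitSum_eq_zero _ fun S T h => ?_
    have hl := h.length_eq
    match T with
    | [] => rfl
    | [z] =>
      have : D.bin deg F S = 0 := by
        match S with
        | [] => rfl
        | [_] => rfl
        | [_, _] => exact absurd (hl.symm.trans (by simp)) hL
        | _ :: _ :: _ :: _ => rfl
      simp [this]
    | _ :: _ :: _ => rfl

/-- The part of the higher Jacobi identity which takes values in the abelian subalgebra. -/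
theorem splitSum_mix (hF : ∀ x, F x ∈ D.gDeg (deg x + 1)) (ht : ∀ x, t x ∈ D.bDeg (deg x))
    (L : List α) :
    splitSum K deg L (fun S T => D.prj (D.iter (D.bin deg F S) (T.map t)) +
      pullOut K deg T fun y U => (-1 : K) ^ (((S.map deg).sum + 1) * deg y) •
        D.prj (D.iter (F y) (D.mix deg F t S :: U.map t))) = 0 := by
  rw [splitSum_add]
  -- Both kinds of terms become the same sum over ordered pairs (x, y) taken out of L and unshuffles
  -- (S, U) of the rest. The coefficients are (-1)^(deg x + 1) here and (-1)^(deg x) in `e2`, so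
  -- they cancel.
  have e1 : splitSum K deg L (fun S T => D.prj (D.iter (D.bin deg F S) (T.map t))) =
      pullOut K deg L fun x V => pullOut K deg V fun y T => splitSum K deg T fun S U =>
        (-1 : K) ^ (deg x + 1) •
          D.prj (D.iter (D.br (F x) (D.inc (D.prj (D.iter (F y) (S.map t))))) (U.map t)) := by
    rw [pullOut_pullOut]
    congr 1
    funext S T
    match S with
    | [] => simp [bin, iter_zero]
    | [_] => simp [bin, iter_zero]
    | [x, y] =>
      -- The two summands of `prj_iter_br` match the two orders of x and y in `pullOut_pullOut`.
      simp only [bin]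
      rw [iter_smul, map_smul, D.prj_iter_br ht (hF x) (hF y), ← splitSum_smul, ← splitSum_smul,
        ← splitSum_add]
      congr 1
      funext S U
      rw [smul_add, smul_smul, smul_smul, neg_neg_one_zpow, neg_one_zpow_mul, neg_one_zpow_mul]
      congr 2
      refine neg_one_zpow_congr ?_
      simp only [Int.even_add, Int.even_sub, Int.even_mul, Int.not_even_one]
      tauto
    | _ :: _ :: _ :: _ => simp [bin, iter_zero]
  -- The element pulled out of T carries the outer bracket. Expanding `mix` pulls a second one out
  -- of S, and linearity of the outer bracket in its first entry from `b` moves that sum outside.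
  have e2 : splitSum K deg L (fun S T => pullOut K deg T fun y U =>
        (-1 : K) ^ (((S.map deg).sum + 1) * deg y) •
          D.prj (D.iter (F y) (D.mix deg F t S :: U.map t))) =
      pullOut K deg L fun x V => pullOut K deg V fun y T => splitSum K deg T fun S U =>
        (-1 : K) ^ deg x •
          D.prj (D.iter (D.br (F x) (D.inc (D.prj (D.iter (F y) (S.map t))))) (U.map t)) := by
    rw [splitSum_pullOut L fun y S U => (-1 : K) ^ (((S.map deg).sum + 1) * deg y) •
      D.prj (D.iter (F y) (D.mix deg F t S :: U.map t))]
    congr 1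
    funext x V
    rw [← splitSum_pullOut_left]
    congr 1
    funext S U
    rw [smul_smul, neg_one_zpow_mul, pullOut_smul]
    congr 1
    · refine neg_one_zpow_congr ?_
      simp only [Int.even_add, Int.even_sub, Int.even_mul]
      tauto
    · let g : b →ₗ[K] b :=
        { toFun := fun f => D.prj (D.iter (F x) (f :: U.map t))
          map_add' := fun f f' => by simp only [iter_cons, map_add, iter_add]
          map_smul' := fun c f => by
            simp only [iter_cons, map_smul, iter_smul, RingHom.id_apply] }
      exact pullOut_map g S fun y T => D.prj (D.iter (F y) (T.map t))
  rw [e1, e2, ← pullOut_add]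
  refine splitSum_eq_zero _ fun S V _ => ?_
  match S with
  | [] => rfl
  | [x] =>
    simp only [single]
    rw [← pullOut_add]
    refine splitSum_eq_zero _ fun S V _ => ?_
    match S with
    | [] => rfl
    | [y] =>
      simp only [single]
      rw [← splitSum_add]
      refine splitSum_eq_zero _ fun S U _ => ?_
      rw [← add_smul, ← neg_neg_one_zpow, neg_add_cancel, zero_smul]
    | _ :: _ :: _ => rfl
  | _ :: _ :: _ => rfl

end BracketData

end Voronov

/-! ### Homogeneous components of the Gerstenhaber algebra -/

section Components

variable {K : Type*} [Field K]

variable (K) in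
/-- The elements of `⨁ₙ Mₙ` whose components of degree different from `d` vanish. -/
def degPart (M : ℕ → Type*) [∀ n, AddCommMonoid (M n)] [∀ n, Module K (M n)] (d : ℤ) :
    Submodule K (⨁ n, M n) where
  carrier := {X | ∀ n : ℕ, (n : ℤ) ≠ d → X n = 0}
  add_mem' hX hY n hn := by simp [hX n hn, hY n hn]
  zero_mem' n _ := by simp
  smul_mem' c X hX n hn := by
    rw [DirectSum.smul_apply, hX n hn, smul_zero]

variable {M : ℕ → Type*} [∀ n, AddCommMonoid (M n)] [∀ n, Module K (M n)]

theorem lof_mem_degPart (n : ℕ) (x : M n) : DirectSum.lof K ℕ M n x ∈ degPart K M n := by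
  intro m hm
  rw [DirectSum.lof_eq_of, DirectSum.of_eq_of_ne]
  exact_mod_cast hm

theorem eq_lof_of_mem_degPart {n : ℕ} {X : ⨁ n, M n} (hX : X ∈ degPart K M n) :
    X = DirectSum.lof K ℕ M n (X n) := by
  refine DFinsupp.ext fun m => ?_
  rcases eq_or_ne m n with rfl | h
  · exact (DirectSum.lof_apply K (M := M) m (X m)).symm
  · rw [lof_mem_degPart n _ m (by exact_mod_cast h)]
    exact hX m (by exact_mod_cast h)

theorem mem_degPart_cases {d : ℤ} {X : ⨁ n, M n} (hX : X ∈ degPart K M d) :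
    X = 0 ∨ ∃ (n : ℕ) (x : M n), d = n ∧ X = DirectSum.lof K ℕ M n x := by
  rcases lt_or_ge d 0 with h | h
  · left
    exact DFinsupp.ext fun m => hX m (by omega)
  · right
    obtain ⟨n, rfl⟩ := Int.eq_ofNat_of_zero_le h
    exact ⟨n, X n, rfl, eq_lof_of_mem_degPart hX⟩

end Components

/-! ### The graded Lie identities for homogeneous elements of integer degree -/

section GradedBracket

variable {K : Type*} [Field K] {W : Type*} [AddCommGroup W] [Module K W]

variable (K W) in
/-- The homogeneous part of degree `d` of the Gerstenhaber algebra. -/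
abbrev gerstDeg (d : ℤ) : Submodule K (Gerst K W) := degPart K (Multi K W) d

theorem bracket_mem_gerstDeg {a b : ℤ} {X Y : Gerst K W} (hX : X ∈ gerstDeg K W a)
    (hY : Y ∈ gerstDeg K W b) : bracket K W X Y ∈ gerstDeg K W (a + b) := by
  rcases mem_degPart_cases hX with rfl | ⟨m, x, rfl, rfl⟩
  · simp
  rcases mem_degPart_cases hY with rfl | ⟨n, y, rfl, rfl⟩
  · simp
  rw [bracket_lof]
  refine Submodule.sub_mem _ ?_ (Submodule.smul_mem _ _ ?_)
  · exact_mod_cast lof_mem_degPart (m + n) _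
  · rw [add_comm (m : ℤ)]
    exact_mod_cast lof_mem_degPart (n + m) _

theorem bracket_antisymm_of_mem {a b : ℤ} {X Y : Gerst K W} (hX : X ∈ gerstDeg K W a)
    (hY : Y ∈ gerstDeg K W b) :
    bracket K W Y X = (-(-1 : K) ^ (a * b)) • bracket K W X Y := by
  rcases mem_degPart_cases hX with rfl | ⟨m, x, rfl, rfl⟩
  · simp
  rcases mem_degPart_cases hY with rfl | ⟨n, y, rfl, rfl⟩
  · simp
  rw [bracket_antisymm]
  norm_cast

theorem bracket_jacobi_of_mem {a b c : ℤ} {X Y Z : Gerst K W} (hX : X ∈ gerstDeg K W a)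
    (hY : Y ∈ gerstDeg K W b) (hZ : Z ∈ gerstDeg K W c) :
    bracket K W (bracket K W X Y) Z =
      bracket K W X (bracket K W Y Z) + (-1 : K) ^ (b * c) • bracket K W (bracket K W X Z) Y := by
  rcases mem_degPart_cases hX with rfl | ⟨m, x, rfl, rfl⟩
  · simp
  rcases mem_degPart_cases hY with rfl | ⟨n, y, rfl, rfl⟩
  · simp
  rcases mem_degPart_cases hZ with rfl | ⟨p, z, rfl, rfl⟩
  · simp
  rw [bracket_jacobi]
  norm_cast

/-- Bracketing with an element of degree `0` is a derivation. -/
theorem bracket_bracket_lof_zero (X Y : Gerst K W) (f : Multi K W 0) :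
    bracket K W (bracket K W X Y) (DirectSum.lof K ℕ _ 0 f) =
      bracket K W X (bracket K W Y (DirectSum.lof K ℕ _ 0 f)) +
        bracket K W (bracket K W X (DirectSum.lof K ℕ _ 0 f)) Y := by
  induction X using DirectSum.induction_on with
  | zero => simp
  | add X X' h h' => simp only [map_add, LinearMap.add_apply, h, h']; abel
  | of m x =>
    induction Y using DirectSum.induction_on with
    | zero => simp
    | add Y Y' h h' => simp only [map_add, LinearMap.add_apply, h, h']; abel
    | of n y =>
      rw [← DirectSum.lof_eq_of K, ← DirectSum.lof_eq_of K, bracket_jacobi]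
      simp

end GradedBracket

/-! ### The abelian subalgebra and the complementary subalgebra -/

section Projection

variable {K : Type*} [Field K] {A B : Type*} [AddCommGroup A] [Module K A]
  [AddCommGroup B] [Module K B]

variable (K A B) in
/-- The homogeneous part of degree `d` of `𝔟`. -/
abbrev abDeg (d : ℤ) : Submodule K (AbB K A B) :=
  degPart K (fun n => MultilinearMap K (fun _ : Fin (n + 1) => B) A) d

/-- The inclusion of `Hom(B^{⊗ n+1}, A)`. -/
def inclHom {n : ℕ} (f : MultilinearMap K (fun _ : Fin (n + 1) => B) A) : Multi K (A × B) n :=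
  (LinearMap.inl K A B).compMultilinearMap (f.compLinearMap fun _ => LinearMap.snd K A B)

theorem inclHom_apply {n : ℕ} (f : MultilinearMap K (fun _ : Fin (n + 1) => B) A)
    (v : Fin (n + 1) → A × B) : inclHom f v = (f fun i => (v i).2, 0) := rfl

theorem incl_lof {n : ℕ} (f : MultilinearMap K (fun _ : Fin (n + 1) => B) A) :
    incl (DirectSum.lof K ℕ _ n f) = DirectSum.lof K ℕ (Multi K (A × B)) n (inclHom f) :=
  DirectSum.lmap_lof ..

theorem proj_apply (F : Gerst K (A × B)) (n : ℕ) (v : Fin (n + 1) → B) :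
    proj F n v = (F n fun i => ((0 : A), v i)).1 := by
  rw [proj, DirectSum.lmap_apply]
  rfl

theorem incl_mem_gerstDeg {d : ℤ} {f : AbB K A B} (hf : f ∈ abDeg K A B d) :
    incl f ∈ gerstDeg K (A × B) d := by
  intro n hn
  rw [incl, DirectSum.lmap_apply, hf n hn, map_zero]

theorem proj_mem_abDeg {d : ℤ} {F : Gerst K (A × B)} (hF : F ∈ gerstDeg K (A × B) d) :
    proj F ∈ abDeg K A B d := by
  intro n hn
  rw [proj, DirectSum.lmap_apply, hF n hn, map_zero]

/-- The inner map takes values in A, while the outer one reads only the B-components of its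
arguments. -/
theorem circ_inclHom {m n : ℕ} (f : MultilinearMap K (fun _ : Fin (m + 1) => B) A)
    (g : MultilinearMap K (fun _ : Fin (n + 1) => B) A) :
    circ m n (inclHom f) (inclHom g) = 0 := by
  change (∑ i : Fin (m + 1), (-1 : K) ^ (i.val * n) • insertAt i (inclHom f) (inclHom g)) = 0
  refine Finset.sum_eq_zero fun i _ => ?_
  have : insertAt i (inclHom f) (inclHom g) = 0 := by
    ext1 v
    rw [insertAt_apply, inclHom_apply, MultilinearMap.map_coord_zero f i]
    · rfl
    · simp [outerArgs, inclHom_apply]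
  rw [this, smul_zero]

theorem bracket_incl_incl (f g : AbB K A B) : bracket K (A × B) (incl f) (incl g) = 0 := by
  induction f using DirectSum.induction_on with
  | zero => simp
  | add f f' h h' => simp [h, h']
  | of m f =>
    induction g using DirectSum.induction_on with
    | zero => simp
    | add g g' h h' => simp [h, h']
    | of n g =>
      rw [← DirectSum.lof_eq_of K, ← DirectSum.lof_eq_of K, incl_lof, incl_lof, bracket_lof,
        circ_inclHom, circ_inclHom]
      simp

theorem proj_incl (f : AbB K A B) : proj (incl f) = f := by
  refine DFinsupp.ext fun n => MultilinearMap.ext fun v => ?_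
  change proj (incl f) n v = f n v
  rw [proj_apply, incl, DirectSum.lmap_apply]
  rfl

theorem mem_Q_iff (F : Gerst K (A × B)) : F ∈ Q K A B ↔ proj F = 0 := by
  constructor
  · intro h
    refine DFinsupp.ext fun n => MultilinearMap.ext fun v => ?_
    exact (proj_apply F n v).trans ((mem_homQ_iff _).1 (h n) v)
  · intro h n
    rw [mem_homQ_iff]
    intro v
    rw [← proj_apply, h]
    rfl

theorem sub_incl_proj_mem_Q (F : Gerst K (A × B)) : F - incl (proj F) ∈ Q K A B := by
  rw [mem_Q_iff, map_sub, proj_incl, sub_self]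

/-- The subalgebra 𝒬 contains X - `incl (proj X)` and Y - `incl (proj Y)`, hence their bracket, and
the brackets inside 𝔟 vanish in the expansion. -/
theorem proj_bracket (X Y : Gerst K (A × B)) :
    proj (bracket K (A × B) X Y) = proj (bracket K (A × B) X (incl (proj Y))) +
      proj (bracket K (A × B) (incl (proj X)) Y) := by
  have h := (mem_Q_iff _).1 (bracket_mem_Q (sub_incl_proj_mem_Q X) (sub_incl_proj_mem_Q Y))
  simp only [map_sub, LinearMap.sub_apply, bracket_incl_incl, map_zero] at h
  rw [← sub_eq_zero, ← h]
  abel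

variable (K A B) in
/-- The Gerstenhaber algebra with its projection to `𝔟`. -/
def gerstData : BracketData K (Gerst K (A × B)) (AbB K A B) where
  br := bracket K (A × B)
  inc := incl
  prj := proj
  gDeg := gerstDeg K (A × B)
  bDeg := abDeg K A B
  br_mem := bracket_mem_gerstDeg
  antisymm := bracket_antisymm_of_mem
  jacobi := bracket_jacobi_of_mem
  inc_mem := incl_mem_gerstDeg
  prj_mem := proj_mem_abDeg
  br_inc_inc := bracket_incl_incl
  prj_br := proj_bracket

theorem iterBracket_eq_iter (k : ℕ) (X : Gerst K (A × B)) (f : Fin k → AbB K A B) :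
    iterBracket k X f = (gerstData K A B).iter X (List.ofFn f) := by
  induction k generalizing X with
  | zero => rfl
  | succ k ih =>
    rw [iterBracket_succ, ih, List.ofFn_succ]
    rfl

end Projection

/-! ### Vanishing of long iterated brackets -/

/-- By the derivation property, each bracket with `b` lowers the eigenvalue of [·, e] by 1, so the
iterated bracket has eigenvalue k - |L|. Its projection can only have eigenvalue -1, so it vanishes
unless the two agree. -/
theorem BracketData.prj_iter_eq_zero {K G b : Type*} [Field K] [AddCommMonoid G] [Module K G]
    [AddCommGroup b] [Module K b] (D : BracketData K G b) {e : G}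
    (he : ∀ X Y, D.br (D.br X Y) e = D.br X (D.br Y e) + D.br (D.br X e) Y)
    (hinc : ∀ f, D.br (D.inc f) e = (-1 : K) • D.inc f)
    (hprj : ∀ X, D.prj (D.br X e) = (-1 : K) • D.prj X) {X : G} {k : K} (hX : D.br X e = k • X)
    (L : List b) (hk : k - L.length + 1 ≠ 0) : D.prj (D.iter X L) = 0 := by
  have key : ∀ (L : List b) (X : G) (k : K), D.br X e = k • X →
      D.br (D.iter X L) e = (k - L.length) • D.iter X L := by
    intro L
    induction L with
    | nil =>
      intro X k hX
      simpa [D.iter_nil] using hX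
    | cons f L ih =>
      intro X k hX
      rw [D.iter_cons, ih _ (k - 1)]
      · congr 1
        push_cast [List.length_cons]
        ring
      · rw [he, hinc, hX]
        simp only [map_smul, LinearMap.smul_apply]
        rw [← add_smul]
        congr 1
        ring
  have h := congrArg D.prj (key L X k hX)
  rw [hprj, map_smul] at h
  have h' : (k - L.length + 1) • D.prj (D.iter X L) = 0 := by
    rw [add_smul, ← h, ← add_smul]
    simp
  exact (smul_eq_zero.1 h').resolve_left hk

section Vanishing

variable {K : Type*} [Field K] {A B : Type*} [AddCommGroup A] [Module K A]
  [AddCommGroup B] [Module K B]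

variable (K A B) in
/-- The Euler element `(a, x) ↦ (a, 0)`; bracketing with it detects the bidegree. -/
def euler : Multi K (A × B) 0 :=
  MultilinearMap.ofSubsingleton K (A × B) (A × B) (0 : Fin 1)
    (LinearMap.inl K A B ∘ₗ LinearMap.fst K A B)

theorem euler_apply (v : Fin 1 → A × B) : euler K A B v = ((v 0).1, 0) := rfl

theorem ext_pure {n : ℕ} {f g : Multi K (A × B) n}
    (h : ∀ (s : Finset (Fin (n + 1))) (v : Fin (n + 1) → A × B),
      (∀ i ∈ s, (v i).2 = 0) → (∀ i ∉ s, (v i).1 = 0) → f v = g v) : f = g := by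
  ext1 v
  have hv : v = (fun i => ((v i).1, (0 : B))) + (fun i => ((0 : A), (v i).2)) := by
    funext i
    simp
  rw [hv, MultilinearMap.map_add_univ, MultilinearMap.map_add_univ]
  refine Finset.sum_congr rfl fun s _ => h s _ (fun i hi => ?_) fun i hi => ?_
  · simp [hi]
  · simp [hi]

/-- Inserting e at each place counts the entries from A. On C^{k|l} this number is k + 1 where the
value lies in A and k where it lies in B, which is k plus the projection to A. -/
theorem circ_euler {n : ℕ} {k : ℤ} {f : Multi K (A × B) n} (hf : f ∈ bidegree K A B n k) :
    circ n 0 f (euler K A B) =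
      (k : K) • f + (LinearMap.inl K A B ∘ₗ LinearMap.fst K A B).compMultilinearMap f := by
  refine ext_pure fun s v h1 h2 => ?_
  have hsum : circ n 0 f (euler K A B) v = (s.card : K) • f v := by
    change (∑ i : Fin (n + 1), (-1 : K) ^ (i.val * 0) • insertAt i f (euler K A B)) v = _
    rw [_root_.sum_apply]
    have : ∀ i : Fin (n + 1), ((-1 : K) ^ (i.val * 0) • insertAt i f (euler K A B)) v =
        if i ∈ s then f v else 0 := by
      intro i
      rw [mul_zero, pow_zero, one_smul, insertAt_apply, euler_apply]
      have hin : innerArgs (n := 0) i v 0 = v i := rfl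
      rw [hin]
      split_ifs with hi
      · congr 1
        funext j
        simp only [outerArgs]
        split_ifs with hj hj'
        · rfl
        · subst hj'
          exact Prod.ext rfl (h1 _ hi).symm
        · rfl
      · refine MultilinearMap.map_coord_zero _ i ?_
        simp [outerArgs, h2 i hi]
    simp only [this]
    rw [Finset.sum_ite_mem, Finset.univ_inter, Finset.sum_const, Nat.cast_smul_eq_nsmul]
  obtain ⟨a1, a2, a3⟩ := hf s v h1 h2
  rw [hsum, _root_.add_apply, _root_.smul_apply, LinearMap.compMultilinearMap_apply]
  have hcast : (s.card : K) = ((s.card : ℤ) : K) := by simp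
  rw [hcast]
  by_cases hk : (s.card : ℤ) = k + 1
  · rw [hk]
    refine Prod.ext ?_ ?_
    · simp [add_smul]
    · simp [a1 hk]
  · by_cases hk' : (s.card : ℤ) = k
    · rw [hk']
      refine Prod.ext ?_ ?_
      · simp [a2 hk']
      · simp
    · rw [a3 hk hk', smul_zero, smul_zero, map_zero, add_zero]

/-- The other composition e ⋄ f is the A-part of f and removes the extra summand of `circ_euler`. -/
theorem bracket_euler {n : ℕ} {k : ℤ} {f : Multi K (A × B) n} (hf : f ∈ bidegree K A B n k) :
    bracket K (A × B) (DirectSum.lof K ℕ _ n f) (DirectSum.lof K ℕ _ 0 (euler K A B)) =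
      (k : K) • DirectSum.lof K ℕ _ n f := by
  have h : DirectSum.lof K ℕ (Multi K (A × B)) (0 + n) (circ 0 n (euler K A B) f) =
      DirectSum.lof K ℕ (Multi K (A × B)) n
        ((LinearMap.inl K A B ∘ₗ LinearMap.fst K A B).compMultilinearMap f) := by
    refine lof_eq_lof (zero_add n) fun a => ?_
    rw [evalSeq_circ]
    simp [evalSeq, insertSeq, euler_apply]
  rw [bracket_lof, h, circ_euler hf]
  change DirectSum.lof K ℕ (Multi K (A × B)) n _ - _ = _
  simp

theorem inclHom_mem_bidegree {n : ℕ} (f : MultilinearMap K (fun _ : Fin (n + 1) => B) A) :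
    inclHom f ∈ bidegree K A B n (-1) := by
  intro s v h1 _
  refine ⟨fun _ => rfl, fun h => by omega, fun h _ => ?_⟩
  obtain ⟨i, hi⟩ : s.Nonempty := by
    rw [← Finset.card_pos]
    omega
  rw [inclHom_apply, MultilinearMap.map_coord_zero f i (h1 i hi)]
  rfl

theorem bracket_incl_euler (f : AbB K A B) :
    bracket K (A × B) (incl f) (DirectSum.lof K ℕ _ 0 (euler K A B)) = (-1 : K) • incl f := by
  induction f using DirectSum.induction_on with
  | zero => simp
  | add f f' h h' => simp only [map_add, LinearMap.add_apply, h, h', smul_add]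
  | of m f =>
    rw [← DirectSum.lof_eq_of K, incl_lof, bracket_euler (inclHom_mem_bidegree f)]
    rw [Int.cast_neg, Int.cast_one]

theorem lof_euler_mem_Q : DirectSum.lof K ℕ (Multi K (A × B)) 0 (euler K A B) ∈ Q K A B :=
  lof_mem_Q ((mem_homQ_iff _).2 fun _ => rfl)

theorem proj_bracket_euler (X : Gerst K (A × B)) :
    proj (bracket K (A × B) X (DirectSum.lof K ℕ _ 0 (euler K A B))) =
      (-1 : K) • proj X := by
  rw [proj_bracket, (mem_Q_iff _).1 lof_euler_mem_Q, bracket_incl_euler, map_smul, proj_incl]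
  simp

/-- The condition is linear in f, so it suffices to treat each C^{k|l} with k ≤ n + 1. Then k - |L|
+ 1 is a negative integer, and characteristic 0 keeps it non-zero in K. -/
theorem proj_iter_eq_zero [CharZero K] {n : ℕ} {f : Multi K (A × B) n}
    (hf : f ∈ homQ K A B n) (L : List (AbB K A B)) (hL : n + 3 ≤ L.length) :
    proj ((gerstData K A B).iter (DirectSum.lof K ℕ _ n f) L) = 0 := by
  let S : Submodule K (Multi K (A × B) n) :=
    { carrier := {f | proj ((gerstData K A B).iter (DirectSum.lof K ℕ _ n f) L) = 0}
      add_mem' := by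
        intro f g hf hg
        simp only [Set.mem_ofPred_eq] at hf hg ⊢
        rw [map_add, BracketData.iter_add, map_add, hf, hg, add_zero]
      zero_mem' := by
        simp only [Set.mem_ofPred_eq]
        rw [map_zero, BracketData.iter_zero, map_zero]
      smul_mem' := by
        intro c f hf
        simp only [Set.mem_ofPred_eq] at hf ⊢
        rw [map_smul, BracketData.iter_smul, map_smul, hf, smul_zero] }
  have hle : homQ K A B n ≤ S := by
    refine iSup₂_le fun k hk g hg => ?_
    rw [Finset.mem_Icc] at hk
    change proj ((gerstData K A B).iter (DirectSum.lof K ℕ _ n g) L) = 0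
    refine (gerstData K A B).prj_iter_eq_zero (fun X Y => bracket_bracket_lof_zero X Y _)
      bracket_incl_euler proj_bracket_euler (bracket_euler hg) L ?_
    have : (k : K) - L.length + 1 = ((k - L.length + 1 : ℤ) : K) := by push_cast; rfl
    rw [this]
    exact Int.cast_ne_zero.2 (by omega)
  exact hle hf

end Vanishing

/-! ### Koszul signs of permutations -/

section Koszul

variable {K : Type*} [Field K]

theorem koszulSign_one {N : ℕ} (d : Fin N → ℤ) : koszulSign K d 1 = 1 := by
  rw [koszulSign, Finset.filter_false_of_mem, Finset.prod_empty]
  rintro p - ⟨h1, h2⟩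
  exact absurd h1 (not_lt_of_gt h2)

/-- An adjacent transposition creates or removes exactly one inversion, that of the two exchanged
entries, and preserves the order of all other pairs. The sign of that inversion squares to 1, so
creating and removing it have the same effect. -/
theorem koszulSign_mul_swap {N : ℕ} (d : Fin (N + 1) → ℤ) (σ : Equiv.Perm (Fin (N + 1)))
    (i : Fin N) :
    koszulSign K d (σ * Equiv.swap i.castSucc i.succ) =
      (-1 : K) ^ (d (σ i.castSucc) * d (σ i.succ)) * koszulSign K d σ := by
  set s := Equiv.swap i.castSucc i.succ with hs
  have hne : i.castSucc ≠ i.succ := Fin.castSucc_lt_succ.ne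
  have hss : ∀ a, s (s a) = a := fun a => by
    rw [hs, ← Equiv.Perm.mul_apply, Equiv.swap_mul_self]
    rfl
  have hmono : ∀ a b : Fin (N + 1), a < b → (a, b) ≠ (i.castSucc, i.succ) → s a < s b := by
    intro a b hab hne'
    rw [hs, Equiv.swap_apply_def, Equiv.swap_apply_def]
    rw [Ne, Prod.mk.injEq] at hne'
    simp only [Fin.ext_iff, Fin.lt_def, Fin.val_castSucc, Fin.val_succ] at *
    split_ifs <;> simp <;> omega
  let w : Fin (N + 1) × Fin (N + 1) → K := fun q => (-1 : K) ^ (d (σ q.1) * d (σ q.2))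
  have h1 : koszulSign K d (σ * s) =
      ∏ q : Fin (N + 1) × Fin (N + 1) with s q.1 < s q.2 ∧ σ q.2 < σ q.1, w q := by
    rw [koszulSign]
    refine Finset.prod_equiv (Equiv.prodCongr s s) (fun p => ?_) fun p _ => rfl
    rw [Finset.mem_filter, Finset.mem_filter]
    simp [hss]
  have hlt : ∀ q : Fin (N + 1) × Fin (N + 1), q ≠ (i.castSucc, i.succ) →
      q ≠ (i.succ, i.castSucc) → (s q.1 < s q.2 ↔ q.1 < q.2) := by
    intro q hq hq'
    constructor
    · intro h
      have := hmono _ _ h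
      rw [hss, hss] at this
      refine this fun h' => hq' ?_
      rw [Prod.mk.injEq] at h'
      refine Prod.ext ?_ ?_
      · rw [← hss q.1, h'.1, hs, Equiv.swap_apply_left]
      · rw [← hss q.2, h'.2, hs, Equiv.swap_apply_right]
    · intro h
      exact hmono _ _ h hq
  have hsq : w (i.castSucc, i.succ) * w (i.castSucc, i.succ) = 1 := by
    simp only [w]
    rw [neg_one_zpow_mul, ← two_mul, zpow_mul]
    simp
  have hsymm : w (i.succ, i.castSucc) = w (i.castSucc, i.succ) := by
    simp only [w]
    rw [mul_comm]
  have hs1 : s i.castSucc = i.succ := Equiv.swap_apply_left ..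
  have hs2 : s i.succ = i.castSucc := Equiv.swap_apply_right ..
  have hi : i.castSucc < i.succ := Fin.castSucc_lt_succ
  have hdisj : (i.castSucc, i.succ) ≠ (i.succ, i.castSucc) := fun h => hne (Prod.mk.inj h).1
  rw [h1, koszulSign, Finset.prod_filter, Finset.prod_filter]
  have hsplit : ∀ g : Fin (N + 1) × Fin (N + 1) → K, ∏ q, g q =
      g (i.castSucc, i.succ) * g (i.succ, i.castSucc) *
        ∏ q ∈ (Finset.univ.erase (i.castSucc, i.succ)).erase (i.succ, i.castSucc), g q := by
    intro g
    rw [mul_assoc, Finset.mul_prod_erase _ _ (by simp [hdisj.symm]),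
      Finset.mul_prod_erase _ _ (Finset.mem_univ _)]
  rw [hsplit, hsplit fun q => if q.1 < q.2 ∧ σ q.2 < σ q.1 then _ else _, ← mul_assoc]
  congr 1
  · simp only [hs1, hs2, hi, hi.not_gt, true_and, false_and, if_false, one_mul, mul_one]
    have hσ : σ i.castSucc ≠ σ i.succ := fun h => hne (σ.injective h)
    rcases lt_or_gt_of_ne hσ with h | h
    · rw [if_pos h, if_neg h.not_gt, mul_one, hsymm]
    · rw [if_neg h.not_gt, if_pos h]
      exact hsq.symm
  · refine Finset.prod_congr rfl fun q hq => ?_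
    rw [Finset.mem_erase, Finset.mem_erase] at hq
    exact if_congr (and_congr_left' (hlt q hq.2.1 hq.1)) rfl rfl

/-- Adjacent transpositions generate the symmetric group, and `koszulSign_mul_swap` multiplies the
signs along a word just as the symmetry of φ does. -/
theorem GradedSymm.apply_ofFn {α : Type*} {deg : α → ℤ} {M : Type*} [AddCommMonoid M] [Module K M]
    {φ : List α → M} (hφ : GradedSymm K deg φ) {N : ℕ} (h : Fin N → α)
    (σ : Equiv.Perm (Fin N)) :
    φ (List.ofFn fun i => h (σ i)) =
      koszulSign K (fun i => deg (h i)) σ • φ (List.ofFn h) := by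
  match N with
  | 0 =>
    rw [Subsingleton.elim σ 1, koszulSign_one, one_smul]
    rfl
  | N + 1 =>
    have hadj : ∀ (h : Fin (N + 1) → α) (i : Fin N),
        φ (List.ofFn fun j => h (Equiv.swap i.castSucc i.succ j)) =
          (-1 : K) ^ (deg (h i.castSucc) * deg (h i.succ)) • φ (List.ofFn h) := by
      intro h i
      have key : ∀ g : Fin (N + 1) → α, List.ofFn g = (List.ofFn g).take i ++
          g i.castSucc :: g i.succ :: (List.ofFn g).drop (i + 2) := by
        intro g
        conv_lhs => rw [← List.take_append_drop i (List.ofFn g)]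
        congr 1
        rw [List.drop_eq_getElem_cons (by simp), List.drop_eq_getElem_cons (by simp)]
        simp only [List.getElem_ofFn]
        rfl
      have ht : (List.ofFn fun j => h (Equiv.swap i.castSucc i.succ j)).take i =
          (List.ofFn h).take i := by
        refine List.ext_getElem (by simp) fun k h1 h2 => ?_
        have hk : k < i := by simp at h1; omega
        simp only [List.getElem_take, List.getElem_ofFn]
        rw [Equiv.swap_apply_of_ne_of_ne] <;> simp [Fin.ext_iff] <;> omega
      have hd : (List.ofFn fun j => h (Equiv.swap i.castSucc i.succ j)).drop (i + 2) =
          (List.ofFn h).drop (i + 2) := by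
        refine List.ext_getElem (by simp) fun k h1 h2 => ?_
        simp only [List.getElem_drop, List.getElem_ofFn]
        rw [Equiv.swap_apply_of_ne_of_ne] <;> simp [Fin.ext_iff] <;> omega
      rw [key h, key fun j => h (Equiv.swap i.castSucc i.succ j), ht, hd,
        Equiv.swap_apply_left, Equiv.swap_apply_right, hφ, mul_comm]
    have hσ : σ ∈ Submonoid.closure
        (Set.range fun i : Fin N => Equiv.swap i.castSucc i.succ) := by
      rw [Equiv.Perm.mclosure_swap_castSucc_succ]
      trivial
    induction hσ using Submonoid.closure_induction_right with
    | one =>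
      rw [koszulSign_one, one_smul]
      rfl
    | mul_right τ _ y hy ih =>
      obtain ⟨i, rfl⟩ := hy
      rw [koszulSign_mul_swap, mul_smul, ← ih]
      exact hadj (fun j => h (τ j)) i

end Koszul

/-! ### Unshuffles of lists and shuffles -/

section Shuffles

variable {K : Type*} [Field K] {α : Type*} {deg : α → ℤ} {M : Type*} [AddCommMonoid M] [Module K M]

/-- The indices with the value `c`, in increasing order. -/
def indices {N : ℕ} (p : Fin N → Bool) (c : Bool) : List (Fin N) :=
  (List.finRange N).filter fun i => p i = c

theorem mem_indices {N : ℕ} {p : Fin N → Bool} {c : Bool} {i : Fin N} :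
    i ∈ indices p c ↔ p i = c := by
  simp [indices]

theorem nodup_indices {N : ℕ} (p : Fin N → Bool) (c : Bool) : (indices p c).Nodup :=
  (List.nodup_finRange N).filter _

theorem pairwise_indices {N : ℕ} (p : Fin N → Bool) (c : Bool) :
    (indices p c).Pairwise (· < ·) := by
  have : (List.finRange N).Pairwise (· < ·) := by
    rw [List.pairwise_iff_getElem]
    intro i j hi hj hij
    simpa [Fin.lt_def] using hij
  exact this.filter _

theorem length_indices {N : ℕ} (p : Fin N → Bool) :
    (indices p true).length + (indices p false).length = N := by
  have h := List.length_eq_length_filter_add (l := List.finRange N) (fun i => p i = true)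
  rw [List.length_finRange] at h
  conv_rhs => rw [h]
  simp [indices]

theorem indices_cons {N : ℕ} (b : Bool) (p : Fin N → Bool) (c : Bool) :
    indices (Fin.cons b p : Fin (N + 1) → Bool) c =
      if b = c then 0 :: (indices p c).map Fin.succ else (indices p c).map Fin.succ := by
  rw [indices, List.finRange_succ, List.filter_cons, List.filter_map]
  by_cases h : b = c
  · simp [h, indices, Function.comp_def]
  · simp [h, indices, Function.comp_def]

variable (K) in
/-- The Koszul sign of the unshuffle with the entries of value `true` moved to the left. -/
def unshuffleSign {N : ℕ} (d : Fin N → ℤ) (p : Fin N → Bool) : K :=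
  ∏ u : Fin N, ∏ v : Fin N,
    if v < u ∧ p u = true ∧ p v = false then (-1 : K) ^ (d u * d v) else 1

theorem neg_one_zpow_list_sum (d : List ℤ) (e : ℤ) :
    (-1 : K) ^ (e * d.sum) = (d.map fun x => (-1 : K) ^ (x * e)).prod := by
  induction d with
  | nil => simp
  | cons x d ih => rw [List.sum_cons, mul_add, ← neg_one_zpow_mul, List.map_cons, List.prod_cons,
      ih, mul_comm x]

/-- A new first entry is inverted only if it goes to the right, and then exactly with the entries
that go to the left. This matches the recursion of `splitSum`. -/
theorem unshuffleSign_cons {N : ℕ} (e : ℤ) (d : Fin N → ℤ) (b : Bool) (p : Fin N → Bool) :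
    unshuffleSign K (Fin.cons e d : Fin (N + 1) → ℤ) (Fin.cons b p) =
      (if b = true then 1 else (-1 : K) ^ (e * ((indices p true).map d).sum)) *
        unshuffleSign K d p := by
  rw [unshuffleSign, Fin.prod_univ_succ]
  simp only [Fin.prod_univ_succ, Fin.cons_zero, Fin.cons_succ, Fin.not_lt_zero, false_and, if_false,
    Fin.succ_pos, true_and, Fin.succ_lt_succ_iff, Finset.prod_const_one, one_mul]
  rw [Finset.prod_mul_distrib]
  congr 1
  cases b with
  | true => simp
  | false =>
    have hf : ∀ (l : List (Fin N)) (f : Fin N → K),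
        ((l.filter fun i => p i = true).map f).prod =
          (l.map fun i => if p i = true then f i else 1).prod := by
      intro l f
      induction l with
      | nil => rfl
      | cons i l ih => by_cases hi : p i = true <;> simp [hi, ← ih]
    rw [neg_one_zpow_list_sum, List.map_map, indices, hf]
    simp [← List.prod_ofFn, List.ofFn_eq_map]

theorem splitSum_ofFn {N : ℕ} (h : Fin N → α) (Ψ : List α → List α → M) :
    splitSum K deg (List.ofFn h) Ψ =
      ∑ p : Fin N → Bool, unshuffleSign K (fun i => deg (h i)) p •
        Ψ ((indices p true).map h) ((indices p false).map h) := by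
  induction N generalizing Ψ with
  | zero =>
    rw [List.ofFn_zero, Fintype.sum_unique]
    simp [splitSum, unshuffleSign, indices]
  | succ N ih =>
    rw [List.ofFn_succ, splitSum, ih, ih,
      ← Equiv.sum_comp (Fin.consEquiv fun _ : Fin (N + 1) => Bool), Fintype.sum_prod_type,
      Fintype.sum_bool]
    have hd : (fun i => deg (h i)) = Fin.cons (deg (h 0)) fun i => deg (h (Fin.succ i)) := by
      funext i
      refine Fin.cases rfl (fun i => rfl) i
    congr 1
    · refine Finset.sum_congr rfl fun p _ => ?_
      have hp : (Fin.consEquiv fun _ : Fin (N + 1) => Bool) (true, p) = Fin.cons true p := rfl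
      rw [hp, hd, unshuffleSign_cons, indices_cons, indices_cons]
      simp [Function.comp_def]
    · refine Finset.sum_congr rfl fun p _ => ?_
      have hp : (Fin.consEquiv fun _ : Fin (N + 1) => Bool) (false, p) = Fin.cons false p := rfl
      rw [hp, hd, unshuffleSign_cons, indices_cons, indices_cons]
      simp [Function.comp_def, smul_smul, mul_comm]

/-- The entries which a shuffle moves to the left. -/
def leftOf {N : ℕ} (i : ℕ) (σ : Equiv.Perm (Fin N)) : Fin N → Bool :=
  fun j => decide ((σ.symm j).val < i)

/-- Both lists are strictly increasing and have the same members. The same argument serves the right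
block below. -/
theorem indices_leftOf_true {N : ℕ} {i : ℕ} (hi : i ≤ N) {σ : Equiv.Perm (Fin N)}
    (hσ : σ ∈ shuffles i N) :
    indices (leftOf i σ) true = List.ofFn fun j : Fin i => σ ⟨j.val, by omega⟩ := by
  simp only [shuffles, Finset.mem_filter] at hσ
  refine List.Perm.eq_of_pairwise' (r := (· ≤ ·))
    ((pairwise_indices _ _).imp le_of_lt) ?_ ?_
  · rw [List.pairwise_ofFn]
    intro a b hab
    exact (hσ.2.1 _ _ (Fin.lt_def.2 hab) b.2).le
  · rw [List.perm_ext_iff_of_nodup (nodup_indices _ _)]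
    · intro j
      rw [mem_indices, List.mem_ofFn]
      simp only [leftOf, decide_eq_true_eq]
      constructor
      · intro h
        exact ⟨⟨_, h⟩, by simp⟩
      · rintro ⟨k, rfl⟩
        simp
    · rw [List.nodup_ofFn]
      intro a b hab
      have := σ.injective hab
      simpa [Fin.ext_iff] using this

theorem indices_leftOf_false {N : ℕ} {i : ℕ} (hi : i ≤ N) {σ : Equiv.Perm (Fin N)}
    (hσ : σ ∈ shuffles i N) :
    indices (leftOf i σ) false =
      List.ofFn fun j : Fin (N - i) => σ ⟨i + j.val, by omega⟩ := by
  simp only [shuffles, Finset.mem_filter] at hσ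
  refine List.Perm.eq_of_pairwise' (r := (· ≤ ·))
    ((pairwise_indices _ _).imp le_of_lt) ?_ ?_
  · rw [List.pairwise_ofFn]
    intro a b hab
    exact (hσ.2.2 _ _ (Fin.lt_def.2 (Nat.add_lt_add_left hab i)) (by simp)).le
  · rw [List.perm_ext_iff_of_nodup (nodup_indices _ _)]
    · intro j
      rw [mem_indices, List.mem_ofFn]
      simp only [leftOf, decide_eq_false_iff_not, not_lt]
      constructor
      · intro h
        refine ⟨⟨(σ.symm j).val - i, by omega⟩, ?_⟩
        rw [← Equiv.eq_symm_apply]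
        ext
        simp
        omega
      · rintro ⟨k, rfl⟩
        simp
    · rw [List.nodup_ofFn]
      intro a b hab
      have := σ.injective hab
      simpa [Fin.ext_iff] using this

/-- A shuffle is increasing on each of its two blocks, so its inversions only occur between an entry
of the left block and a smaller one of the right block. -/
theorem koszulSign_eq_unshuffleSign {N : ℕ} {i : ℕ} {σ : Equiv.Perm (Fin N)}
    (hσ : σ ∈ shuffles i N) (d : Fin N → ℤ) :
    koszulSign K d σ = unshuffleSign K d (leftOf i σ) := by
  simp only [shuffles, Finset.mem_filter] at hσ
  rw [unshuffleSign, ← Fintype.prod_prod_type', ← Finset.prod_filter, koszulSign]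
  refine Finset.prod_equiv (Equiv.prodCongr σ σ) (fun q => ?_) fun q _ => rfl
  simp only [Finset.mem_filter, Finset.mem_univ, true_and, leftOf, Equiv.prodCongr_apply,
    Prod.map_fst, Prod.map_snd, Equiv.symm_apply_apply, decide_eq_true_eq,
    decide_eq_false_iff_not, not_lt]
  constructor
  · rintro ⟨h1, h2⟩
    refine ⟨h2, ?_, ?_⟩
    · by_contra h
      exact absurd (hσ.2.2 _ _ h1 (not_lt.1 h)) (not_lt_of_gt h2)
    · by_contra h
      exact absurd (hσ.2.1 _ _ h1 (not_le.1 h)) (not_lt_of_gt h2)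
  · rintro ⟨h1, h2, h3⟩
    exact ⟨Fin.lt_def.2 (by omega), h1⟩

/-- The shuffle is read off from the increasing list of the `true` indices followed by that of the
`false` ones. -/
theorem exists_shuffle {N : ℕ} (p : Fin N → Bool) :
    ∃ σ ∈ shuffles (indices p true).length N, leftOf (indices p true).length σ = p := by
  set L := indices p true ++ indices p false with hL
  have hlen : L.length = N := by rw [hL, List.length_append, length_indices]
  have hnd : L.Nodup := by
    refine List.Nodup.append (nodup_indices _ _) (nodup_indices _ _) fun a h1 h2 => ?_
    rw [mem_indices] at h1 h2
    exact absurd (h1.symm.trans h2) (by simp)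
  have hinj : Function.Injective fun j : Fin N => L[j.val]'(by omega) := by
    intro a b hab
    ext
    exact (hnd.getElem_inj_iff).1 hab
  let σ : Equiv.Perm (Fin N) := Equiv.ofBijective _ (Finite.injective_iff_bijective.1 hinj)
  have hσ : ∀ j : Fin N, σ j = L[j.val]'(by omega) := fun j => rfl
  have hl : ∀ j : Fin N, (h : j.val < (indices p true).length) →
      σ j = (indices p true)[j.val]'h := by
    intro j h
    rw [hσ]
    exact List.getElem_append_left h
  have hr : ∀ j : Fin N, (h : (indices p true).length ≤ j.val) →
      σ j = (indices p false)[j.val - (indices p true).length]'(by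
        have := length_indices p; omega) := by
    intro j h
    rw [hσ]
    exact List.getElem_append_right h
  refine ⟨σ, ?_, ?_⟩
  · rw [shuffles, Finset.mem_filter]
    refine ⟨Finset.mem_univ _, fun a b hab hb => ?_, fun a b hab ha => ?_⟩
    · rw [hl a (lt_trans hab hb), hl b hb]
      exact (List.pairwise_iff_getElem.1 (pairwise_indices p true)) _ _ _ _ hab
    · rw [hr a ha, hr b (ha.trans (le_of_lt hab))]
      refine (List.pairwise_iff_getElem.1 (pairwise_indices p false)) _ _ _ _ ?_
      have : a.val < b.val := hab
      omega
  · funext j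
    obtain ⟨a, rfl⟩ := σ.surjective j
    rw [leftOf, Equiv.symm_apply_apply]
    by_cases h : a.val < (indices p true).length
    · have : σ a ∈ indices p true := by
        rw [hl a h]
        exact List.getElem_mem _
      rw [mem_indices.1 this]
      simpa using h
    · have : σ a ∈ indices p false := by
        rw [hr a (not_lt.1 h)]
        exact List.getElem_mem _
      rw [mem_indices.1 this]
      simpa using h

/-- A signed sum over unshuffles of a list is a signed sum over shuffles. -/
theorem sum_shuffles_eq_splitSum {N : ℕ} (h : Fin N → α) (Ψ : List α → List α → M) :
    ∑ i : Fin (N + 1), ∑ σ ∈ shuffles i.val N, koszulSign K (fun j => deg (h j)) σ •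
      Ψ (List.ofFn fun j : Fin i.val => h (σ ⟨j.val, by omega⟩))
        (List.ofFn fun j : Fin (N - i.val) => h (σ ⟨i.val + j.val, by omega⟩)) =
      splitSum K deg (List.ofFn h) Ψ := by
  rw [splitSum_ofFn, Finset.sum_sigma']
  have hi : ∀ x : (_ : Fin (N + 1)) × Equiv.Perm (Fin N), x.1.val ≤ N := fun x => by omega
  -- Shuffles for all i together correspond to subsets of the positions. The subset consists of the
  -- entries moved to the left, and i is its cardinality.
  refine Finset.sum_bij (fun x _ => leftOf x.1.val x.2) (fun _ _ => Finset.mem_univ _) ?_ ?_ ?_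
  · rintro ⟨i, σ⟩ hx ⟨i', σ'⟩ hx' heq
    simp only [Finset.mem_sigma, Finset.mem_univ, true_and] at hx hx' heq
    have e1 := indices_leftOf_true (by omega) hx
    have e1' := indices_leftOf_true (by omega) hx'
    have e2 := indices_leftOf_false (by omega) hx
    have e2' := indices_leftOf_false (by omega) hx'
    rw [heq] at e1 e2
    have hii : i = i' := by
      have := congrArg List.length (e1.symm.trans e1')
      rw [List.length_ofFn, List.length_ofFn] at this
      exact Fin.ext this
    subst hii
    congr 1
    refine Equiv.ext fun j => ?_
    by_cases hj : j.val < i.val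
    · exact congrFun (List.ofFn_injective (e1.symm.trans e1')) ⟨j.val, hj⟩
    · have := congrFun (List.ofFn_injective (e2.symm.trans e2')) ⟨j.val - i.val, by omega⟩
      simpa [Nat.add_sub_cancel' (not_lt.1 hj)] using this
  · intro p _
    obtain ⟨σ, h1, h2⟩ := exists_shuffle p
    have := length_indices p
    exact ⟨⟨⟨(indices p true).length, by omega⟩, σ⟩, by simpa using h1, h2⟩
  · rintro ⟨i, σ⟩ hx
    simp only [Finset.mem_sigma, Finset.mem_univ, true_and] at hx
    rw [koszulSign_eq_unshuffleSign hx, indices_leftOf_true (by omega) hx,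
      indices_leftOf_false (by omega) hx, List.map_ofFn, List.map_ofFn]
    rfl

end Shuffles

/-! ### `L_∞`-algebras in terms of lists of homogeneous elements -/

section ListForm

variable {V : Type*}

/-- A family of operations as one function on lists. -/
def onList (l : ∀ k : ℕ, (Fin k → V) → V) (L : List V) : V := l L.length L.get

theorem onList_eq (l : ∀ k : ℕ, (Fin k → V) → V) {L : List V} {k : ℕ} (h : L.length = k) :
    onList l L = l k fun i => L[i.val]'(by omega) := by
  subst h
  rfl

theorem onList_ofFn (l : ∀ k : ℕ, (Fin k → V) → V) {k : ℕ} (x : Fin k → V) :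
    onList l (List.ofFn x) = l k x := by
  rw [onList_eq l (List.length_ofFn)]
  simp

variable (K : Type*) [Field K] [AddCommGroup V] [Module K V]

section Graded

variable (𝒢 : ℤ → Submodule K V)

/-- The homogeneous elements, with their degrees. -/
abbrev Homog : Type _ := Σ d : ℤ, 𝒢 d

variable {K 𝒢}

/-- The element of `V` underlying a homogeneous element. -/
def Homog.val (h : Homog K 𝒢) : V := h.2.val

end Graded

variable (𝒢 : ℤ → Submodule K V) (l : ∀ k : ℕ, (Fin k → V) → V)

/-- The axioms of an `L_∞`-algebra, in terms of lists. -/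
structure IsListLInfinity : Prop where
  grading : DirectSum.IsInternal 𝒢
  multilinear : ∀ k, ∃ L : MultilinearMap K (fun _ : Fin k => V) V, ∀ x, L x = l k x
  curvature_zero : onList l [] = 0
  degree_one : ∀ L : List (Homog K 𝒢),
    onList l (L.map Homog.val) ∈ 𝒢 ((L.map Sigma.fst).sum + 1)
  symmetric : GradedSymm K Sigma.fst fun L : List (Homog K 𝒢) => onList l (L.map Homog.val)
  jacobi : ∀ L : List (Homog K 𝒢), splitSum K Sigma.fst L (fun S T =>
    onList l (onList l (S.map Homog.val) :: T.map Homog.val)) = 0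

variable {K 𝒢 l}

theorem IsListLInfinity.isLInfinity (H : IsListLInfinity K 𝒢 l) : IsLInfinity K 𝒢 l where
  grading := H.grading
  multilinear := H.multilinear
  curvature_zero x := by
    rw [← H.curvature_zero]
    exact congrArg (l 0) (Subsingleton.elim _ _)
  degree_one k d x hx := by
    have h := H.degree_one (List.ofFn fun i => (⟨d i, x i, hx i⟩ : Homog K 𝒢))
    rw [List.map_ofFn, List.map_ofFn, List.sum_ofFn] at h
    have e := onList_ofFn l x
    rw [← e]
    exact h
  symmetric k d x hx σ := by
    have h := H.symmetric.apply_ofFn (fun i => (⟨d i, x i, hx i⟩ : Homog K 𝒢)) σ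
    simp only [List.map_ofFn] at h
    rw [← onList_ofFn l x, ← onList_ofFn l]
    exact h
  jacobi N d x hx := by
    have h := H.jacobi (List.ofFn fun i => (⟨d i, x i, hx i⟩ : Homog K 𝒢))
    rw [← sum_shuffles_eq_splitSum] at h
    rw [← h]
    refine Finset.sum_congr rfl fun i _ => Finset.sum_congr rfl fun σ _ => ?_
    simp only [List.map_ofFn]
    rw [onList_ofFn, ← List.ofFn_cons, onList_ofFn]
    rfl

/-- An existential form of linearity in one slot, so that later uses need not match the length of
the list with an arity. -/
theorem exists_linearMap_onList
    (hl : ∀ k, ∃ L : MultilinearMap K (fun _ : Fin k => V) V, ∀ x, L x = l k x) (P T : List V) :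
    ∃ g : V →ₗ[K] V, ∀ u, g u = onList l (P ++ u :: T) := by
  obtain ⟨Λ, hΛ⟩ := hl (P.length + (T.length + 1))
  refine ⟨Λ.toLinearMap (fun i => (P ++ 0 :: T)[i.val]'(by simp)) ⟨P.length, by omega⟩,
    fun u => ?_⟩
  rw [onList_eq l (k := P.length + (T.length + 1)) (by simp), ← hΛ, MultilinearMap.toLinearMap_apply]
  congr 1
  funext i
  rw [Function.update_apply]
  split_ifs with h
  · subst h
    simp
  · have h' : i.val ≠ P.length := fun h' => h (Fin.ext h')
    rcases lt_or_gt_of_ne h' with h' | h'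
    · rw [List.getElem_append_left h', List.getElem_append_left h']
    · rw [List.getElem_append_right h'.le, List.getElem_append_right h'.le, List.getElem_cons,
        List.getElem_cons, dif_neg (by omega), dif_neg (by omega)]

theorem onList_add (hl : ∀ k, ∃ L : MultilinearMap K (fun _ : Fin k => V) V, ∀ x, L x = l k x)
    (P T : List V) (u v : V) :
    onList l (P ++ (u + v) :: T) = onList l (P ++ u :: T) + onList l (P ++ v :: T) := by
  obtain ⟨g, hg⟩ := exists_linearMap_onList hl P T
  rw [← hg, ← hg, ← hg, map_add]

theorem onList_zero (hl : ∀ k, ∃ L : MultilinearMap K (fun _ : Fin k => V) V, ∀ x, L x = l k x)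
    (P T : List V) : onList l (P ++ 0 :: T) = 0 := by
  obtain ⟨g, hg⟩ := exists_linearMap_onList hl P T
  rw [← hg, map_zero]

theorem onList_sum_smul
    (hl : ∀ k, ∃ L : MultilinearMap K (fun _ : Fin k => V) V, ∀ x, L x = l k x)
    (P T : List V) {ι : Type*} (s : Finset ι) (c : ι → K) (u : ι → V) :
    onList l (P ++ (∑ i ∈ s, c i • u i) :: T) = ∑ i ∈ s, c i • onList l (P ++ u i :: T) := by
  obtain ⟨g, hg⟩ := exists_linearMap_onList hl P T
  rw [← hg, map_sum]
  exact Finset.sum_congr rfl fun i _ => by rw [map_smul, hg]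

end ListForm

/-! ### Powers of an even element -/

section Powers

variable {K : Type*} [Field K] {α : Type*} {deg : α → ℤ} {M : Type*} [AddCommMonoid M] [Module K M]

/-- An element of degree 0 moves without sign, so k copies of it are distributed to the two halves
in binomially many ways. The induction is Pascal's rule. -/
theorem splitSum_replicate_append (a : α) (ha : deg a = 0) (k : ℕ) (L : List α)
    (φ : List α → List α → M) :
    splitSum K deg (List.replicate k a ++ L) φ =
      ∑ ij ∈ Finset.HasAntidiagonal.antidiagonal k, k.choose ij.1 • splitSum K deg L fun S T =>
        φ (List.replicate ij.1 a ++ S) (List.replicate ij.2 a ++ T) := by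
  induction k generalizing φ with
  | zero => simp
  | succ k ih =>
    rw [List.replicate_succ, List.cons_append, splitSum]
    simp only [ha, zero_mul, zpow_zero, one_smul]
    rw [ih, ih, Finset.sum_antidiagonal_choose_succ_nsmul fun i j => splitSum K deg L fun S T =>
        φ (List.replicate i a ++ S) (List.replicate j a ++ T), add_comm]
    congr 1
    refine Finset.sum_congr rfl fun ij hij => ?_
    rw [Finset.HasAntidiagonal.mem_antidiagonal] at hij
    rw [← hij, Nat.choose_symm_add]
    rfl

theorem GradedSymm.cons {φ : List α → M} (hφ : GradedSymm K deg φ) (a : α) :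
    GradedSymm K deg fun L => φ (a :: L) := fun P x y L => hφ (a :: P) x y L

theorem GradedSymm.move_replicate {φ : List α → M} (hφ : GradedSymm K deg φ) {a : α}
    (ha : deg a = 0) (x : α) (k : ℕ) (L : List α) :
    φ (List.replicate k a ++ x :: L) = φ (x :: (List.replicate k a ++ L)) := by
  induction k generalizing φ with
  | zero => rfl
  | succ k ih =>
    have h1 := hφ [] x a (List.replicate k a ++ L)
    rw [ha, mul_zero, zpow_zero, one_smul] at h1
    rw [List.replicate_succ, List.cons_append, List.cons_append]
    exact (ih (hφ.cons a)).trans h1.symm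

/-- The binomial theorem, by the same recursion. Only copies of a have to be moved, so only a needs
degree 0. -/
theorem GradedSymm.apply_replicate_add {φ : List α → M} (hφ : GradedSymm K deg φ) {a b c : α}
    (ha : deg a = 0) (h : ∀ P L, φ (P ++ c :: L) = φ (P ++ a :: L) + φ (P ++ b :: L)) (k : ℕ) :
    φ (List.replicate k c) = ∑ ij ∈ Finset.HasAntidiagonal.antidiagonal k,
      k.choose ij.1 • φ (List.replicate ij.1 a ++ List.replicate ij.2 b) := by
  induction k generalizing φ with
  | zero => simp
  | succ k ih =>
    have h0 := h [] (List.replicate k c)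
    simp only [List.nil_append] at h0
    rw [List.replicate_succ, h0, ih (hφ.cons a) fun P L => h (a :: P) L,
      ih (hφ.cons b) fun P L => h (b :: P) L, Finset.sum_antidiagonal_choose_succ_nsmul fun i j =>
        φ (List.replicate i a ++ List.replicate j b), add_comm]
    congr 1
    · refine Finset.sum_congr rfl fun ij _ => ?_
      rw [List.replicate_succ, hφ.move_replicate ha]
    · refine Finset.sum_congr rfl fun ij hij => ?_
      rw [Finset.HasAntidiagonal.mem_antidiagonal] at hij
      rw [← hij, Nat.choose_symm_add]
      rfl

/-- A Cauchy product: the support lies in the square i, j < n, where i + j < 2n. -/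
theorem sum_antidiagonal_eq_sum_product (n : ℕ) (f : ℕ → ℕ → M)
    (hf : ∀ i j, n ≤ i ∨ n ≤ j → f i j = 0) :
    ∑ k ∈ Finset.range (2 * n), ∑ ij ∈ Finset.HasAntidiagonal.antidiagonal k, f ij.1 ij.2 =
      ∑ j ∈ Finset.range n, ∑ i ∈ Finset.range n, f i j := by
  rw [Finset.sum_comm, ← Finset.sum_product',
    ← Finset.sum_fiberwise_of_maps_to (s := Finset.range n ×ˢ Finset.range n)
      (t := Finset.range (2 * n)) (g := fun ij => ij.1 + ij.2)]
  · refine Finset.sum_congr rfl fun k _ => ?_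
    refine (Finset.sum_subset ?_ ?_).symm
    · intro ij hij
      rw [Finset.mem_filter] at hij
      exact Finset.HasAntidiagonal.mem_antidiagonal.2 hij.2
    · intro ij hij hij'
      rw [Finset.HasAntidiagonal.mem_antidiagonal] at hij
      refine hf _ _ ?_
      by_contra hcon
      push Not at hcon
      refine hij' (Finset.mem_filter.2 ⟨?_, hij⟩)
      simp [hcon]
  · intro ij hij
    simp only [Finset.mem_product, Finset.mem_range] at hij ⊢
    omega

theorem choose_div_factorial [CharZero K] {i j k : ℕ} (h : i + j = k) (x : M) :
    ((k.factorial : K)⁻¹) • (k.choose i • x) =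
      ((j.factorial : K)⁻¹) • ((i.factorial : K)⁻¹) • x := by
  subst h
  rw [← Nat.cast_smul_eq_nsmul K, smul_smul, smul_smul]
  congr 1
  have h := Nat.add_choose_mul_factorial_mul_factorial i j
  have h1 : (i.factorial : K) ≠ 0 := Nat.cast_ne_zero.2 i.factorial_ne_zero
  have h2 : (j.factorial : K) ≠ 0 := Nat.cast_ne_zero.2 j.factorial_ne_zero
  have h3 : ((i + j).factorial : K) ≠ 0 := Nat.cast_ne_zero.2 (i + j).factorial_ne_zero
  rw [← Nat.choose_symm_add] at h
  field_simp
  rw [← h]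
  push_cast
  ring

end Powers

/-! ### Maurer–Cartan elements and twisting -/

section Twisting

variable {K : Type*} [Field K] {V : Type*} [AddCommGroup V] [Module K V]
  {𝒢 : ℤ → Submodule K V} {l : ∀ k : ℕ, (Fin k → V) → V}

theorem finsum_eq_sum_range {f : ℕ → V} {n : ℕ} (h : ∀ k, n ≤ k → f k = 0) :
    ∑ᶠ k, f k = ∑ k ∈ Finset.range n, f k := by
  refine finsum_eq_sum_of_support_subset _ fun k hk => ?_
  rw [Finset.mem_coe, Finset.mem_range]
  by_contra hcon
  exact hk (h k (not_lt.1 hcon))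

theorem finite_support_of_bound {f : ℕ → V} {n : ℕ} (h : ∀ k, n ≤ k → f k = 0) :
    (Function.support f).Finite := by
  refine (Finset.finite_toSet (Finset.range n)).subset fun k hk => ?_
  rw [Finset.mem_coe, Finset.mem_range]
  by_contra hcon
  exact hk (h k (not_lt.1 hcon))

/-- Since `l_0` vanishes, the sum may start at k = 0, which removes the index shift. -/
theorem isMaurerCartan_iff (h0 : onList l [] = 0) {γ : V} (hγ : γ ∈ 𝒢 0) {n : ℕ}
    (h : ∀ k, n ≤ k → onList l (List.replicate k γ) = 0) :
    IsMaurerCartan K 𝒢 l γ ↔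
      ∑ k ∈ Finset.range n, ((k.factorial : K)⁻¹) • onList l (List.replicate k γ) = 0 := by
  have hl : ∀ k, l k (fun _ => γ) = onList l (List.replicate k γ) := fun k => by
    rw [← List.ofFn_const, onList_ofFn]
  have hz : ∀ k, n ≤ k → (((k + 1).factorial : K)⁻¹) • l (k + 1) (fun _ => γ) = 0 := by
    intro k hk
    rw [hl, h _ (by omega), smul_zero]
  have hsum : ∑ᶠ k : ℕ, (((k + 1).factorial : K)⁻¹) • l (k + 1) (fun _ => γ) =
      ∑ k ∈ Finset.range n, ((k.factorial : K)⁻¹) • onList l (List.replicate k γ) := by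
    rw [finsum_eq_sum_range hz]
    simp only [hl]
    have e := Finset.sum_range_succ'
      (fun k => ((k.factorial : K)⁻¹) • onList l (List.replicate k γ)) n
    rw [Finset.sum_range_succ, h n le_rfl, List.replicate_zero, h0] at e
    simpa using e.symm
  exact ⟨fun hmc => hsum ▸ hmc.equation,
    fun he => ⟨hγ, finite_support_of_bound hz, hsum.trans he⟩⟩

theorem twistTerm_eq (α : V) (k : ℕ) (x : Fin k → V) (n : ℕ) :
    twistTerm K l α k x n =
      ((n.factorial : K)⁻¹) • onList l (List.replicate n α ++ List.ofFn x) := by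
  rw [twistTerm, ← onList_ofFn l, List.ofFn_fin_append, List.ofFn_const]

variable (K l) in
/-- The twisted operations on lists. -/
def twistList (α : V) (L : List V) : V :=
  ∑ᶠ n : ℕ, ((n.factorial : K)⁻¹) • onList l (List.replicate n α ++ L)

theorem onList_twist_of_ne_nil (α : V) {L : List V} (hL : L ≠ []) :
    onList (twist K l α) L = twistList K l α L := by
  match L, hL with
  | x :: L, _ =>
    change ∑ᶠ n : ℕ, twistTerm K l α (L.length + 1) _ n = _
    refine finsum_congr fun n => ?_
    rw [twistTerm_eq]
    congr 3
    exact List.ofFn_get (x :: L)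

/-- Long lists of homogeneous elements of bounded degree are annihilated. -/
def IsLocallyNilpotent (K : Type*) [Field K] {V : Type*} [AddCommGroup V] [Module K V]
    (𝒢 : ℤ → Submodule K V) (l : ∀ k : ℕ, (Fin k → V) → V) : Prop :=
  ∀ D : ℤ, ∃ n : ℕ, ∀ L : List (Homog K 𝒢), (∀ h ∈ L, h.1 ≤ D) → n ≤ L.length →
    onList l (L.map Homog.val) = 0

/-- On the empty list `twist` is 0 by definition, while `twistList` gives the curvature, whose
vanishing is the Maurer–Cartan equation. This is where that equation enters the twisted Jacobi
identity. -/
theorem onList_twist (h0 : onList l [] = 0) (hnil : IsLocallyNilpotent K 𝒢 l) {α : V}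
    (hα : IsMaurerCartan K 𝒢 l α) (L : List V) :
    onList (twist K l α) L = twistList K l α L := by
  rcases eq_or_ne L [] with rfl | hL
  · obtain ⟨n, hn⟩ := hnil 0
    have hb : ∀ k, n ≤ k → onList l (List.replicate k α) = 0 := by
      intro k hk
      have := hn (List.replicate k ⟨0, α, hα.degree_zero⟩)
        (fun h hh => by rw [List.eq_of_mem_replicate hh]) (by simpa using hk)
      simpa [Homog.val] using this
    rw [twistList, finsum_eq_sum_range (n := n)]
    · simp only [List.append_nil]
      rw [(isMaurerCartan_iff h0 hα.degree_zero hb).1 hα]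
      rfl
    · intro k hk
      rw [List.append_nil, hb k hk, smul_zero]
  · exact onList_twist_of_ne_nil α hL

theorem onList_replicate_append_eq_zero {α : V} {n : ℕ} {D : ℤ} (hα : α ∈ 𝒢 0) (hD : 0 ≤ D)
    (hn : ∀ L : List (Homog K 𝒢), (∀ h ∈ L, h.1 ≤ D) → n ≤ L.length →
      onList l (L.map Homog.val) = 0) (L : List (Homog K 𝒢)) (hL : ∀ h ∈ L, h.1 ≤ D) (k : ℕ)
    (hk : n ≤ k + L.length) : onList l (List.replicate k α ++ L.map Homog.val) = 0 := by
  have := hn (List.replicate k ⟨0, α, hα⟩ ++ L) (fun h hh => by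
    rcases List.mem_append.1 hh with hh | hh
    · rw [List.eq_of_mem_replicate hh]
      exact hD
    · exact hL h hh) (by simpa using hk)
  simpa [Homog.val] using this

/-- The inner result of a nested operation becomes an entry of the outer one, so D must bound its
degree as well. -/
theorem exists_bound (L : List (Homog K 𝒢)) :
    ∃ D : ℤ, 0 ≤ D ∧ (∀ h ∈ L, h.1 ≤ D) ∧
      ∀ S T : List (Homog K 𝒢), (S ++ T).Perm L → (S.map Sigma.fst).sum + 1 ≤ D := by
  refine ⟨(L.map fun h => |h.1|).sum + 1, ?_, ?_, ?_⟩
  · have : 0 ≤ (L.map fun h => |h.1|).sum := List.sum_nonneg fun x hx => by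
      obtain ⟨h, -, rfl⟩ := List.mem_map.1 hx
      exact abs_nonneg _
    omega
  · intro h hh
    have h1 := List.single_le_sum (l := L.map fun h => |h.1|) (fun x hx => by
      obtain ⟨h, -, rfl⟩ := List.mem_map.1 hx
      exact abs_nonneg _) |h.1|
      (List.mem_map.2 ⟨h, hh, rfl⟩)
    have h2 := le_abs_self h.1
    omega
  · intro S T h
    have h1 : (L.map fun h => |h.1|).sum =
        (S.map fun h => |h.1|).sum + (T.map fun h => |h.1|).sum := by
      rw [← (h.map fun h : Homog K 𝒢 => |h.1|).sum_eq, List.map_append, List.sum_append]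
    have h2 : 0 ≤ (T.map fun h => |h.1|).sum := List.sum_nonneg fun x hx => by
      obtain ⟨h, -, rfl⟩ := List.mem_map.1 hx
      exact abs_nonneg _
    have h3 : (S.map Sigma.fst).sum ≤ (S.map fun h => |h.1|).sum :=
      List.sum_le_sum fun h _ => le_abs_self _
    omega

theorem onList_twist_eq_sum (H : IsListLInfinity K 𝒢 l) (hnil : IsLocallyNilpotent K 𝒢 l) {α : V}
    (hα : IsMaurerCartan K 𝒢 l α) {D : ℤ} (hD : 0 ≤ D) {n : ℕ}
    (hn : ∀ L : List (Homog K 𝒢), (∀ h ∈ L, h.1 ≤ D) → n ≤ L.length →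
      onList l (L.map Homog.val) = 0) (L : List (Homog K 𝒢)) (hL : ∀ h ∈ L, h.1 ≤ D) :
    onList (twist K l α) (L.map Homog.val) = ∑ k ∈ Finset.range n,
      ((k.factorial : K)⁻¹) • onList l (List.replicate k α ++ L.map Homog.val) := by
  rw [onList_twist H.curvature_zero hnil hα, twistList]
  refine finsum_eq_sum_range fun k hk => ?_
  rw [onList_replicate_append_eq_zero hα.degree_zero hD hn L hL k (by omega), smul_zero]

/-- Finiteness of the supports makes `finsum` additive in each argument. -/
theorem twist_multilinear (hl : ∀ k, ∃ L : MultilinearMap K (fun _ : Fin k => V) V, ∀ x, L x = l k x)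
    {α : V} (hfin : ∀ (k : ℕ) (x : Fin k → V), (Function.support (twistTerm K l α k x)).Finite)
    (k : ℕ) : ∃ L : MultilinearMap K (fun _ : Fin k => V) V, ∀ x, L x = twist K l α k x := by
  match k with
  | 0 => exact ⟨0, fun _ => rfl⟩
  | k + 1 =>
    have hterm : ∀ n, ∃ L : MultilinearMap K (fun _ : Fin (k + 1) => V) V,
        ∀ x, L x = twistTerm K l α (k + 1) x n := by
      intro n
      obtain ⟨Λ, hΛ⟩ := hl (n + (k + 1))
      have hup : ∀ (x : Fin (k + 1) → V) (i : Fin (k + 1)) (v : V),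
          (Fin.append (fun _ : Fin n => α) (Function.update x i v)) =
            Function.update (Fin.append (fun _ : Fin n => α) x) (Fin.natAdd n i) v := by
        intro x i v
        funext j
        refine Fin.addCases (fun j => ?_) (fun j => ?_) j
        · rw [Fin.append_left, Function.update_of_ne, Fin.append_left]
          simp [Fin.ext_iff]
          omega
        · rw [Fin.append_right, Function.update_apply, Function.update_apply, Fin.append_right]
          simp [Fin.ext_iff]
      refine ⟨((n.factorial : K)⁻¹) • MultilinearMap.mk'
        (fun x => Λ (Fin.append (fun _ : Fin n => α) x))
        (fun x i u v => by rw [hup, hup, hup, MultilinearMap.map_update_add])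
        (fun x i c u => by rw [hup, hup, MultilinearMap.map_update_smul]), fun x => ?_⟩
      rw [twistTerm, ← hΛ]
      rfl
    choose Λ hΛ using hterm
    have hfin' : ∀ x, (Function.support fun n => Λ n x).Finite := by
      intro x
      simp only [hΛ]
      exact hfin (k + 1) x
    refine ⟨MultilinearMap.mk' (fun x => ∑ᶠ n, Λ n x) (fun x i u v => ?_) (fun x i c u => ?_),
      fun x => ?_⟩
    · rw [← finsum_add_distrib (hfin' _) (hfin' _)]
      exact finsum_congr fun n => MultilinearMap.map_update_add _ _ _ _ _
    · rw [smul_finsum]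
      exact finsum_congr fun n => MultilinearMap.map_update_smul _ _ _ _ _
    · exact finsum_congr fun n => hΛ n x

/-- Twisting an `L_∞`-algebra by a Maurer–Cartan element. -/
theorem IsListLInfinity.twist [CharZero K] (H : IsListLInfinity K 𝒢 l)
    (hnil : IsLocallyNilpotent K 𝒢 l) {α : V} (hα : IsMaurerCartan K 𝒢 l α)
    (hfin : ∀ (k : ℕ) (x : Fin k → V), (Function.support (twistTerm K l α k x)).Finite) :
    IsListLInfinity K 𝒢 (twist K l α) where
  grading := H.grading
  multilinear := twist_multilinear H.multilinear hfin
  curvature_zero := rfl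
  degree_one L := by
    obtain ⟨D, hD, hL, -⟩ := exists_bound L
    obtain ⟨n, hn⟩ := hnil D
    rw [onList_twist_eq_sum H hnil hα hD hn L hL]
    refine Submodule.sum_mem _ fun k _ => Submodule.smul_mem _ _ ?_
    have := H.degree_one (List.replicate k ⟨0, α, hα.degree_zero⟩ ++ L)
    simpa [Homog.val] using this
  symmetric P x y L := by
    simp only
    rw [onList_twist H.curvature_zero hnil hα, onList_twist H.curvature_zero hnil hα, twistList,
      twistList, smul_finsum]
    refine finsum_congr fun n => ?_
    have := H.symmetric (List.replicate n ⟨0, α, hα.degree_zero⟩ ++ P) x y L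
    simp only [List.append_assoc, List.map_append, List.map_replicate] at this
    rw [smul_comm, List.map_append, List.map_append]
    exact congrArg _ this
  jacobi L := by
    obtain ⟨D, hD, hL, hS⟩ := exists_bound L
    obtain ⟨n, hn⟩ := hnil D
    let a : Homog K 𝒢 := ⟨0, α, hα.degree_zero⟩
    let Ψ : List (Homog K 𝒢) → List (Homog K 𝒢) → V := fun S T =>
      onList l (onList l (S.map Homog.val) :: T.map Homog.val)
    let f : ℕ → ℕ → V := fun i j => splitSum K Sigma.fst L fun S T =>
      Ψ (List.replicate i a ++ S) (List.replicate j a ++ T)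
    have hrep : ∀ (i : ℕ) (S : List (Homog K 𝒢)),
        (List.replicate i a ++ S).map Homog.val = List.replicate i α ++ S.map Homog.val := by
      intro i S
      simp [a, Homog.val]
    -- The copies of α in the outer operation are moved behind the inner result, without sign
    -- because α has degree 0.
    have hmove : ∀ (S T : List (Homog K 𝒢)) (i j : ℕ),
        onList l (List.replicate j α ++
          onList l (List.replicate i α ++ S.map Homog.val) :: T.map Homog.val) =
        Ψ (List.replicate i a ++ S) (List.replicate j a ++ T) := by
      intro S T i j
      have := H.symmetric.move_replicate (a := a) rfl
        ⟨_, _, H.degree_one (List.replicate i a ++ S)⟩ j T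
      simp only [hrep, List.map_cons] at this
      simp only [Ψ, hrep]
      exact this
    have hle : ∀ S T : List (Homog K 𝒢), (S ++ T).Perm L →
        (∀ h ∈ S, h.1 ≤ D) ∧ ∀ h ∈ T, h.1 ≤ D := fun S T hST =>
      ⟨fun h hh => hL h (hST.subset (List.mem_append_left _ hh)),
        fun h hh => hL h (hST.subset (List.mem_append_right _ hh))⟩
    have hzero : ∀ i j, n ≤ i ∨ n ≤ j → f i j = 0 := by
      intro i j hij
      refine splitSum_eq_zero _ fun S T hST => ?_
      rw [← hmove]
      rcases hij with hi | hj
      · rw [onList_replicate_append_eq_zero hα.degree_zero hD hn S (hle S T hST).1 i (by omega),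
          onList_zero H.multilinear]
      · have hd : (⟨_, _, H.degree_one (List.replicate i a ++ S)⟩ : Homog K 𝒢).1 ≤ D := by
          have := hS S T hST
          simpa [a] using this
        have := onList_replicate_append_eq_zero hα.degree_zero hD hn
          (⟨_, _, H.degree_one (List.replicate i a ++ S)⟩ :: T) (fun h hh => by
            rcases List.mem_cons.1 hh with rfl | hh
            · exact hd
            · exact (hle S T hST).2 h hh) j (by omega)
        rw [List.map_cons] at this
        simp only [Homog.val, hrep] at this
        exact this
    have hsum : splitSum K Sigma.fst L (fun S T => onList (QuasiTwilled.twist K l α)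
        (onList (QuasiTwilled.twist K l α) (S.map Homog.val) :: T.map Homog.val)) =
        ∑ j ∈ Finset.range n, ∑ i ∈ Finset.range n,
          ((j.factorial : K)⁻¹) • ((i.factorial : K)⁻¹) • f i j := by
      simp only [f, ← splitSum_smul, ← splitSum_sum]
      refine splitSum_congr _ fun S T hST => ?_
      have hu : onList (QuasiTwilled.twist K l α) (S.map Homog.val) ∈
          𝒢 ((S.map Sigma.fst).sum + 1) := by
        rw [onList_twist_eq_sum H hnil hα hD hn S (hle S T hST).1]
        refine Submodule.sum_mem _ fun k _ => Submodule.smul_mem _ _ ?_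
        have := H.degree_one (List.replicate k a ++ S)
        simpa [hrep, a] using this
      have h1 := onList_twist_eq_sum H hnil hα hD hn (⟨_, _, hu⟩ :: T) (fun h hh => by
        rcases List.mem_cons.1 hh with rfl | hh
        · exact hS S T hST
        · exact (hle S T hST).2 h hh)
      rw [List.map_cons] at h1
      refine h1.trans (Finset.sum_congr rfl fun j _ => ?_)
      rw [← Finset.smul_sum]
      congr 1
      change onList l (List.replicate j α ++
        onList (QuasiTwilled.twist K l α) (S.map Homog.val) :: T.map Homog.val) = _
      rw [onList_twist_eq_sum H hnil hα hD hn S (hle S T hST).1, onList_sum_smul H.multilinear]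
      exact Finset.sum_congr rfl fun i _ => by rw [hmove]
    -- Grouped by k = i + j, the double sum consists of 1/k! times the original Jacobi identities
    -- for k copies of α followed by L.
    rw [hsum, ← sum_antidiagonal_eq_sum_product n fun i j =>
      ((j.factorial : K)⁻¹) • ((i.factorial : K)⁻¹) • f i j]
    · refine Finset.sum_eq_zero fun k _ => ?_
      have := H.jacobi (List.replicate k a ++ L)
      rw [splitSum_replicate_append a rfl] at this
      have h2 := congrArg (fun v => ((k.factorial : K)⁻¹) • v) this
      simp only [Finset.smul_sum, smul_zero] at h2
      rw [← h2]
      refine Finset.sum_congr rfl fun ij hij => ?_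
      rw [Finset.HasAntidiagonal.mem_antidiagonal] at hij
      exact (choose_div_factorial hij _).symm
    · intro i j hij
      rw [hzero i j hij, smul_zero, smul_zero]

/-- Maurer–Cartan elements of the twisted algebra are differences of Maurer–Cartan elements. -/
theorem isMaurerCartan_twist_iff [CharZero K] (H : IsListLInfinity K 𝒢 l)
    (hnil : IsLocallyNilpotent K 𝒢 l) {α β : V} (hα : IsMaurerCartan K 𝒢 l α) (hβ : β ∈ 𝒢 0) :
    IsMaurerCartan K 𝒢 (twist K l α) β ↔ IsMaurerCartan K 𝒢 l (α + β) := by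
  obtain ⟨n, hn⟩ := hnil 0
  have hα0 := hα.degree_zero
  let a : Homog K 𝒢 := ⟨0, α, hα0⟩
  let b : Homog K 𝒢 := ⟨0, β, hβ⟩
  let c : Homog K 𝒢 := ⟨0, α + β, Submodule.add_mem _ hα0 hβ⟩
  have hdeg : ∀ j, ∀ h ∈ List.replicate j b, h.1 ≤ 0 := fun j h hh => by
    rw [List.eq_of_mem_replicate hh]
  have hb : ∀ j, (List.replicate j b).map Homog.val = List.replicate j β := fun j => by
    simp [b, Homog.val]
  have htw : ∀ j, onList (twist K l α) (List.replicate j β) = ∑ i ∈ Finset.range n,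
      ((i.factorial : K)⁻¹) • onList l (List.replicate i α ++ List.replicate j β) := by
    intro j
    have := onList_twist_eq_sum H hnil hα le_rfl hn (List.replicate j b) (hdeg j)
    rwa [hb] at this
  have hz : ∀ i j, n ≤ i ∨ n ≤ j →
      onList l (List.replicate i α ++ List.replicate j β) = 0 := by
    intro i j hij
    have := onList_replicate_append_eq_zero hα0 le_rfl hn (List.replicate j b) (hdeg j) i
      (by rw [List.length_replicate]; omega)
    rwa [hb] at this
  have hc : ∀ k, n ≤ k → onList l (List.replicate k (α + β)) = 0 := by
    intro k hk
    have := hn (List.replicate k c) (fun h hh => by rw [List.eq_of_mem_replicate hh])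
      (by simpa using hk)
    simpa [c, Homog.val] using this
  rw [isMaurerCartan_iff (n := n) rfl hβ, isMaurerCartan_iff (n := 2 * n) H.curvature_zero
    (Submodule.add_mem _ hα0 hβ)]
  -- The binomial expansion of the k-th term for α + β. Summed over k < 2n and regrouped by the
  -- number j of copies of β, it is the twisted Maurer–Cartan sum.
  · have hk : ∀ k, ((k.factorial : K)⁻¹) • onList l (List.replicate k (α + β)) =
        ∑ ij ∈ Finset.HasAntidiagonal.antidiagonal k, ((ij.2.factorial : K)⁻¹) • ((ij.1.factorial : K)⁻¹) •
          onList l (List.replicate ij.1 α ++ List.replicate ij.2 β) := by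
      intro k
      have := H.symmetric.apply_replicate_add (a := a) (b := b) (c := c) rfl (fun P L => by
        simp only [List.map_append, List.map_cons]
        exact onList_add H.multilinear _ _ _ _) k
      have e : onList l (List.replicate k (α + β)) = ∑ ij ∈ Finset.HasAntidiagonal.antidiagonal k,
          k.choose ij.1 • onList l (List.replicate ij.1 α ++ List.replicate ij.2 β) := by
        simpa [a, b, c, Homog.val] using this
      rw [e, Finset.smul_sum]
      refine Finset.sum_congr rfl fun ij hij => ?_
      rw [Finset.HasAntidiagonal.mem_antidiagonal] at hij
      exact choose_div_factorial hij _
    have hs := sum_antidiagonal_eq_sum_product n (fun i j => ((j.factorial : K)⁻¹) •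
      ((i.factorial : K)⁻¹) • onList l (List.replicate i α ++ List.replicate j β))
      (fun i j hij => by rw [hz i j hij, smul_zero, smul_zero])
    simp only [hk, htw]
    rw [hs]
    simp only [Finset.smul_sum]
  · intro k hk
    exact hc k (by omega)
  · intro k hk
    rw [htw]
    exact Finset.sum_eq_zero fun i _ => by rw [hz i k (Or.inr hk), smul_zero]

end Twisting

/-! ### The operations on `𝒬[1] ⊕ 𝔟` in terms of lists -/

section Operations

variable {K : Type*} [Field K] {A B : Type*} [AddCommGroup A] [Module K A]
  [AddCommGroup B] [Module K B]

/-- Moving the i-th entry to the front passes exactly the entries of `removeNth` with index below i.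
-/
theorem pullOut_ofFn {α : Type*} {deg : α → ℤ} {M : Type*} [AddCommMonoid M] [Module K M] {k : ℕ}
    (h : Fin (k + 1) → α) (ψ : α → List α → M) :
    pullOut K deg (List.ofFn h) ψ = ∑ i : Fin (k + 1),
      (-1 : K) ^ (deg (h i) * ∑ j : Fin k, if j.castSucc < i then deg (i.removeNth h j) else 0) •
        ψ (h i) (List.ofFn (i.removeNth h)) := by
  induction k generalizing ψ with
  | zero => simp [pullOut_cons, pullOut_nil]
  | succ k ih =>
    rw [List.ofFn_succ, pullOut_cons, ih]
    conv_rhs => rw [Fin.sum_univ_succ]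
    congr 1
    · simp [Fin.removeNth_zero, Fin.tail_def]
    · refine Finset.sum_congr rfl fun i _ => ?_
      have h1 : i.succ.removeNth h =
          Fin.cons (h 0) (i.removeNth fun j : Fin (k + 1) => h j.succ) := by
        funext j
        refine Fin.cases ?_ (fun j => ?_) j
        · simp [Fin.removeNth_apply]
        · simp [Fin.removeNth_apply]
      rw [h1, List.ofFn_succ, Fin.sum_univ_succ, smul_smul]
      simp only [Fin.cons_zero, Fin.cons_succ, Fin.castSucc_zero, Fin.succ_pos, if_true]
      congr 1
      rw [neg_one_zpow_mul]
      congr 1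
      have h2 : ∀ j : Fin k, (j.succ.castSucc < i.succ) ↔ j.castSucc < i := by
        intro j
        rw [← Fin.succ_castSucc, Fin.succ_lt_succ_iff]
      simp only [h2]
      ring

theorem signTwist_of_mem (e : ℕ) {d : ℤ} {f : AbB K A B} (hf : f ∈ abDeg K A B d) :
    signTwist e f = (-1 : K) ^ ((e : ℤ) * d) • f := by
  rcases mem_degPart_cases hf with rfl | ⟨n, f, rfl, rfl⟩
  · rw [map_zero, smul_zero]
  · rw [signTwist, DirectSum.lmap_lof, ← map_smul]
    congr 1
    change (-1 : K) ^ (e * n) • f = _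
    rw [← zpow_natCast]
    push_cast
    rfl

theorem parity_of_mem {d : ℤ} {F : Gerst K (A × B)} (hF : F ∈ gerstDeg K (A × B) d) :
    parity F = (-1 : K) ^ d • F := by
  rcases mem_degPart_cases hF with rfl | ⟨n, f, rfl, rfl⟩
  · rw [map_zero, smul_zero]
  · rw [parity, DirectSum.lmap_lof, ← map_smul]
    congr 1
    change (-1 : K) ^ n • f = _
    rw [zpow_natCast]

theorem mixedHom_apply (k : ℕ) (i : Fin (k + 1)) (n : ℕ) (F : Multi K (A × B) n)
    (y : Fin k → Tot K A B) :
    mixedHom k i n F y = (0, proj (iterBracket k (DirectSum.lof K ℕ _ n F) fun j =>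
      if j.castSucc < i then signTwist (n + 1) (y j).2 else (y j).2)) := by
  change ((0 : Q K A B), proj (iterBracket k (DirectSum.lof K ℕ _ n F) fun j =>
      ((if j.castSucc < i then signTwist (n + 1) else LinearMap.id) ∘ₗ
        LinearMap.snd K (Q K A B) (AbB K A B)) (y j))) = _
  congr 4
  funext j
  split_ifs <;> rfl

theorem mixed_apply (k : ℕ) (x : Fin (k + 1) → Tot K A B) :
    mixed k x = ∑ i, DirectSum.toModule K ℕ _ (mixedHom k i) (x i).1.val (i.removeNth x) := by
  rw [mixed, _root_.sum_apply]
  rfl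

variable (K A B) in
/-- The homogeneous elements of `𝒬[1] ⊕ 𝔟`, with their degrees. -/
abbrev TotHomog : Type _ := Homog (V := Tot K A B) K (totDeg K A B)

/-- The component in the Gerstenhaber algebra of a homogeneous element of `𝒬[1] ⊕ 𝔟`. -/
def gerstPart (h : TotHomog K A B) : Gerst K (A × B) := h.val.1.val

/-- The component in `𝔟` of a homogeneous element of `𝒬[1] ⊕ 𝔟`. -/
def abPart (h : TotHomog K A B) : AbB K A B := h.val.2

theorem gerstPart_mem (h : TotHomog K A B) :
    gerstPart h ∈ (gerstData K A B).gDeg (h.1 + 1) := fun n hn => h.2.2.1 n hn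

theorem abPart_mem (h : TotHomog K A B) :
    abPart h ∈ (gerstData K A B).bDeg h.1 := fun n hn => h.2.2.2 n hn

/-- The exponent n + 1 used by `signTwist` has the parity of the degree n - 1 of F[1], so the
product of the sign twists is the Koszul sign of moving F[1] to the front. -/
theorem toModule_mixedHom (k : ℕ) (h : TotHomog K A B) (i : Fin (k + 1))
    (y : Fin k → TotHomog K A B) :
    DirectSum.toModule K ℕ _ (mixedHom k i) h.val.1.val (fun j => (y j).val) =
      (0, (-1 : K) ^ (h.1 * ∑ j : Fin k, if j.castSucc < i then (y j).1 else 0) •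
        proj ((gerstData K A B).iter (gerstPart h) ((List.ofFn y).map abPart))) := by
  rcases mem_degPart_cases (gerstPart_mem h) with h0 | ⟨n, F, hn, hF⟩
  · rw [h0, BracketData.iter_zero, map_zero, smul_zero, show h.val.1.val = 0 from h0, map_zero]
    rfl
  · rw [hF, show h.val.1.val = DirectSum.lof K ℕ _ n F from hF, DirectSum.toModule_lof,
      mixedHom_apply]
    congr 1
    have hc : (fun j => if j.castSucc < i then signTwist (n + 1) (y j).val.2 else (y j).val.2) =
        fun j => (if j.castSucc < i then (-1 : K) ^ (h.1 * (y j).1) else 1) • abPart (y j) := by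
      funext j
      split_ifs
      · refine (signTwist_of_mem (f := abPart (y j)) (n + 1) (abPart_mem (y j))).trans ?_
        congr 1
        refine neg_one_zpow_congr ?_
        push_cast
        rw [← hn]
        simp only [Int.even_add, Int.even_sub, Int.even_mul, Int.not_even_one]
        tauto
      · exact (one_smul K _).symm
    rw [hc, MultilinearMap.map_smul_univ, map_smul, iterBracket_eq_iter, List.map_ofFn]
    congr 1
    rw [Finset.mul_sum]
    have hprod : ∀ g : Fin k → ℤ, (-1 : K) ^ (∑ j, g j) = ∏ j, (-1 : K) ^ g j := by
      intro g
      induction (Finset.univ : Finset (Fin k)) using Finset.cons_induction with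
      | empty => simp
      | cons a s ha ih => rw [Finset.sum_cons, Finset.prod_cons, ← neg_one_zpow_mul, ih]
    rw [hprod]
    refine Finset.prod_congr rfl fun j _ => ?_
    split_ifs <;> simp

theorem mixed_ofFn (k : ℕ) (h : Fin (k + 1) → TotHomog K A B) :
    mixed k (fun i => (h i).val) =
      (0, (gerstData K A B).mix Sigma.fst gerstPart abPart (List.ofFn h)) := by
  rw [mixed_apply, BracketData.mix, pullOut_ofFn]
  have e : ∀ i : Fin (k + 1), i.removeNth (fun i => (h i).val) =
      fun j => ((i.removeNth h) j).val := fun i => rfl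
  simp only [e, toModule_mixedHom]
  have hsum : ∀ (s : Finset (Fin (k + 1))) (f : Fin (k + 1) → AbB K A B),
      ∑ i ∈ s, ((0 : Q K A B), f i) = (0, ∑ i ∈ s, f i) := by
    intro s f
    refine Prod.ext ?_ ?_
    · rw [Prod.fst_sum]
      exact Finset.sum_const_zero
    · rw [Prod.snd_sum]
  rw [hsum]
  rfl

/-- Without entries from 𝔟 the derived bracket is PF = 0. So a vanishing `l_1` fits the general
formula. -/
theorem mix_singleton (h : TotHomog K A B) :
    (gerstData K A B).mix Sigma.fst gerstPart abPart [h] = 0 := by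
  rw [BracketData.mix, pullOut_cons, pullOut_nil, add_zero]
  exact (mem_Q_iff _).1 h.val.1.2

/-- Identifies the components of the operations with `bin` and `mix` for lists of every length, so
the identities for abstract bracket data apply. -/
theorem onList_ops (L : List (TotHomog K A B)) :
    ((onList (fun k => ops K A B k) (L.map Homog.val)).1 : Gerst K (A × B)) =
        (gerstData K A B).bin Sigma.fst gerstPart L ∧
      (onList (fun k => ops K A B k) (L.map Homog.val)).2 =
        (gerstData K A B).mix Sigma.fst gerstPart abPart L := by
  match L with
  | [] => exact ⟨rfl, rfl⟩
  | [x] => exact ⟨rfl, (mix_singleton x).symm⟩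
  | [x, y] =>
    have hx : [x, y].map Homog.val = List.ofFn fun i : Fin 2 => (![x, y] i).val := by
      simp
    have hm := mixed_ofFn 1 ![x, y]
    have hl : List.ofFn ![x, y] = [x, y] := by simp
    rw [hl] at hm
    have ho : onList (fun k => ops K A B k) ([x, y].map Homog.val) =
        binary K A B (fun i : Fin 2 => (![x, y] i).val) +
          mixed 1 (fun i : Fin 2 => (![x, y] i).val) := by
      rw [hx, onList_ofFn]
      rfl
    rw [ho, hm]
    constructor
    · change bracket K (A × B) (parity (gerstPart x)) (gerstPart y) + 0 = _
      rw [add_zero, parity_of_mem (gerstPart_mem x), map_smul]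
      rfl
    · exact zero_add _
  | x :: y :: z :: L =>
    have hm := mixed_ofFn (L.length + 2) (x :: y :: z :: L).get
    rw [List.ofFn_get] at hm
    have ho : onList (fun k => ops K A B k) ((x :: y :: z :: L).map Homog.val) =
        mixed (L.length + 2) (fun i => ((x :: y :: z :: L).get i).val) := by
      rw [onList_eq (k := L.length + 2 + 1) _ (by simp)]
      simp only [List.getElem_map]
      rfl
    rw [ho, hm]
    exact ⟨rfl, rfl⟩

end Operations

/-! ### The grading -/

section Grading

variable {K : Type*} [Field K] {A B : Type*} [AddCommGroup A] [Module K A]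
  [AddCommGroup B] [Module K B]

/-- A homogeneous component of an element of `𝒬`, as an element of `𝒬[1] ⊕ 𝔟`. -/
def componentQ (x : Tot K A B) (n : ℕ) : Tot K A B :=
  (⟨DirectSum.lof K ℕ (Multi K (A × B)) n (x.1.val n), lof_mem_Q (x.1.2 n)⟩, 0)

/-- A homogeneous component of an element of `𝔟`, as an element of `𝒬[1] ⊕ 𝔟`. -/
def componentB (x : Tot K A B) (n : ℕ) : Tot K A B :=
  (0, DirectSum.lof K ℕ (fun n => MultilinearMap K (fun _ : Fin (n + 1) => B) A) n (x.2 n))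

theorem componentQ_mem (x : Tot K A B) (n : ℕ) : componentQ x n ∈ totDeg K A B (n - 1) := by
  refine ⟨fun m hm => ?_, fun m _ => rfl⟩
  exact lof_mem_degPart n (x.1.val n) m (by simpa using hm)

theorem componentB_mem (x : Tot K A B) (n : ℕ) : componentB x n ∈ totDeg K A B n :=
  ⟨fun _ _ => rfl, fun _ hm => lof_mem_degPart (K := K)
    (M := fun n => MultilinearMap K (fun _ : Fin (n + 1) => B) A) n (x.2 n) _ hm⟩

theorem exists_list_components (N : Submodule K (Tot K A B))
    (h1 : ∀ x ∈ N, ∀ n, componentQ x n ∈ N) (h2 : ∀ x ∈ N, ∀ n, componentB x n ∈ N)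
    (x : Tot K A B) (hx : x ∈ N) :
    ∃ L : List (Tot K A B), (∀ y ∈ L, y ∈ N ∧ ∃ d, y ∈ totDeg K A B d) ∧ L.sum = x := by
  classical
  refine ⟨(DFinsupp.support x.1.val).toList.map (componentQ x) ++
    (DFinsupp.support x.2).toList.map (componentB x), fun y hy => ?_, ?_⟩
  · rcases List.mem_append.1 hy with hy | hy
    · obtain ⟨n, -, rfl⟩ := List.mem_map.1 hy
      exact ⟨h1 x hx n, _, componentQ_mem x n⟩
    · obtain ⟨n, -, rfl⟩ := List.mem_map.1 hy
      exact ⟨h2 x hx n, _, componentB_mem x n⟩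
  · rw [List.sum_append, Finset.sum_map_toList, Finset.sum_map_toList]
    refine Prod.ext (Subtype.ext ?_) ?_
    · rw [Prod.fst_add, Prod.fst_sum, Prod.fst_sum, Submodule.coe_add, Submodule.coe_sum,
        Submodule.coe_sum]
      simp only [componentQ, componentB, ZeroMemClass.coe_zero, Finset.sum_const_zero, add_zero]
      exact DirectSum.sum_support_of x.1.val
    · rw [Prod.snd_add, Prod.snd_sum, Prod.snd_sum]
      simp only [componentQ, componentB, Finset.sum_const_zero, zero_add]
      exact DirectSum.sum_support_of x.2

theorem le_iSup_inf_of_exists_list {V : Type*} [AddCommGroup V] [Module K V]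
    {𝒢 : ℤ → Submodule K V} {N : Submodule K V}
    (h : ∀ x ∈ N, ∃ L : List V, (∀ y ∈ L, y ∈ N ∧ ∃ d, y ∈ 𝒢 d) ∧ L.sum = x) :
    N ≤ ⨆ d, N ⊓ 𝒢 d := by
  intro x hx
  obtain ⟨L, hL, rfl⟩ := h x hx
  refine list_sum_mem fun y hy => ?_
  obtain ⟨hN, d, hd⟩ := hL y hy
  exact Submodule.mem_iSup_of_mem d ⟨hN, hd⟩

/-- A criterion for a family of subspaces to be a grading. -/
theorem isInternal_of_separated {V : Type*} [AddCommGroup V] [Module K V]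
    (𝒢 N : ℤ → Submodule K V) (hN : ∀ d j, j ≠ d → ∀ x ∈ 𝒢 j, x ∈ N d)
    (h0 : ∀ d, ∀ x ∈ 𝒢 d, x ∈ N d → x = 0)
    (htop : ∀ x : V, ∃ L : List V, (∀ y ∈ L, ∃ d, y ∈ 𝒢 d) ∧ L.sum = x) :
    DirectSum.IsInternal 𝒢 := by
  rw [DirectSum.isInternal_submodule_iff_iSupIndep_and_iSup_eq_top]
  refine ⟨fun d => ?_, eq_top_iff.2 ((le_iSup_inf_of_exists_list (𝒢 := 𝒢) fun x _ => ?_).trans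
    (iSup_mono fun _ => inf_le_right))⟩
  · rw [Submodule.disjoint_def]
    exact fun x hx hx' => h0 d x hx ((iSup₂_le fun j hj => hN d j hj : _ ≤ N d) hx')
  · obtain ⟨L, hL, hx⟩ := htop x
    exact ⟨L, fun y hy => ⟨trivial, hL y hy⟩, hx⟩

variable (K A B) in
/-- The elements of `𝒬[1] ⊕ 𝔟` without component of degree `d`. -/
def withoutDeg (d : ℤ) : Submodule K (Tot K A B) where
  carrier := {x | (∀ n : ℕ, (n : ℤ) = d + 1 → x.1.val n = 0) ∧
    ∀ n : ℕ, (n : ℤ) = d → x.2 n = 0}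
  add_mem' hx hy :=
    ⟨fun n hn => by simp [hx.1 n hn, hy.1 n hn], fun n hn => by simp [hx.2 n hn, hy.2 n hn]⟩
  zero_mem' := by simp
  smul_mem' c _ hx :=
    ⟨fun n hn => (congrArg (c • ·) (hx.1 n hn)).trans (smul_zero c),
      fun n hn => (congrArg (c • ·) (hx.2 n hn)).trans (smul_zero c)⟩

theorem mem_withoutDeg {d j : ℤ} (hj : j ≠ d) {x : Tot K A B} (hx : x ∈ totDeg K A B j) :
    x ∈ withoutDeg K A B d :=
  ⟨fun n hn => hx.1 n fun h => hj (by omega), fun n hn => hx.2 n fun h => hj (by omega)⟩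

theorem eq_zero_of_mem_withoutDeg {d : ℤ} {x : Tot K A B} (hx : x ∈ totDeg K A B d)
    (hN : x ∈ withoutDeg K A B d) : x = 0 := by
  refine Prod.ext (Subtype.ext (DFinsupp.ext fun n => ?_)) (DFinsupp.ext fun n => ?_)
  · by_cases hn : (n : ℤ) = d + 1
    · exact hN.1 n hn
    · exact hx.1 n hn
  · by_cases hn : (n : ℤ) = d
    · exact hN.2 n hn
    · exact hx.2 n hn

theorem exists_list_homogeneous (x : Tot K A B) :
    ∃ L : List (Tot K A B), (∀ y ∈ L, ∃ d, y ∈ totDeg K A B d) ∧ L.sum = x := by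
  obtain ⟨L, hL, hx⟩ :=
    exists_list_components ⊤ (fun _ _ _ => trivial) (fun _ _ _ => trivial) x trivial
  exact ⟨L, fun y hy => (hL y hy).2, hx⟩

end Grading

/-! ### The `L_∞`-algebra -/

section Algebra

variable {K : Type*} [Field K] {A B : Type*} [AddCommGroup A] [Module K A]
  [AddCommGroup B] [Module K B]

theorem onList_ops_mem (L : List (TotHomog K A B)) :
    onList (fun k => ops K A B k) (L.map Homog.val) ∈
      totDeg K A B ((L.map Sigma.fst).sum + 1) := by
  obtain ⟨h1, h2⟩ := onList_ops L
  constructor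
  · intro n hn
    rw [h1]
    exact (gerstData K A B).bin_mem gerstPart_mem L n hn
  · intro n hn
    rw [h2]
    exact (gerstData K A B).mix_mem gerstPart_mem abPart_mem L n hn

theorem gradedSymm_ops : GradedSymm K Sigma.fst
    fun L : List (TotHomog K A B) => onList (fun k => ops K A B k) (L.map Homog.val) := by
  intro P x y L
  refine Prod.ext (Subtype.ext ?_) ?_
  · refine (onList_ops _).1.trans (((gerstData K A B).gradedSymm_bin gerstPart_mem P x y L).trans ?_)
    rw [← (onList_ops (P ++ y :: x :: L)).1]
    rfl
  · refine (onList_ops _).2.trans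
      (((gerstData K A B).gradedSymm_mix gerstPart_mem abPart_mem P x y L).trans ?_)
    rw [← (onList_ops (P ++ y :: x :: L)).2]
    rfl

theorem splitSum_ops_fst (L : List (TotHomog K A B)) : (splitSum K Sigma.fst L (fun S T =>
    onList (fun k => ops K A B k)
      (onList (fun k => ops K A B k) (S.map Homog.val) :: T.map Homog.val))).1.val = 0 := by
  refine (splitSum_map ((Q K A B).subtype ∘ₗ LinearMap.fst K (Q K A B) (AbB K A B)) L _).trans ?_
  refine Eq.trans ?_ ((gerstData K A B).splitSum_bin gerstPart_mem L)
  congr 1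
  funext S T
  refine (onList_ops (⟨_, _, onList_ops_mem S⟩ :: T)).1.trans ?_
  match T with
  | [] => rfl
  | [z] =>
    rw [← (onList_ops S).1]
    rfl
  | _ :: _ :: _ => rfl

theorem splitSum_ops_snd (L : List (TotHomog K A B)) : (splitSum K Sigma.fst L (fun S T =>
    onList (fun k => ops K A B k)
      (onList (fun k => ops K A B k) (S.map Homog.val) :: T.map Homog.val))).2 = 0 := by
  refine (splitSum_map (LinearMap.snd K (Q K A B) (AbB K A B)) L _).trans ?_
  refine Eq.trans ?_ ((gerstData K A B).splitSum_mix gerstPart_mem abPart_mem L)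
  congr 1
  funext S T
  refine (onList_ops (⟨_, _, onList_ops_mem S⟩ :: T)).2.trans ?_
  -- Separates the term where the inner result supplies the entry from 𝒬 from the terms where it is
  -- one of the entries from 𝔟.
  rw [BracketData.mix, pullOut_cons, ← (onList_ops S).1, ← (onList_ops S).2]
  rfl

theorem isListLInfinity_ops :
    IsListLInfinity (V := Tot K A B) K (totDeg K A B) (fun k => ops K A B k) where
  grading := by
    have h := isInternal_of_separated (V := Tot K A B) (totDeg K A B) (withoutDeg K A B)
      (fun _ _ hj _ hx => mem_withoutDeg hj hx)
      (fun _ _ hx hN => eq_zero_of_mem_withoutDeg hx hN) exists_list_homogeneous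
    exact h
  multilinear k := ⟨ops K A B k, fun _ => rfl⟩
  curvature_zero := rfl
  degree_one := onList_ops_mem
  symmetric := gradedSymm_ops
  jacobi L := Prod.ext (Subtype.ext (splitSum_ops_fst L)) (splitSum_ops_snd L)

end Algebra

/-! ### Filtrations -/

/-- If the filtration meets each degree trivially from some index on, every coherent sequence of
that degree is eventually constant, and the constant value is its unique limit. -/
theorem isWeaklyFiltered_of_separated {K : Type*} [Field K] {V : Type*} [AddCommGroup V]
    [Module K V] (𝒢 : ℤ → Submodule K V) (l : ∀ k : ℕ, (Fin k → V) → V) (F : ℕ → Submodule K V)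
    (h1 : ∀ x, x ∈ F 1) (hdec : ∀ k x, x ∈ F (k + 1) → x ∈ F k)
    (hgr : ∀ k, ∀ x ∈ F k, ∃ L : List V, (∀ y ∈ L, y ∈ F k ∧ ∃ d, y ∈ 𝒢 d) ∧ L.sum = x)
    (hsep : ∀ d, ∃ n, 1 ≤ n ∧ ∀ k, n ≤ k → ∀ x ∈ 𝒢 d, x ∈ F k → x = 0)
    (N : ℕ) (hl : ∀ k, N ≤ k → ∀ x, l k x ∈ F k) : IsWeaklyFiltered K 𝒢 l := by
  have hanti : ∀ j k, j ≤ k → F k ≤ F j := by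
    intro j k hjk
    induction k, hjk using Nat.le_induction with
    | base => exact le_rfl
    | succ k _ ih => exact fun x hx => ih (hdec k x hx)
  refine ⟨F, eq_top_iff.2 fun x _ => h1 x, fun k _ => hdec k,
    fun k _ => le_antisymm (le_iSup_inf_of_exists_list (hgr k)) (iSup_le fun _ => inf_le_left),
    fun d u hu hstep => ?_, N, fun k hk _ => hl k hk⟩
  obtain ⟨n, hn, hz⟩ := hsep d
  have htel : ∀ j k, 1 ≤ j → j ≤ k → u k - u j ∈ F j := by
    intro j k hj hjk
    induction k, hjk using Nat.le_induction with
    | base => rw [sub_self]; exact Submodule.zero_mem _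
    | succ k hk ih =>
      rw [← sub_add_sub_cancel _ (u k)]
      exact Submodule.add_mem _ (hanti j k hk (hstep k (hj.trans hk))) ih
  have hconst : ∀ k, n ≤ k → u k - u n = 0 := fun k hk =>
    hz n le_rfl _ (Submodule.sub_mem _ (hu k) (hu n)) (htel n k hn hk)
  refine ⟨u n, ⟨hu n, fun k hk => ?_⟩, fun v hv => ?_⟩
  · rcases le_total k n with h | h
    · exact htel k n hk h
    · rw [← neg_sub, hconst k h, neg_zero]
      exact Submodule.zero_mem _
  · exact sub_eq_zero.1 (hz n le_rfl _ (Submodule.sub_mem _ hv.1 (hu n)) (hv.2 n hn))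

/-! ### Lower and upper degree bounds in direct sums -/

section AboveDeg

variable (K : Type*) [Field K]

/-- The elements of a direct sum whose components of degree less than `n` vanish. -/
def aboveDeg (M : ℕ → Type*) [∀ n, AddCommMonoid (M n)] [∀ n, Module K (M n)] (n : ℕ) :
    Submodule K (⨁ n, M n) where
  carrier := {X | ∀ m < n, X m = 0}
  add_mem' hX hY m hm := by rw [DirectSum.add_apply, hX m hm, hY m hm, add_zero]
  zero_mem' _ _ := rfl
  smul_mem' c X hX m hm := by rw [DirectSum.smul_apply, hX m hm, smul_zero]

variable {K} {M : ℕ → Type*} [∀ n, AddCommMonoid (M n)] [∀ n, Module K (M n)]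

theorem lof_mem_aboveDeg {m n : ℕ} (h : n ≤ m) (x : M m) :
    DirectSum.lof K ℕ M m x ∈ aboveDeg K M n := by
  intro j hj
  rw [DirectSum.lof_eq_of, DirectSum.of_eq_of_ne]
  omega

/-- All degrees in the Gerstenhaber algebra are non-negative, so a bracket never lowers the degree.
-/
theorem bracket_mem_aboveDeg {W : Type*} [AddCommGroup W] [Module K W] {n : ℕ} {X : Gerst K W}
    (hX : X ∈ aboveDeg K (Multi K W) n) (Y : Gerst K W) :
    bracket K W X Y ∈ aboveDeg K (Multi K W) n := by
  classical
  rw [← DirectSum.sum_support_of X, ← DirectSum.sum_support_of Y]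
  simp only [map_sum, LinearMap.sum_apply]
  refine Submodule.sum_mem _ fun i _ => Submodule.sum_mem _ fun j hj => ?_
  have hin : n ≤ j := by
    by_contra hcon
    exact (DFinsupp.mem_support_toFun _ _).1 hj (hX j (not_le.1 hcon))
  rw [← DirectSum.lof_eq_of K, ← DirectSum.lof_eq_of K, bracket_lof]
  exact Submodule.sub_mem _ (lof_mem_aboveDeg (by omega) _)
    (Submodule.smul_mem _ _ (lof_mem_aboveDeg (by omega) _))

theorem toModule_eq_sum {P : Type*} [AddCommMonoid P] [Module K P] (φ : ∀ n, M n →ₗ[K] P)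
    (X : ⨁ n, M n) :
    ∃ s : Finset ℕ, (∀ n ∈ s, X n ≠ 0) ∧ DirectSum.toModule K ℕ P φ X = ∑ n ∈ s, φ n (X n) := by
  classical
  refine ⟨DFinsupp.support X, fun n hn => (DFinsupp.mem_support_toFun _ _).1 hn, ?_⟩
  conv_lhs => rw [← DirectSum.sum_support_of X]
  rw [map_sum]
  exact Finset.sum_congr rfl fun n _ => DirectSum.toModule_lof K n (X n)

theorem exists_bound_directSum (X : ⨁ n, M n) : ∃ D : ℕ, ∀ n, D < n → X n = 0 := by
  classical
  refine ⟨(DFinsupp.support X).sup id, fun n hn => ?_⟩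
  by_contra hcon
  exact absurd (Finset.le_sup (f := id) ((DFinsupp.mem_support_toFun X n).2 hcon)) (not_le.2 hn)

end AboveDeg

/-! ### The filtration by arity and local nilpotence -/

section Filtration

variable {K : Type*} [Field K] {A B : Type*} [AddCommGroup A] [Module K A]
  [AddCommGroup B] [Module K B]

theorem mixed_mem {k : ℕ} {x : Fin (k + 1) → Tot K A B} {N : Submodule K (Tot K A B)}
    (h : ∀ i n, (x i).1.val n ≠ 0 → ∀ L : List (AbB K A B), L.length = k →
      (0, proj ((gerstData K A B).iter (DirectSum.lof K ℕ (Multi K (A × B)) n ((x i).1.val n)) L))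
        ∈ N) : mixed k x ∈ N := by
  rw [mixed_apply]
  refine Submodule.sum_mem _ fun i _ => ?_
  obtain ⟨s, hs, he⟩ := toModule_eq_sum (mixedHom k i) (x i).1.val
  rw [he, _root_.sum_apply]
  refine Submodule.sum_mem _ fun n hn => ?_
  rw [mixedHom_apply, iterBracket_eq_iter]
  exact h i n (hs n hn) _ List.length_ofFn

theorem iter_mem_aboveDeg {n : ℕ} {X : Gerst K (A × B)}
    (hX : X ∈ aboveDeg K (Multi K (A × B)) n) (L : List (AbB K A B)) :
    (gerstData K A B).iter X L ∈ aboveDeg K (Multi K (A × B)) n := by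
  induction L generalizing X with
  | nil => exact hX
  | cons f L ih => exact ih (bracket_mem_aboveDeg hX _)

variable (K A B) in
/-- The filtration of `𝒬[1] ⊕ 𝔟` by the arity. -/
def arityFiltration (k : ℕ) : Submodule K (Tot K A B) where
  carrier := {x | (∀ n : ℕ, n + 2 < k → x.1.val n = 0) ∧ ∀ n : ℕ, n + 3 < k → x.2 n = 0}
  add_mem' hx hy :=
    ⟨fun n hn => by simp [hx.1 n hn, hy.1 n hn], fun n hn => by simp [hx.2 n hn, hy.2 n hn]⟩
  zero_mem' := by simp
  smul_mem' c _ hx :=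
    ⟨fun n hn => (congrArg (c • ·) (hx.1 n hn)).trans (smul_zero c),
      fun n hn => (congrArg (c • ·) (hx.2 n hn)).trans (smul_zero c)⟩

theorem arityFiltration_antitone : Antitone (arityFiltration K A B) := fun _ _ h _ hx =>
  ⟨fun n hn => hx.1 n (hn.trans_le h), fun n hn => hx.2 n (hn.trans_le h)⟩

theorem componentQ_mem_arityFiltration {k : ℕ} {x : Tot K A B} (hx : x ∈ arityFiltration K A B k)
    (n : ℕ) : componentQ x n ∈ arityFiltration K A B k := by
  refine ⟨fun m hm => ?_, fun _ _ => rfl⟩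
  rcases eq_or_ne n m with rfl | h
  · change DirectSum.lof K ℕ (Multi K (A × B)) n (x.1.val n) n = 0
    rw [hx.1 n hm, map_zero]
    rfl
  · exact lof_mem_degPart (K := K) n (x.1.val n) m (by simpa using h.symm)

theorem componentB_mem_arityFiltration {k : ℕ} {x : Tot K A B} (hx : x ∈ arityFiltration K A B k)
    (n : ℕ) : componentB x n ∈ arityFiltration K A B k := by
  refine ⟨fun _ _ => rfl, fun m hm => ?_⟩
  rcases eq_or_ne n m with rfl | h
  · change DirectSum.lof K ℕ (fun n => MultilinearMap K (fun _ : Fin (n + 1) => B) A) n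
      (x.2 n) n = 0
    rw [hx.2 n hm, map_zero]
    rfl
  · exact lof_mem_degPart (K := K) (M := fun n => MultilinearMap K (fun _ : Fin (n + 1) => B) A)
      n (x.2 n) m (by simpa using h.symm)

theorem isWeaklyFiltered_of_mem_arityFiltration (l : ∀ k : ℕ, (Fin k → Tot K A B) → Tot K A B)
    (hl : ∀ k, 3 ≤ k → ∀ x, l k x ∈ arityFiltration K A B k) :
    IsWeaklyFiltered (V := Tot K A B) K (totDeg K A B) l := by
  have h := isWeaklyFiltered_of_separated (V := Tot K A B) (totDeg K A B) l
    (arityFiltration K A B) (fun x => ⟨fun n hn => by omega, fun n hn => by omega⟩)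
    (fun k x hx => arityFiltration_antitone k.le_succ hx)
    (fun k x hx => exists_list_components _ (fun _ => componentQ_mem_arityFiltration)
      (fun _ => componentB_mem_arityFiltration) x hx)
    (fun d => ⟨(d + 4).toNat + 1, by omega, fun k hk x hx hF => Prod.ext
      (Subtype.ext (DFinsupp.ext fun n => ?_)) (DFinsupp.ext fun n => ?_)⟩) 3 hl
  · exact h
  · by_cases hn : (n : ℤ) = d + 1
    · exact hF.1 n (by omega)
    · exact hx.1 n hn
  · by_cases hn : (n : ℤ) = d
    · exact hF.2 n (by omega)
    · exact hx.2 n hn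

variable [CharZero K]

/-- A component F of degree n contributes to `l_k` only if k - 1 ≤ n + 2, and then only in degrees
at least n. So the 𝔟-component of `l_k` starts in degree k - 3, which is the offset 3 in the
filtration; for k ≥ 3 there is no 𝒬-component. -/
theorem ops_mem_arityFiltration (k : ℕ) (hk : 3 ≤ k) (x : Fin k → Tot K A B) :
    ops K A B k x ∈ arityFiltration K A B k := by
  obtain ⟨k, rfl⟩ := Nat.exists_eq_add_of_le' hk
  change mixed (k + 2) x ∈ _
  refine mixed_mem fun i n _ L hL => ⟨fun _ _ => rfl, fun m hm => ?_⟩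
  change proj _ m = 0
  by_cases hn : n + 3 ≤ L.length
  · rw [proj_iter_eq_zero ((x i).1.2 n) L hn]
    rfl
  · rw [proj, DirectSum.lmap_apply,
      iter_mem_aboveDeg (lof_mem_aboveDeg le_rfl _) L m (by omega), map_zero]

/-- With all 𝒬-parts of degree at most D, the operation `l_k` brackets with k - 1 ≥ D + 3 elements
of 𝔟, enough for `proj_iter_eq_zero`. -/
theorem ops_eq_zero {k D : ℕ} {x : Fin k → Tot K A B} (hx : ∀ i n, D < n → (x i).1.val n = 0)
    (hk : D + 4 ≤ k) : ops K A B k x = 0 := by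
  obtain ⟨k, rfl⟩ := Nat.exists_eq_add_of_le' (show 3 ≤ k by omega)
  change mixed (k + 2) x = 0
  rw [← Submodule.mem_bot K]
  refine mixed_mem fun i n hn L hL => ?_
  have hD : n ≤ D := not_lt.1 fun h => hn (hx i n h)
  rw [proj_iter_eq_zero ((x i).1.2 n) L (by omega)]
  exact Submodule.zero_mem _

theorem onList_ops_eq_zero {D : ℕ} {L : List (Tot K A B)}
    (hL : ∀ y ∈ L, ∀ n, D < n → y.1.val n = 0) (hk : D + 4 ≤ L.length) :
    onList (fun k => ops K A B k) L = 0 :=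
  ops_eq_zero (fun i => hL _ (List.get_mem L i)) hk

theorem isLocallyNilpotent_ops :
    IsLocallyNilpotent (V := Tot K A B) K (totDeg K A B) (fun k => ops K A B k) := by
  -- Total degree at most D means degree at most D + 1 in 𝒬 before the shift, and D may be negative.
  refine fun D => ⟨(D + 1).toNat + 4, fun L hL hlen => ?_⟩
  refine onList_ops_eq_zero (D := (D + 1).toNat) (fun y hy n hn => ?_) (by simpa using hlen)
  obtain ⟨h, hh, rfl⟩ := List.mem_map.1 hy
  have := hL h hh
  exact h.2.2.1 n (by omega)

theorem finite_support_twistTerm (α : Tot K A B) (k : ℕ) (x : Fin k → Tot K A B) :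
    (Function.support (twistTerm K (fun k => ops K A B k) α k x)).Finite := by
  obtain ⟨D₀, h₀⟩ := exists_bound_directSum α.1.val
  choose D hD using fun i => exists_bound_directSum (x i).1.val
  -- The sum of the individual bounds serves as one bound for α and all the arguments.
  refine finite_support_of_bound (V := Tot K A B) (n := D₀ + ∑ i, D i + 4) fun n hn => ?_
  rw [twistTerm_eq, onList_ops_eq_zero (D := D₀ + ∑ i, D i), smul_zero]
  · intro y hy m hm
    rcases List.mem_append.1 hy with hy | hy
    · rw [List.eq_of_mem_replicate hy]
      exact h₀ m (by omega)
    · obtain ⟨i, rfl⟩ := List.mem_ofFn.1 hy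
      have := Finset.single_le_sum (f := D) (fun i _ => Nat.zero_le _) (Finset.mem_univ i)
      exact hD i m (by omega)
  · simp only [List.length_append, List.length_replicate]
    omega

theorem twist_mem_arityFiltration (α : Tot K A B) (k : ℕ) (hk : 3 ≤ k) (x : Fin k → Tot K A B) :
    twist K (fun k => ops K A B k) α k x ∈ arityFiltration K A B k := by
  obtain ⟨k, rfl⟩ := Nat.exists_eq_add_of_le' (show 1 ≤ k by omega)
  refine finsum_induction (· ∈ arityFiltration K A B (k + 1)) (Submodule.zero_mem _)
    (fun _ _ => Submodule.add_mem _) fun n => Submodule.smul_mem _ _ ?_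
  exact arityFiltration_antitone (by omega) (ops_mem_arityFiltration (n + (k + 1)) (by omega) _)

end Filtration

/-! ### The values of the structure maps -/

section StructureMaps

variable {K : Type*} [Field K] {A B : Type*} [AddCommGroup A] [Module K A]
  [AddCommGroup B] [Module K B]

theorem toModule_mixedHom_eq_zero {k : ℕ} {i : Fin (k + 1)} (F : Gerst K (A × B))
    {y : Fin k → Tot K A B} (j : Fin k) (hj : (y j).2 = 0) :
    DirectSum.toModule K ℕ _ (mixedHom k i) F y = 0 := by
  obtain ⟨s, -, he⟩ := toModule_eq_sum (mixedHom (K := K) (A := A) (B := B) k i) F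
  rw [he, _root_.sum_apply]
  refine Finset.sum_eq_zero fun n _ => ?_
  rw [mixedHom_apply, MultilinearMap.map_coord_zero _ j, map_zero]
  · rfl
  · rw [hj, map_zero, ite_self]

theorem toModule_mixedHom_zero (k : ℕ) (F : Gerst K (A × B)) (y : Fin k → Tot K A B) :
    DirectSum.toModule K ℕ _ (mixedHom k 0) F y = (0, proj (iterBracket k F fun j => (y j).2)) := by
  induction F using DirectSum.induction_on with
  | zero =>
    rw [map_zero, map_zero]
    exact Prod.ext rfl (map_zero _).symm
  | of n f =>
    rw [← DirectSum.lof_eq_of K, DirectSum.toModule_lof, mixedHom_apply]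
    simp
  | add F G hF hG =>
    rw [map_add, _root_.add_apply, hF, hG, map_add, _root_.add_apply, map_add]
    exact Prod.ext (add_zero 0) rfl

/-- Each summand reads the 𝔟-parts of all arguments but one, so at least one of the two vanishing
parts occurs in it. -/
theorem mixed_eq_zero_of_snd {k : ℕ} {x : Fin (k + 1) → Tot K A B} {i j : Fin (k + 1)}
    (hij : i ≠ j) (hi : (x i).2 = 0) (hj : (x j).2 = 0) : mixed k x = 0 := by
  rw [mixed_apply]
  refine Finset.sum_eq_zero fun p _ => ?_
  by_cases hp : i = p
  · obtain ⟨q, hq⟩ := Fin.exists_succAbove_eq (show j ≠ p from fun h => hij (hp.trans h.symm))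
    exact toModule_mixedHom_eq_zero _ q (by rw [Fin.removeNth_apply, hq, hj])
  · obtain ⟨q, hq⟩ := Fin.exists_succAbove_eq hp
    exact toModule_mixedHom_eq_zero _ q (by rw [Fin.removeNth_apply, hq, hi])

theorem mixed_eq_zero_of_fst {k : ℕ} {x : Fin (k + 1) → Tot K A B} (hx : ∀ i, (x i).1 = 0) :
    mixed k x = 0 := by
  rw [mixed_apply]
  refine Finset.sum_eq_zero fun p _ => ?_
  rw [hx, ZeroMemClass.coe_zero, map_zero]
  rfl

theorem mixed_cons (k : ℕ) (F : Q K A B) (f : Fin k → AbB K A B) :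
    mixed k (Fin.cons (F, 0) fun j => (0, f j)) = (0, proj (iterBracket k F.val f)) := by
  rw [mixed_apply, Finset.sum_eq_single 0]
  · rw [toModule_mixedHom_zero]
    rfl
  · intro i _ hi
    obtain ⟨j, rfl⟩ := Fin.exists_succ_eq.2 hi
    rw [Fin.cons_succ, ZeroMemClass.coe_zero, map_zero]
    rfl
  · exact fun h => absurd (Finset.mem_univ _) h

theorem ops_two_of_homogeneous (m : ℕ) (F G : Q K A B) (hF : ∀ n, n ≠ m → F.val n = 0) :
    ops K A B 2 ![(F, 0), (G, 0)] =
      ((-1 : K) ^ m • ⟨bracket K (A × B) F.val G.val, bracket_mem_Q F.2 G.2⟩, 0) := by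
  change binary K A B ![(F, 0), (G, 0)] + mixed 1 ![(F, 0), (G, 0)] = _
  rw [mixed_eq_zero_of_snd (i := 0) (j := 1) (by decide) rfl rfl, add_zero]
  refine Prod.ext (Subtype.ext ?_) rfl
  change bracket K (A × B) (parity F.val) G.val = (-1 : K) ^ m • bracket K (A × B) F.val G.val
  have hm : F.val ∈ gerstDeg K (A × B) m := fun n hn => hF n (by simpa using hn)
  rw [parity_of_mem hm, map_smul, zpow_natCast]
  rfl

theorem ops_cons (k : ℕ) (hk : 1 ≤ k) (F : Q K A B) (f : Fin k → AbB K A B) :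
    ops K A B (k + 1) (Fin.cons (F, 0) fun j => (0, f j)) = (0, proj (iterBracket k F.val f)) := by
  match k, hk with
  | 1, _ =>
    have hb : binary K A B (Fin.cons (F, 0) fun j => (0, f j)) = 0 :=
      Prod.ext (Subtype.ext (map_zero (bracket K (A × B) (parity F.val)))) rfl
    exact (congrArg₂ (· + ·) hb (mixed_cons 1 F f)).trans (zero_add _)
  | k + 2, _ => exact mixed_cons (k + 2) F f

theorem ops_of_fst_eq_zero (k : ℕ) (f : Fin k → AbB K A B) :
    ops K A B k (fun j => (0, f j)) = 0 := by
  match k with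
  | 0 => rfl
  | 1 => rfl
  | 2 =>
    have hb : binary K A B (fun j => (0, f j)) = 0 :=
      Prod.ext (Subtype.ext (map_zero (bracket K (A × B) (parity 0)))) rfl
    have hm : mixed 1 (fun j => ((0 : Q K A B), f j)) = 0 := mixed_eq_zero_of_fst fun _ => rfl
    exact (congrArg₂ (· + ·) hb hm).trans (zero_add _)
  | k + 3 => exact mixed_eq_zero_of_fst fun _ => rfl

theorem ops_of_snd_eq_zero (k : ℕ) (hk : 3 ≤ k) (x : Fin k → Tot K A B) (i j : Fin k)
    (hij : i ≠ j) (hi : (x i).2 = 0) (hj : (x j).2 = 0) : ops K A B k x = 0 := by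
  obtain ⟨k, rfl⟩ := Nat.exists_eq_add_of_le' hk
  exact mixed_eq_zero_of_snd hij hi hj

end StructureMaps

/-! ### Tuples and bilinear maps -/

section Tuples

variable {K : Type*} [Field K]

/-- A multilinear map in two variables as a bilinear map. -/
def toBilin {W : Type*} [AddCommGroup W] [Module K W] (f : Multi K W 1) : W →ₗ[K] W →ₗ[K] W :=
  have h (u v w : W) : Function.update ![u, v] 1 w = ![u, w] := by
    funext i
    fin_cases i <;> rfl
  LinearMap.mk₂ K (fun u v => f ![u, v])
    (fun u u' v => f.cons_add ![v] u u')
    (fun c u v => f.cons_smul ![v] c u)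
    (fun u v v' => by simpa only [h] using f.map_update_add ![u, v] 1 v v')
    (fun c u v => by simpa only [h] using f.map_update_smul ![u, v] 1 c v)

theorem toBilin_apply {W : Type*} [AddCommGroup W] [Module K W] (f : Multi K W 1) (u v : W) :
    toBilin f u v = f ![u, v] := rfl

variable {A B : Type*} [AddCommGroup A] [Module K A] [AddCommGroup B] [Module K B]

/-- The tuple of the components of a bilinear map on `A ⊕ B`. -/
def Tuple.ofMulti (f : Multi K (A × B) 1) : Tuple K A B where
  mu := ((toBilin f).compl₁₂ (.inl K A B) (.inl K A B)).compr₂ (.fst K A B)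
  nu := ((toBilin f).compl₁₂ (.inr K A B) (.inr K A B)).compr₂ (.snd K A B)
  lact := ((toBilin f).compl₁₂ (.inl K A B) (.inr K A B)).compr₂ (.snd K A B)
  ract := ((toBilin f).compl₁₂ (.inr K A B) (.inl K A B)).compr₂ (.snd K A B)
  lharp := ((toBilin f).compl₁₂ (.inr K A B) (.inl K A B)).compr₂ (.fst K A B)
  rharp := ((toBilin f).compl₁₂ (.inl K A B) (.inr K A B)).compr₂ (.fst K A B)
  theta := ((toBilin f).compl₁₂ (.inl K A B) (.inl K A B)).compr₂ (.snd K A B)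

theorem Tuple.ofMulti_omega (T : Tuple K A B) : Tuple.ofMulti T.omega = T := by
  obtain ⟨mu, nu, lact, ract, lharp, rharp, theta⟩ := T
  simp only [Tuple.ofMulti, Tuple.mk.injEq]
  refine ⟨?_, ?_, ?_, ?_, ?_, ?_, ?_⟩ <;> refine LinearMap.ext₂ fun a b => ?_ <;>
    simp [toBilin_apply, Tuple.omega_apply, Tuple.mul]

/-- The tuple records every component of a bilinear map on A ⊕ B except B ⊗ B → A, and that one
vanishes on `homQ`. -/
theorem Tuple.omega_ofMulti {f : Multi K (A × B) 1} (hf : f ∈ homQ K A B 1) :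
    (Tuple.ofMulti f).omega = f := by
  refine MultilinearMap.ext fun v => ?_
  have h0 : (toBilin f (0, (v 0).2) (0, (v 1).2)).1 = 0 := by
    refine Eq.trans ?_ ((mem_homQ_iff f).1 hf ![(v 0).2, (v 1).2])
    rw [toBilin_apply]
    congr 2
    funext i
    fin_cases i <;> rfl
  have hv : f v = toBilin f ((v 0).1, 0) ((v 1).1, 0) + toBilin f ((v 0).1, 0) (0, (v 1).2) +
      (toBilin f (0, (v 0).2) ((v 1).1, 0) + toBilin f (0, (v 0).2) (0, (v 1).2)) := by
    rw [← map_add, ← map_add, ← LinearMap.add_apply, ← map_add, Prod.mk_add_mk, Prod.mk_add_mk,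
      add_zero, zero_add, add_zero, zero_add, toBilin_apply]
    congr 1
    funext i
    fin_cases i <;> rfl
  rw [hv, Tuple.omega_apply]
  simp only [Tuple.mul, Tuple.ofMulti, LinearMap.compr₂_apply, LinearMap.compl₁₂_apply,
    LinearMap.inl_apply, LinearMap.inr_apply, LinearMap.fst_apply, LinearMap.snd_apply]
  refine Prod.ext ?_ ?_
  · simp only [Prod.fst_add, h0, add_zero]
  · simp only [Prod.snd_add]
    abel

theorem Tuple.omegaQ_ofMulti (Ω : homQ K A B 1) : (Tuple.ofMulti Ω.val).omegaQ = Ω :=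
  Subtype.ext (Tuple.omega_ofMulti Ω.2)

theorem pairElt_add (Ω Ω' : homQ K A B 1) (r r' : B →ₗ[K] A) :
    pairElt Ω r + pairElt Ω' r' = pairElt (Ω + Ω') (r + r') := by
  refine Prod.ext (Subtype.ext ?_) ?_
  · exact (map_add (DirectSum.lof K ℕ (Multi K (A × B)) 1) Ω.val Ω'.val).symm
  · exact (map_add (DirectSum.lof K ℕ (fun n => MultilinearMap K (fun _ : Fin (n + 1) => B) A) 0)
      (MultilinearMap.ofSubsingleton K B A (0 : Fin 1) r) _).symm

theorem pairElt_mem (Ω : homQ K A B 1) (r : B →ₗ[K] A) : pairElt Ω r ∈ totDeg K A B 0 :=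
  ⟨fun n hn => lof_mem_degPart (K := K) 1 Ω.val n (by simpa using hn),
    fun n hn => lof_mem_degPart (K := K)
      (M := fun n => MultilinearMap K (fun _ : Fin (n + 1) => B) A) 0 _ n hn⟩

theorem pairElt_injective {Ω Ω' : homQ K A B 1} {r r' : B →ₗ[K] A}
    (h : pairElt Ω r = pairElt Ω' r') : Ω = Ω' ∧ r = r' := by
  have h1 := congrArg (fun x : Tot K A B => x.1.val 1) h
  have h2 := congrArg (fun x : Tot K A B => x.2 0) h
  simp only [pairElt, DirectSum.lof_apply] at h1 h2
  exact ⟨Subtype.ext h1, (MultilinearMap.ofSubsingleton K B A (0 : Fin 1)).injective h2⟩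

theorem exists_eq_pairElt {α : Tot K A B} (hα : α ∈ totDeg K A B 0) :
    ∃ (Ω : homQ K A B 1) (r : B →ₗ[K] A), α = pairElt Ω r := by
  refine ⟨⟨α.1.val 1, α.1.2 1⟩,
    (MultilinearMap.ofSubsingleton K B A (0 : Fin 1)).symm (α.2 0), Prod.ext (Subtype.ext ?_) ?_⟩
  · exact eq_lof_of_mem_degPart (K := K) fun n hn => hα.1 n (by simpa using hn)
  · refine Eq.trans (eq_lof_of_mem_degPart (K := K) (n := 0) fun n hn => hα.2 n hn) ?_
    simp only [pairElt, Equiv.apply_symm_apply]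

theorem existsUnique_eq_pairElt (α : Tot K A B) (hα : α ∈ totDeg K A B 0) :
    ∃! p : Tuple K A B × (B →ₗ[K] A), α = pairElt p.1.omegaQ p.2 := by
  obtain ⟨Ω, r, rfl⟩ := exists_eq_pairElt hα
  refine ⟨(Tuple.ofMulti Ω.val, r), ?_, fun p hp => ?_⟩
  · simp only [Tuple.omegaQ_ofMulti]
  · obtain ⟨h1, h2⟩ := pairElt_injective hp
    refine Prod.ext ?_ h2.symm
    rw [h1]
    exact (Tuple.ofMulti_omega p.1).symm

end Tuples

/-! ### Maurer–Cartan elements of `𝒬[1] ⊕ 𝔟` -/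

section Gauge

variable {K : Type*} [Field K] {W : Type*} [AddCommGroup W] [Module K W]

theorem circ_one_one (X : Multi K W 1) (u v w : W) :
    circ 1 1 X X ![u, v, w] =
      toBilin X (toBilin X u v) w - toBilin X u (toBilin X v w) := by
  change (∑ i : Fin 2, (-1 : K) ^ (i.val * 1) • insertAt i X X) ![u, v, w] = _
  rw [Fin.sum_univ_two, _root_.add_apply, _root_.smul_apply, _root_.smul_apply, insertAt_apply,
    insertAt_apply]
  have h1 : ∀ c : W, outerArgs (m := 1) (n := 1) 0 c ![u, v, w] = ![c, w] := by
    intro c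
    funext i
    fin_cases i <;> rfl
  have h2 : ∀ c : W, outerArgs (m := 1) (n := 1) 1 c ![u, v, w] = ![u, c] := by
    intro c
    funext i
    fin_cases i <;> rfl
  have h3 : innerArgs (m := 1) (n := 1) 0 ![u, v, w] = ![u, v] := by
    funext i
    fin_cases i <;> rfl
  have h4 : innerArgs (m := 1) (n := 1) 1 ![u, v, w] = ![v, w] := by
    funext i
    fin_cases i <;> rfl
  rw [h1, h2, h3, h4]
  simp [toBilin_apply, sub_eq_add_neg]

/-- The bracket of a bilinear map with a linear map. -/
def adOne (X : Multi K W 1) (g : Multi K W 0) : Multi K W 1 := circ 1 0 X g - circ 0 1 g X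

theorem bracket_lof_one_zero (X : Multi K W 1) (g : Multi K W 0) :
    bracket K W (DirectSum.lof K ℕ _ 1 X) (DirectSum.lof K ℕ _ 0 g) =
      DirectSum.lof K ℕ _ 1 (adOne X g) := by
  rw [bracket_lof, adOne, map_sub, mul_zero, pow_zero, one_smul]

theorem toBilin_adOne (X : Multi K W 1) (g : Multi K W 0) (u v : W) :
    toBilin (adOne X g) u v =
      toBilin X (g ![u]) v + toBilin X u (g ![v]) - g ![toBilin X u v] := by
  change (circ 1 0 X g - circ 0 1 g X : Multi K W 1) ![u, v] = _
  have e1 : (circ 1 0 X g : Multi K W 1) ![u, v] = toBilin X (g ![u]) v + toBilin X u (g ![v]) := by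
    change (∑ i : Fin 2, (-1 : K) ^ (i.val * 0) • insertAt i X g) ![u, v] = _
    rw [Fin.sum_univ_two, _root_.add_apply, _root_.smul_apply, _root_.smul_apply, insertAt_apply,
      insertAt_apply]
    have h1 : ∀ c : W, outerArgs (m := 1) (n := 0) 0 c ![u, v] = ![c, v] := by
      intro c
      funext i
      fin_cases i <;> rfl
    have h2 : ∀ c : W, outerArgs (m := 1) (n := 0) 1 c ![u, v] = ![u, c] := by
      intro c
      funext i
      fin_cases i <;> rfl
    have h3 : innerArgs (m := 1) (n := 0) 0 ![u, v] = ![u] := by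
      funext i
      fin_cases i
      rfl
    have h4 : innerArgs (m := 1) (n := 0) 1 ![u, v] = ![v] := by
      funext i
      fin_cases i
      rfl
    rw [h1, h2, h3, h4]
    simp [toBilin_apply]
  have e2 : (circ 0 1 g X : Multi K W 1) ![u, v] = g ![toBilin X u v] := by
    change (∑ i : Fin 1, (-1 : K) ^ (i.val * 1) • insertAt i g X) ![u, v] = _
    rw [Fin.sum_univ_one, _root_.smul_apply, insertAt_apply]
    have h1 : ∀ c : W, outerArgs (m := 0) (n := 1) 0 c ![u, v] = ![c] := by
      intro c
      funext i
      fin_cases i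
      rfl
    have h3 : innerArgs (m := 0) (n := 1) 0 ![u, v] = ![u, v] := by
      funext i
      fin_cases i <;> rfl
    rw [h1, h3]
    simp [toBilin_apply]
  rw [_root_.sub_apply, e1, e2]

end Gauge

/-! ### The Maurer–Cartan equation as associativity and the weak deformation equation -/

section MaurerCartan

variable {K : Type*} [Field K]

theorem pullOut_replicate {α : Type*} {deg : α → ℤ} {M : Type*} [AddCommMonoid M] [Module K M]
    {a : α} (ha : deg a = 0) (k : ℕ) (ψ : α → List α → M) :
    pullOut K deg (List.replicate (k + 1) a) ψ = (k + 1) • ψ a (List.replicate k a) := by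
  induction k generalizing ψ with
  | zero => simp [pullOut_cons, pullOut_nil]
  | succ k ih =>
    rw [List.replicate_succ, pullOut_cons, ih]
    simp only [ha, mul_zero, zpow_zero, one_smul]
    rw [← List.replicate_succ, succ_nsmul' _ (k + 1)]

variable {A B : Type*} [AddCommGroup A] [Module K A] [AddCommGroup B] [Module K B]

/-- In degree 1 the bracket of X with itself is 2 X ⋄ X, and X ⋄ X is the associator of the product
X. -/
theorem bracket_self_lof_one [CharZero K] (X : Multi K (A × B) 1) :
    bracket K (A × B) (DirectSum.lof K ℕ _ 1 X) (DirectSum.lof K ℕ _ 1 X) = 0 ↔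
      ∀ u v w, toBilin X (toBilin X u v) w = toBilin X u (toBilin X v w) := by
  have h2 : bracket K (A × B) (DirectSum.lof K ℕ _ 1 X) (DirectSum.lof K ℕ _ 1 X) =
      (2 : K) • DirectSum.lof K ℕ (Multi K (A × B)) (1 + 1) (circ 1 1 X X) := by
    rw [bracket_lof]
    module
  rw [h2, smul_eq_zero_iff_right two_ne_zero]
  constructor
  · intro h u v w
    have h' := congrArg (fun Z : Gerst K (A × B) => Z 2 ![u, v, w]) h
    have e : (DirectSum.lof K ℕ (Multi K (A × B)) (1 + 1) (circ 1 1 X X)) 2 = circ 1 1 X X :=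
      DirectSum.lof_apply K (1 + 1) _
    simp only [e] at h'
    exact sub_eq_zero.1 ((circ_one_one X u v w).symm.trans h')
  · intro h
    have hc : circ 1 1 X X = 0 := by
      refine MultilinearMap.ext fun v => ?_
      have hv : v = ![v 0, v 1, v 2] := by
        funext i
        fin_cases i <;> rfl
      rw [hv, circ_one_one, h, sub_self]
      rfl
    rw [hc, map_zero]

theorem proj_lof_eq_zero_iff {n : ℕ} (Z : Multi K (A × B) n) :
    proj (DirectSum.lof K ℕ _ n Z) = 0 ↔ Z ∈ homQ K A B n := by
  rw [← mem_Q_iff]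
  refine ⟨fun h => ?_, lof_mem_Q⟩
  have := h n
  rwa [DirectSum.lof_apply] at this

/-- The linear map `(a, x) ↦ (r(x), 0)`. -/
def shift (r : B →ₗ[K] A) : Multi K (A × B) 0 :=
  inclHom (MultilinearMap.ofSubsingleton K B A (0 : Fin 1) r)

theorem shift_apply (r : B →ₗ[K] A) (u : A × B) : shift r ![u] = (r u.2, 0) := rfl

/-- The exponential series of [·, r] at X is (1 - r)X((1 + r)·, (1 + r)·), since r squares to zero.
It stops at order three, with coefficients 1, 1/2 and 1/6, and its missing constant term explains
why X((0, x), (0, y)) appears only under r. -/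
theorem sum_adOne [CharZero K] (X : Multi K (A × B) 1) (r : B →ₗ[K] A) (x y : B) :
    toBilin (adOne X (shift r) + (2 : K)⁻¹ • adOne (adOne X (shift r)) (shift r) +
      (6 : K)⁻¹ • adOne (adOne (adOne X (shift r)) (shift r)) (shift r)) (0, x) (0, y) =
    toBilin X (r x, 0) (0, y) + toBilin X (0, x) (r y, 0) + toBilin X (r x, 0) (r y, 0) -
      (r (toBilin X (0, x) (0, y) + toBilin X (r x, 0) (0, y) + toBilin X (0, x) (r y, 0) +
        toBilin X (r x, 0) (r y, 0)).2, 0) := by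
  have h0 : ((0, 0) : A × B) = 0 := rfl
  change toBilin (adOne X (shift r)) _ _ +
    (2 : K)⁻¹ • toBilin (adOne (adOne X (shift r)) (shift r)) _ _ +
    (6 : K)⁻¹ • toBilin (adOne (adOne (adOne X (shift r)) (shift r)) (shift r)) _ _ = _
  simp only [toBilin_adOne, shift_apply, map_zero, h0, LinearMap.zero_apply, Prod.snd_add,
    Prod.snd_sub, map_add, map_sub, Prod.snd_zero]
  refine Prod.ext ?_ ?_
  · simp only [Prod.fst_add, Prod.fst_sub, Prod.smul_fst, Prod.fst_zero]
    module
  · simp only [Prod.snd_add, Prod.snd_sub, Prod.smul_snd, Prod.snd_zero]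
    module

/-- Each of the k + 1 copies can supply Ω. The resulting factor k + 1 turns the 1/(k + 1)! of the
Maurer–Cartan sum into 1/k!. -/
theorem onList_ops_pairElt (Ω : homQ K A B 1) (r : B →ₗ[K] A) (k : ℕ) :
    onList (fun k => ops K A B k) (List.replicate (k + 1) (pairElt Ω r)) =
      (if k = 1 then (-1 : K) • ⟨bracket K (A × B) (DirectSum.lof K ℕ _ 1 Ω.val) (DirectSum.lof K ℕ _ 1 Ω.val),
          bracket_mem_Q (lof_mem_Q Ω.2) (lof_mem_Q Ω.2)⟩ else 0,
        (k + 1) • proj ((gerstData K A B).iter (DirectSum.lof K ℕ _ 1 Ω.val)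
          (List.replicate k (pairElt Ω r).2))) := by
  let c : TotHomog K A B := ⟨0, pairElt Ω r, pairElt_mem Ω r⟩
  have hc : List.replicate (k + 1) (pairElt Ω r) = (List.replicate (k + 1) c).map Homog.val := by
    rw [List.map_replicate]
    rfl
  rw [hc]
  obtain ⟨h1, h2⟩ := onList_ops (List.replicate (k + 1) c)
  refine Prod.ext (Subtype.ext ?_) ?_
  · rw [h1]
    match k with
    | 0 => rfl
    | 1 =>
      change (-1 : K) ^ (0 + 1 : ℤ) • bracket K (A × B) _ _ = (-1 : K) • bracket K (A × B) _ _
      rw [zero_add, zpow_one]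
      rfl
    | k + 2 => rfl
  · rw [h2, BracketData.mix, pullOut_replicate (deg := Sigma.fst) (a := c) rfl, List.map_replicate]
    rfl

theorem isMaurerCartan_pairElt_iff [CharZero K] (Ω : homQ K A B 1) (r : B →ₗ[K] A) :
    IsMaurerCartan (V := Tot K A B) K (totDeg K A B) (fun k => ops K A B k) (pairElt Ω r) ↔
      (∀ u v w, toBilin Ω.val (toBilin Ω.val u v) w = toBilin Ω.val u (toBilin Ω.val v w)) ∧
      ∀ x y : B, (toBilin Ω.val (r x, 0) (0, y) + toBilin Ω.val (0, x) (r y, 0) +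
        toBilin Ω.val (r x, 0) (r y, 0)).1 =
          r (toBilin Ω.val (0, x) (0, y) + toBilin Ω.val (r x, 0) (0, y) +
            toBilin Ω.val (0, x) (r y, 0) + toBilin Ω.val (r x, 0) (r y, 0)).2 := by
  -- The 𝒬-part has degree 1, so `onList_ops_eq_zero` applies from length 1 + 4 on.
  have hz : ∀ k, 5 ≤ k →
      onList (fun k => ops K A B k) (List.replicate k (pairElt Ω r)) = 0 := by
    intro k hk
    refine onList_ops_eq_zero (D := 1) (fun y hy n hn => ?_) (by simpa using hk)
    rw [List.eq_of_mem_replicate hy]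
    exact (pairElt_mem Ω r).1 n (by omega)
  let X : Gerst K (A × B) := DirectSum.lof K ℕ _ 1 Ω.val
  let f : AbB K A B := (pairElt Ω r).2
  let P : ℕ → AbB K A B := fun k => proj ((gerstData K A B).iter X (List.replicate k f))
  have hP0 : P 0 = 0 := (mem_Q_iff _).1 (lof_mem_Q Ω.2)
  have hsum : ∑ k ∈ Finset.range 5, ((k.factorial : K)⁻¹) •
      onList (fun k => ops K A B k) (List.replicate k (pairElt Ω r)) =
        ((2 : K)⁻¹ • (-1 : K) • ⟨bracket K (A × B) X X, bracket_mem_Q (lof_mem_Q Ω.2) (lof_mem_Q Ω.2)⟩,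
          P 1 + (2 : K)⁻¹ • P 2 + (6 : K)⁻¹ • P 3) := by
    have h0 : onList (fun k => ops K A B k) (List.replicate 0 (pairElt Ω r)) = 0 := rfl
    rw [Finset.sum_range_succ', h0, smul_zero, add_zero]
    simp only [onList_ops_pairElt, Finset.sum_range_succ, Finset.sum_range_zero]
    refine Prod.ext ?_ ?_
    · simp [Nat.factorial]
      rfl
    · change (0 : AbB K A B) + _ • _ • P 0 + _ • _ • P 1 + _ • _ • P 2 + _ • _ • P 3 =
        P 1 + (2 : K)⁻¹ • P 2 + (6 : K)⁻¹ • P 3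
      rw [hP0]
      simp only [Nat.factorial]
      push_cast
      module
  have hP : P 1 + (2 : K)⁻¹ • P 2 + (6 : K)⁻¹ • P 3 = proj (DirectSum.lof K ℕ _ 1
      (adOne Ω.val (shift r) + (2 : K)⁻¹ • adOne (adOne Ω.val (shift r)) (shift r) +
        (6 : K)⁻¹ • adOne (adOne (adOne Ω.val (shift r)) (shift r)) (shift r))) := by
    have hf : incl f = DirectSum.lof K ℕ _ 0 (shift r) := incl_lof _
    have hstep : ∀ (Y : Multi K (A × B) 1) (L : List (AbB K A B)),
        (gerstData K A B).iter (DirectSum.lof K ℕ _ 1 Y) (f :: L) =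
          (gerstData K A B).iter (DirectSum.lof K ℕ _ 1 (adOne Y (shift r))) L := by
      intro Y L
      rw [← bracket_lof_one_zero, ← hf]
      rfl
    simp only [P, X, List.replicate_succ, List.replicate_zero, hstep, BracketData.iter_nil, map_add,
      map_smul]
  have h2 : (2 : K)⁻¹ ≠ 0 := by simp
  have h1 : (-1 : K) ≠ 0 := by simp
  rw [isMaurerCartan_iff (K := K) (V := Tot K A B) (𝒢 := totDeg K A B)
    (l := fun k => ops K A B k) rfl (pairElt_mem Ω r) hz, hsum, Prod.mk_eq_zero,
    smul_eq_zero_iff_right h2, smul_eq_zero_iff_right h1, hP, proj_lof_eq_zero_iff, mem_homQ_iff]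
  refine and_congr ?_ ?_
  · rw [← bracket_self_lof_one, ← Submodule.coe_eq_zero]
  · constructor
    · intro h x y
      have e : (fun i => ((0 : A), ![x, y] i)) = ![(0, x), (0, y)] := by
        funext i
        fin_cases i <;> rfl
      have h' := h ![x, y]
      rw [e, ← toBilin_apply, sum_adOne] at h'
      exact sub_eq_zero.1 h'
    · intro h v
      have e : (fun i => ((0 : A), v i)) = ![(0, v 0), (0, v 1)] := by
        funext i
        fin_cases i <;> rfl
      rw [e, ← toBilin_apply, sum_adOne]
      exact sub_eq_zero.2 (h (v 0) (v 1))

theorem isMaurerCartan_omegaQ_iff [CharZero K] (T : Tuple K A B) (r : B →ₗ[K] A) :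
    (T.IsQuasiTwilled ∧ T.IsWeakDeformationMap r) ↔
      IsMaurerCartan (V := Tot K A B) K (totDeg K A B) (fun k => ops K A B k)
        (pairElt T.omegaQ r) := by
  have e : ∀ u v, toBilin T.omegaQ.val u v = T.mul u v := fun u v => T.omega_apply ![u, v]
  rw [isMaurerCartan_pairElt_iff]
  simp only [e]
  refine and_congr ?_ (forall₂_congr fun x y => ?_)
  -- That B is a subalgebra is automatic, since a tuple has no component B ⊗ B → A.
  · refine ⟨fun h => h.1, fun h => ⟨h, fun x y => ?_⟩⟩
    simp [Tuple.mul]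
  · have e1 : (T.mul (r x, 0) (0, y) + T.mul (0, x) (r y, 0) + T.mul (r x, 0) (r y, 0)).1 =
        T.mu (r x) (r y) + T.rharp (r x) y + T.lharp x (r y) := by
      simp only [Tuple.mul, Prod.fst_add, map_zero, LinearMap.zero_apply]
      abel
    have e2 : (T.mul (0, x) (0, y) + T.mul (r x, 0) (0, y) + T.mul (0, x) (r y, 0) +
        T.mul (r x, 0) (r y, 0)).2 =
        T.nu x y + T.lact (r x) y + T.ract x (r y) + T.theta (r x) (r y) := by
      simp only [Tuple.mul, Prod.snd_add, map_zero, LinearMap.zero_apply]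
      abel
    rw [e1, e2]

/-- Since `pairElt` is additive and every element of `homQ` in degree 1 comes from a unique tuple,
this is `isMaurerCartan_twist_iff` read through the untwisted characterization at (Ω + Ω', r + r').
-/
theorem isMaurerCartan_twist_omegaQ_iff [CharZero K] (T : Tuple K A B) (r : B →ₗ[K] A)
    (hα : IsMaurerCartan (V := Tot K A B) K (totDeg K A B) (fun k => ops K A B k)
      (pairElt T.omegaQ r)) (Ω' : homQ K A B 1) (r' : B →ₗ[K] A) :
    (∃ T' : Tuple K A B, T'.omegaQ = T.omegaQ + Ω' ∧ T'.IsQuasiTwilled ∧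
      T'.IsWeakDeformationMap (r + r')) ↔
        IsMaurerCartan (V := Tot K A B) K (totDeg K A B)
          (twist K (fun k => ops K A B k) (pairElt T.omegaQ r)) (pairElt Ω' r') := by
  have h := isMaurerCartan_twist_iff (V := Tot K A B) isListLInfinity_ops isLocallyNilpotent_ops hα
    (pairElt_mem Ω' r')
  have h' := isMaurerCartan_omegaQ_iff (Tuple.ofMulti (T.omegaQ + Ω').val) (r + r')
  rw [Tuple.omegaQ_ofMulti, ← pairElt_add] at h'
  refine Iff.trans ?_ (h'.trans h.symm)
  constructor
  · rintro ⟨T', h1, h2⟩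
    rw [← h1]
    change (Tuple.ofMulti T'.omega).IsQuasiTwilled ∧ _
    rw [Tuple.ofMulti_omega]
    change _ ∧ (Tuple.ofMulti T'.omega).IsWeakDeformationMap _
    rw [Tuple.ofMulti_omega]
    exact h2
  · exact fun h => ⟨_, Tuple.omegaQ_ofMulti _, h⟩

end MaurerCartan

end QuasiTwilled

end

theorem mainTheorem9 {K : Type*} [Field K] [CharZero K] {A B : Type*}
    [AddCommGroup A] [Module K A] [AddCommGroup B] [Module K B] :
    -- `𝒬[1] ⊕ 𝔟` with the operations `l_k` is an `L_∞`-algebra, weakly filtered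
    (IsLInfinity K (totDeg K A B) (fun k => ops K A B k) ∧
      IsWeaklyFiltered K (totDeg K A B) (fun k => ops K A B k)) ∧
    -- the structure maps: `l_2(F[1], G[1]) = (-1)^{|F|} [F, G][1]`
    (∀ (m : ℕ) (F G : Q K A B), (∀ n, n ≠ m → F.val n = 0) →
      ops K A B 2 ![(F, 0), (G, 0)] =
        ((-1 : K) ^ m • ⟨bracket K (A × B) F.val G.val, bracket_mem_Q F.2 G.2⟩, 0)) ∧
    -- `l_k(F[1], f_1, …, f_{k-1}) = P[⋯[[F, f_1], f_2], …, f_{k-1}]` for `k ≥ 2`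
    (∀ (k : ℕ), 1 ≤ k → ∀ (F : Q K A B) (f : Fin k → AbB K A B),
      ops K A B (k + 1) (Fin.cons (F, 0) fun j => (0, f j)) =
        (0, proj (iterBracket k F.val f))) ∧
    -- all the other structure maps vanish
    (∀ x, ops K A B 1 x = 0) ∧
    (∀ (k : ℕ) (f : Fin k → AbB K A B), ops K A B k (fun j => (0, f j)) = 0) ∧
    (∀ (k : ℕ), 3 ≤ k → ∀ (x : Fin k → Tot K A B) (i j : Fin k), i ≠ j →
      (x i).2 = 0 → (x j).2 = 0 → ops K A B k x = 0) ∧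
    -- every element of degree `0` is `(Ω[1], r)` for exactly one tuple and one linear map `r`
    (∀ α ∈ totDeg K A B 0, ∃! p : Tuple K A B × (B →ₗ[K] A), α = pairElt p.1.omegaQ p.2) ∧
    -- the Maurer-Cartan elements
    (∀ (T : Tuple K A B) (r : B →ₗ[K] A),
      (T.IsQuasiTwilled ∧ T.IsWeakDeformationMap r) ↔
        IsMaurerCartan K (totDeg K A B) (fun k => ops K A B k) (pairElt T.omegaQ r)) ∧
    -- the twisted algebra governs the simultaneous deformations
    (∀ (T : Tuple K A B) (r : B →ₗ[K] A), T.IsQuasiTwilled → T.IsWeakDeformationMap r →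
      (∀ (k : ℕ) (x : Fin k → Tot K A B), (Function.support
        (twistTerm K (fun k => ops K A B k) (pairElt T.omegaQ r) k x)).Finite) ∧
      IsLInfinity K (totDeg K A B)
        (twist K (fun k => ops K A B k) (pairElt T.omegaQ r)) ∧
      IsWeaklyFiltered K (totDeg K A B)
        (twist K (fun k => ops K A B k) (pairElt T.omegaQ r)) ∧
      ∀ (Ω' : homQ K A B 1) (r' : B →ₗ[K] A),
        (∃ T' : Tuple K A B, T'.omegaQ = T.omegaQ + Ω' ∧ T'.IsQuasiTwilled ∧
          T'.IsWeakDeformationMap (r + r')) ↔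
        IsMaurerCartan K (totDeg K A B)
          (twist K (fun k => ops K A B k) (pairElt T.omegaQ r)) (pairElt Ω' r')) := by
  refine ⟨⟨isListLInfinity_ops.isLInfinity,
    isWeaklyFiltered_of_mem_arityFiltration _ ops_mem_arityFiltration⟩, ops_two_of_homogeneous,
    ops_cons, fun _ => rfl, ops_of_fst_eq_zero, ops_of_snd_eq_zero, existsUnique_eq_pairElt,
    isMaurerCartan_omegaQ_iff, fun T r hT hr => ?_⟩
  have hα := (isMaurerCartan_omegaQ_iff T r).1 ⟨hT, hr⟩
  have hfin := finite_support_twistTerm (pairElt T.omegaQ r)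
  exact ⟨hfin, (isListLInfinity_ops.twist isLocallyNilpotent_ops hα hfin).isLInfinity,
    isWeaklyFiltered_of_mem_arityFiltration _ (twist_mem_arityFiltration _),
    isMaurerCartan_twist_omegaQ_iff T r hα⟩
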